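/- **Setting.** Let $V\subseteq H\equiv H^*\subseteq V^*$ be a Gelfand triple: $H$ is a separable real Hilbert space and $V$ is a reflexive real Banach space that is continuously and densely embedded in $H$. Assume moreover that the embedding $V\subseteq H$ is compact. Let $(\Omega,\mathcal F,\mathbb P,\{\theta_t\}_{t\in\mathbb R})$ be a metric dynamical system: $(\Omega,\mathcal F,\mathbb P)$ is a probability space, $(t,\omega)\mapsto\theta_t\omega$ is measurable, $\theta_0=\mathrm{id}$, $\theta_{t+s}=\theta_t\circ\theta_s$, and each $\theta_t$ preserves $\mathbb P$. Let $\alpha\in(1,2)$. **Drift.** Let $A:\mathbb R\times V\times\Omega\to V^*$ be such that $A(\cdot,\cdot;\omega)$ is Borel measurable for each $\omega$, and let $c:\Omega\to(0,\infty)$, $C_2:\Omega\to\mathbb R$ (both constant in time) and $f:\mathbb R\times\Omega\to\mathbb R$ be such that for all $v,v_1,v_2\in V$, $t\in\mathbb R$, $\omega\in\Omega$: 1. $s\mapsto\langle A(t,v_1+sv_2;\omega),v\rangle$ is continuous on $\mathbb R$; 2. $2\langle A(t,v_1;\omega)-A(t,v_2;\omega),v_1-v_2\rangle\le C_2(\omega)\|v_1-v_2\|_H^2$;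 3. $2\langle A(t,v;\omega),v\rangle\le -c(\omega)\|v\|_V^\alpha+f(t,\omega)$; 4. $\|A(t,v;\omega)\|_{V^*}^{\alpha/(\alpha-1)}\le C_2(\omega)\|v\|_V^\alpha+f(t,\omega)$; 5. $f(\cdot,\omega)$ is càdlàg (hence locally integrable) and $f(t,\omega)=o(|t|^{\alpha/(2-\alpha)})$ as $t\to-\infty$. **Noise.** Let $N_t$, $t\in\mathbb R$, be a $V$-valued stochastic process with càdlàg paths in $V$ such that $N_t(\omega)-N_s(\omega)=N_{t-s}(\theta_s\omega)-N_0(\theta_s\omega)$ for all $t,s\in\mathbb R$ and $\omega\in\Omega$, and such that for $\mathbb P$-almost every $\omega$, $\|N_t(\omega)\|_V=o(|t|^{1/(2-\alpha)})$ as $t\to-\infty$. **Flow.** A flow of solutions of $dX_t=A(t,X_t)\,dt+dN_t$ is a family of maps $S(t,s;\omega):H\to H$, $s\le t$, such that for all $s,\omega,x$ the function $Z(t)=S(t,s;\omega)x-N_t(\omega)$ lies in $C([s,\infty);H)\cap L^\alpha_{\mathrm{loc}}([s,\infty);V)$ and $$Z(t)=x-N_s(\omega)+\int_s^tA\big(r,Z(r)+N_r(\omega);\omega\big)\,dr\quad\text{in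 }V^*,\ t\ge s,$$ that is, $S(t,s;\omega)x=x+\int_s^tA(r,S(r,s;\omega)x;\omega)\,dr+N_t(\omega)-N_s(\omega)$. **Attractors.** Let $d(B,C)=\sup_{b\in B}\inf_{a\in C}\|b-a\|_H$. For a system $\mathcal D$ of families $D=\{D(t,\omega)\}_{t\in\mathbb R,\,\omega\in\Omega}$ of subsets of $H$, a family $\mathcal A=\{\mathcal A(t,\omega)\}$ is a random $\mathcal D$-attractor of $S$ if, for all $\omega$ outside a $\mathbb P$-null set, the following hold: each $\mathcal A(t,\omega)$, $t\in\mathbb R$, is nonempty and compact; $d(S(t,s;\omega)D(s,\omega),\mathcal A(t,\omega))\to0$ as $s\to-\infty$ for all $D\in\mathcal D$ and $t\in\mathbb R$; and $S(t,s;\omega)\mathcal A(s,\omega)=\mathcal A(t,\omega)$ for all $s\le t$. A family $D$ is *measurable* (a random closed set) if it is $\mathbb P$-a.s. closed and $\omega\mapsto d(x,D(t,\omega))$ is measurable for all $x\in H$, $t\in\mathbb R$; it is *strictly stationary* if $D(t,\omega)=D(0,\theta_t\omega)$ for all $t,\omega$. Let $\mathcal D^\alpha$ be the system of all families $D$ with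 $\lim_{t\to-\infty}|t|^{-1/(2-\alpha)}\sup_{b\in D(t,\omega)}\|b\|_H=0$ for all $\omega\in\Omega$, and let $\mathcal D^b$ be the system of all constant families $D(t,\omega)=B$ with $B\subseteq H$ bounded. **Theorem.** There is a unique flow $S$ of solutions of $dX_t=A(t,X_t)\,dt+dN_t$; it is a stochastic flow, i.e. $S(s,s;\omega)=\mathrm{id}_H$ and $S(t,s;\omega)=S(t,r;\omega)\circ S(r,s;\omega)$ for $s\le r\le t$; and: (i) $S$ has a random $\mathcal D^\alpha$-attractor $\mathcal A^\alpha$ with $\mathcal A^\alpha\in\mathcal D^\alpha$; if $A$ is $\mathcal B(\mathbb R)\otimes\mathcal B(V)\otimes\mathcal F$-measurable and $f(t,\cdot)$ is $\mathcal F$-measurable for each $t$, then $\mathcal A^\alpha$ is measurable. (ii) If $A$ is strictly stationary, i.e. $A(t,v;\omega)=A(0,v;\theta_t\omega)$ for all $t,v,\omega$, then $S$ has a strictly stationary random $\mathcal D^b$-attractor $\mathcal A^b$, which is measurable if $A$ is $\mathcal B(\mathbb R)\otimes\mathcal B(V)\otimes\mathcal F$-measurable. -/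

import Mathlib

open Set Filter Topology MeasureTheory
open scoped ENNReal

/-- A metric dynamical system on the probability space `(Ω, P)`: a jointly measurable group
`θ` of `P`-preserving transformations indexed by the real line. -/
structure IsMetricDynamicalSystem {Ω : Type*} [MeasurableSpace Ω] (P : Measure Ω)
    (θ : ℝ → Ω → Ω) : Prop where
  measurable_uncurry : Measurable (fun p : ℝ × Ω => θ p.1 p.2)
  zero : ∀ ω, θ 0 ω = ω
  add : ∀ s t ω, θ (t + s) ω = θ t (θ s ω)
  measurePreserving : ∀ t, MeasurePreserving (θ t) P P

/-- Right-continuous with left limits at every time. -/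
def IsCadlag {E : Type*} [TopologicalSpace E] (g : ℝ → E) : Prop :=
  ∀ t, ContinuousWithinAt g (Ici t) t ∧ ∃ l, Tendsto g (𝓝[<] t) (𝓝 l)

section Flow

variable {Ω H : Type*}

/-- A stochastic flow; `S t s ω x` is the state at time `t` started from `x` at time `s`.
Only the values with `s ≤ t` are meaningful. -/
structure IsStochasticFlow (S : ℝ → ℝ → Ω → H → H) : Prop where
  refl : ∀ s ω x, S s s ω x = x
  comp : ∀ s r t ω x, s ≤ r → r ≤ t → S t s ω x = S t r ω (S r s ω x)

/-- Strict stationarity of a time-dependent random family of sets. -/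
def IsStrictlyStationarySet (θ : ℝ → Ω → Ω) (D : ℝ → Ω → Set H) : Prop :=
  ∀ t ω, D t ω = D 0 (θ t ω)

/-- A random closed set: almost surely closed, and the distance to each point is measurable. -/
def IsRandomClosedSet [MeasurableSpace Ω] [PseudoEMetricSpace H] (P : Measure Ω)
    (D : ℝ → Ω → Set H) : Prop :=
  (∀ᵐ ω ∂P, ∀ t, IsClosed (D t ω)) ∧
    ∀ (t : ℝ) (x : H), Measurable (fun ω => Metric.infEDist x (D t ω))

/-- The Hausdorff semi-distance `d(B, C) = sup_{b ∈ B} d(b, C)`. -/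
noncomputable def semiDist [PseudoEMetricSpace H] (B C : Set H) : ℝ≥0∞ :=
  ⨆ b ∈ B, Metric.infEDist b C

/-- `F` is (pullback) attracting for the system `𝒟` of families of sets. The exceptional null
set does not depend on the member of `𝒟`, nor on time. -/
def IsAttracting [MeasurableSpace Ω] [PseudoEMetricSpace H] (P : Measure Ω)
    (𝒟 : Set (ℝ → Ω → Set H)) (S : ℝ → ℝ → Ω → H → H) (F : ℝ → Ω → Set H) : Prop :=
  ∀ᵐ ω ∂P, ∀ D ∈ 𝒟, ∀ t : ℝ,
    Tendsto (fun s => semiDist (S t s ω '' D s ω) (F t ω)) atBot (𝓝 0)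

/-- A random `𝒟`-attractor of the flow `S`: almost surely nonempty and compact at each time,
`𝒟`-attracting, and invariant. -/
structure IsRandomAttractor [MeasurableSpace Ω] [PseudoEMetricSpace H] (P : Measure Ω)
    (𝒟 : Set (ℝ → Ω → Set H)) (S : ℝ → ℝ → Ω → H → H) (𝒜 : ℝ → Ω → Set H) : Prop where
  nonempty_compact : ∀ᵐ ω ∂P, ∀ t, (𝒜 t ω).Nonempty ∧ IsCompact (𝒜 t ω)
  attracting : IsAttracting P 𝒟 S 𝒜
  invariant : ∀ᵐ ω ∂P, ∀ s t, s ≤ t → S t s ω '' 𝒜 s ω = 𝒜 t ω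

/-- `‖B‖ = sup_{b ∈ B} ‖b‖`, equal to `∞` for unbounded sets. -/
noncomputable def setNorm [NormedAddCommGroup H] (B : Set H) : ℝ≥0∞ :=
  ⨆ b ∈ B, ‖b‖ₑ

/-- The system of all families of sets of subpolynomial growth of order `β` at `-∞`. -/
def subpolynomialFamilies (Ω H : Type*) [NormedAddCommGroup H] (β : ℝ) :
    Set (ℝ → Ω → Set H) :=
  {D | ∀ ω, Tendsto (fun t : ℝ => setNorm (D t ω) / ENNReal.ofReal (|t| ^ β)) atBot (𝓝 0)}

/-- The system of all deterministic bounded sets (constant in time and in `ω`). -/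
def deterministicBoundedFamilies (Ω H : Type*) [NormedAddCommGroup H] :
    Set (ℝ → Ω → Set H) :=
  {D | ∃ B : Set H, Bornology.IsBounded B ∧ D = fun _ _ => B}

end Flow

section Equation

variable {Ω V H : Type*} [NormedAddCommGroup V] [NormedSpace ℝ V]

/-- A Gelfand triple `V ⊆ H ≡ H* ⊆ V*`, where `ι` is the embedding of `V` into `H`: `V` is a
reflexive Banach space, `H` is a separable Hilbert space, and `ι` is continuous, injective and
has dense range. -/
structure IsGelfandTriple [NormedAddCommGroup H] [InnerProductSpace ℝ H] (ι : V →L[ℝ] H) :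
    Prop where
  complete_V : CompleteSpace V
  reflexive_V : Function.Surjective (NormedSpace.inclusionInDoubleDual ℝ V)
  complete_H : CompleteSpace H
  separable_H : TopologicalSpace.SeparableSpace H
  injective : Function.Injective ι
  denseRange : DenseRange ι

/-- The embedding `H ≡ H* ⊆ V*`, `h ↦ ⟨h, ι ·⟩`. -/
noncomputable def toDualV [NormedAddCommGroup H] [InnerProductSpace ℝ H] (ι : V →L[ℝ] H)
    (h : H) : StrongDual ℝ V :=
  (innerSL ℝ h).comp ι

/-- The standing assumptions on the drift `A : ℝ × V × Ω → V*` with coefficients `C₁`, `C₂`, `c`,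
`f` and exponent `α`: measurability in `(t, v)`, right-continuity of the coefficients `C₁`, `C₂`
and `c > 0`, hemicontinuity, (weak) monotonicity, coercivity and growth. -/
structure DriftAssumptions [NormedAddCommGroup H] [InnerProductSpace ℝ H]
    [MeasurableSpace V] (ι : V →L[ℝ] H) (A : ℝ → V → Ω → StrongDual ℝ V)
    (α : ℝ) (C₁ C₂ c f : ℝ → Ω → ℝ) : Prop where
  measurable : ∀ ω, Measurable (fun p : ℝ × V => A p.1 p.2 ω)
  rightCts_C₁ : ∀ ω t, ContinuousWithinAt (fun r => C₁ r ω) (Ici t) t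
  rightCts_C₂ : ∀ ω t, ContinuousWithinAt (fun r => C₂ r ω) (Ici t) t
  rightCts_c : ∀ ω t, ContinuousWithinAt (fun r => c r ω) (Ici t) t
  c_pos : ∀ t ω, 0 < c t ω
  locallyIntegrable_f : ∀ ω, LocallyIntegrable (fun t => f t ω) volume
  hemicontinuity : ∀ (v v₁ v₂ : V) (t : ℝ) (ω : Ω),
    Continuous (fun s : ℝ => A t (v₁ + s • v₂) ω v)
  monotonicity : ∀ (v₁ v₂ : V) (t : ℝ) (ω : Ω),
    2 * (A t v₁ ω - A t v₂ ω) (v₁ - v₂) ≤ C₂ t ω * ‖ι (v₁ - v₂)‖ ^ 2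
  coercivity : ∀ (v : V) (t : ℝ) (ω : Ω),
    2 * A t v ω v ≤ C₁ t ω * ‖ι v‖ ^ 2 - c t ω * ‖v‖ ^ α + f t ω
  growth : ∀ (v : V) (t : ℝ) (ω : Ω),
    ‖A t v ω‖ ^ (α / (α - 1)) ≤ C₁ t ω * ‖ι v‖ ^ 2 + C₂ t ω * ‖v‖ ^ α + f t ω

/-- Strict stationarity of the drift. -/
def IsStrictlyStationaryDrift (θ : ℝ → Ω → Ω) (A : ℝ → V → Ω → StrongDual ℝ V) : Prop :=
  ∀ t v ω, A t v ω = A 0 v (θ t ω)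

/-- Joint measurability of the drift in `(t, v, ω)`. -/
def IsMeasurableDrift [MeasurableSpace Ω] [MeasurableSpace V]
    (A : ℝ → V → Ω → StrongDual ℝ V) : Prop :=
  Measurable (fun p : ℝ × V × Ω => A p.1 p.2.1 p.2.2)

/-- `Z` is the variational solution on `[s, ∞)` of `Z(t) = z + ∫_s^t B(r, Z(r)) dr`: `Z` belongs
to `C([s, ∞); H) ∩ L^α_loc([s, ∞); V)` and the equation holds in `V*`. Here `u` is the `V`-valued
version of `Z`; that is, `Z(r) = u(r) ∈ V` for almost every `r ≥ s`. -/
def IsVariationalSolution [NormedAddCommGroup H] [InnerProductSpace ℝ H] (ι : V →L[ℝ] H)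
    (α : ℝ) (B : ℝ → V → StrongDual ℝ V) (s : ℝ) (z : H) (Z : ℝ → H) : Prop :=
  ContinuousOn Z (Ici s) ∧
    ∃ u : ℝ → V,
      (∀ᵐ r ∂(volume.restrict (Ici s)), ι (u r) = Z r) ∧
      (∀ t, MemLp u (ENNReal.ofReal α) (volume.restrict (Icc s t))) ∧
      ∀ t, s ≤ t →
        IntervalIntegrable (fun r => B r (u r)) volume s t ∧
        toDualV ι (Z t) = toDualV ι z + ∫ r in s..t, B r (u r)

/-- `S` is the flow of solutions to `dX_t = A(t, X_t) dt + dN_t`: for all `s`, `ω`, `x`,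
the function `Z(t) = S(t, s; ω) x - N_t(ω)` is the variational solution on `[s, ∞)` of the random
equation `Z(t) = (x - N_s(ω)) + ∫_s^t A(r, Z(r) + N_r(ω); ω) dr`. Equivalently, `X = S(·, s; ω) x`
satisfies `X_t = x + ∫_s^t A(r, X_r; ω) dr + N_t(ω) - N_s(ω)` for `t ≥ s`. -/
def IsSolutionFlow [NormedAddCommGroup H] [InnerProductSpace ℝ H] (ι : V →L[ℝ] H)
    (α : ℝ) (A : ℝ → V → Ω → StrongDual ℝ V) (N : ℝ → Ω → V)
    (S : ℝ → ℝ → Ω → H → H) : Prop :=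
  ∀ (s : ℝ) (ω : Ω) (x : H),
    IsVariationalSolution ι α (fun r v => A r (v + N r ω) ω) s (x - ι (N s ω))
      (fun t => S t s ω x - ι (N t ω))

/-- The noise: a `V`-valued process on a metric dynamical system with strictly stationary
increments, càdlàg paths, and growth `‖N_t‖ = o(|t|^{1/(2-α)})` as `t → -∞`,
almost surely. -/
structure NoiseAssumptions [MeasurableSpace Ω] [MeasurableSpace V] (P : Measure Ω)
    (θ : ℝ → Ω → Ω) (α : ℝ) (N : ℝ → Ω → V) : Prop where
  measurable : ∀ t, Measurable (N t)
  stationary_increments : ∀ t s ω, N t ω - N s ω = N (t - s) (θ s ω) - N 0 (θ s ω)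
  cadlag : ∀ ω, IsCadlag (fun t => N t ω)
  growth : ∀ᵐ ω ∂P, (fun t => N t ω) =o[atBot] (fun t : ℝ => |t| ^ (1 / (2 - α)))

end Equation

/-!
Fix `ω`. In terms of `Z = X - N` the equation is a deterministic evolution equation
`Z' = B t (Z t)` in `V*`, where `B t v = A t (v + N t)` is monotone up to a multiple of the
`H`-norm, hemicontinuous, and, because `N` is locally bounded in `V`, coercive and of growth `α`
(`DriftAssumptions.exists_isMonotoneDrift`). The proof solves this equation, controls its
solutions as the initial time tends to `-∞`, and passes to pullback limits.

*Solutions.* The equality of energy `energy_eq` is proved directly in `L^p`–`L^q` duality by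
Steklov averages. With monotonicity it shows that two solutions separate at most exponentially
(`IsVariationalSolution.norm_sub_sq_le`), which gives uniqueness, the flow property and continuity
in the initial value. For existence, `B` is compressed to subspaces of `V` spanned by finitely
many vectors; the resulting ordinary differential equations have a right-hand side which is only
measurable in time and one-sided Lipschitz in space, and are solved by a delay scheme
(`IsOneSidedLipschitz.exists_solution`). The Galerkin approximations are bounded uniformly in `H`
and in `L^α(V)`, and their drifts in the dual space. Along a subsequence they converge weakly in
`H` at every time, hence, by compactness of the embedding, strongly in `L²(H)`, and the drift of
the limit is identified by the equality of energy and Minty's trick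
(`IsGalerkinApprox.toDualV_eq`, `tendsto_apply_of_minty`). By uniqueness the whole sequence
converges, so a solution depends measurably on any parameter on which the drift and the initial
value do (`measurable_of_isVariationalSolution`).

*Compactness.* On a bounded time interval, solutions starting in a bounded set are bounded in
`L^α(V)`, hence bounded in `V` at suitable intermediate times. Since `V` embeds compactly in `H`,
solutions from bounded initial values have subsequences converging in `H` at some earlier time,
and therefore, by continuity in the initial value, at every later time
(`exists_subseq_tendsto_of_isVariationalSolution`).

*Absorption.* As `α < 2`, the inequality `(‖Z‖²)' ≤ -c ‖Z‖ ^ α + g` does not force decay at an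
exponential rate, but it does at the rate of the comparison functions `(a - κ t) ^ (1 / (2 - α))`
(`IsVariationalSolution.norm_le_rpow`). Let `β = 1 / (2 - α)`. The perturbation `g` consists of
the function `f` and of `‖N‖ ^ α`, and both are of order `o(|t| ^ (α β))` at `-∞`. Hence, for a
sufficiently small `ε`, every solution which starts at time `s` in the ball of radius `ε |s| ^ β`
lies at time `t` in the ball of radius `ε' |t| ^ β`, if `t` is close enough to `-∞` (depending on
`ε'`) and `s` is close enough to `-∞` (depending on `t` and `ε'`): this is `exists_absorption`. A
family in the class of families of growth `o(|t| ^ β)` is eventually contained in these balls.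

*Attractors.* The attractor for families of growth `o(|t| ^ β)` is the pullback limit set of the
balls of radius `ε |s| ^ β` (`growthAttractor`); absorption for every `ε'` puts it into the class
which it attracts. The attractor for bounded sets is the closure of the union of the pullback
limit sets of all bounded balls (`boundedAttractor`), a subset of the former one and hence
compact. The constants `ε` may depend on `ω` in a nonmeasurable way. The measurability of the
attractors comes from formulas for the distance to them in which no nonmeasurable dependence
remains (`IsCompactProcess.infEDist_pullbackLimitSet_growthBall`,
`IsCompactProcess.infEDist_boundedLimitSet`). Uniqueness of solutions turns stationarity of the
drift and of the increments of the noise into covariance of the flow under `θ`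
(`IsSolutionFlow.apply_eq_shift`). The limit sets of balls are covariant too, and the event on
which the noise has the required growth is invariant under `θ`, so the second attractor is
strictly stationary.
-/

/-! ### Duality pairings and Steklov averages in Bochner spaces -/

/-- Translations act continuously on `L^p`, `1 ≤ p < ∞`. -/
lemma exists_eLpNorm_translate_sub_lt {E : Type*} [NormedAddCommGroup E] {p : ℝ≥0∞}
    (hp1 : 1 ≤ p) (hp : p ≠ ∞) {u : ℝ → E}
    (hu : MemLp u p volume) {ε : ℝ} (hε : 0 < ε) :
    ∃ δ > 0, ∀ τ : ℝ, |τ| < δ → (eLpNorm (fun r => u (r - τ) - u r) p volume).toReal < ε := by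
  have : Fact (1 ≤ p) := ⟨hp1⟩
  let g : ℝ → C(ℝ, ℝ) := fun τ => ⟨fun r => r - τ, by fun_prop⟩
  have hg : Continuous g := ContinuousMap.continuous_of_continuous_uncurry _ (by
    change Continuous (fun x : ℝ × ℝ => x.2 - x.1); fun_prop)
  have hgm : ∀ τ, MeasurePreserving (g τ) volume volume := fun τ =>
    measurePreserving_sub_right volume τ
  have hc := (continuous_const (y := hu.toLp u)).compMeasurePreservingLp hg hgm hp
  have h0 := Metric.tendsto_nhds.1 (hc.continuousAt (x := 0)) ε hε
  obtain ⟨δ, hδ, h⟩ := Metric.eventually_nhds_iff.1 h0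
  refine ⟨δ, hδ, fun τ hτ => ?_⟩
  have := h (y := τ) (by simpa [Real.dist_eq] using hτ)
  rw [Lp.dist_def] at this
  refine lt_of_eq_of_lt ?_ this
  congr 1
  apply eLpNorm_congr_ae
  have h1 := Lp.coeFn_compMeasurePreserving (hu.toLp u) (hgm τ)
  have h2 := Lp.coeFn_compMeasurePreserving (hu.toLp u) (hgm 0)
  have h3 := (hgm τ).quasiMeasurePreserving.ae_eq_comp (hu.coeFn_toLp)
  have h4 := (hgm 0).quasiMeasurePreserving.ae_eq_comp (hu.coeFn_toLp)
  filter_upwards [h1, h2, h3, h4] with r h1 h2 h3 h4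
  simp only [Pi.sub_apply]
  rw [h1, h2, h3, h4]
  simp [g]

section Pairing

variable {V : Type*} [NormedAddCommGroup V] [NormedSpace ℝ V]

lemma MeasureTheory.AEStronglyMeasurable.dual_apply {X : Type*} [MeasurableSpace X]
    {μ : Measure X} {b : X → StrongDual ℝ V} {u : X → V} (hb : AEStronglyMeasurable b μ)
    (hu : AEStronglyMeasurable u μ) : AEStronglyMeasurable (fun r => b r (u r)) μ :=
  isBoundedBilinearMap_apply.continuous.comp_aestronglyMeasurable (hb.prodMk hu)

lemma MeasureTheory.MemLp.dual_apply {X : Type*} [MeasurableSpace X] {μ : Measure X}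
    {p q : ℝ≥0∞} [p.HolderConjugate q] {b : X → StrongDual ℝ V} {u : X → V}
    (hb : MemLp b q μ) (hu : MemLp u p μ) : Integrable (fun r => b r (u r)) μ := by
  rw [← memLp_one_iff_integrable]
  have h := MemLp.of_bilin (r := 1) (p := q) (q := p) (μ := μ) (f := b) (g := u)
    (fun (x : StrongDual ℝ V) (y : V) => x y) 1 hb hu
    (hb.aestronglyMeasurable.dual_apply hu.aestronglyMeasurable)
    (Eventually.of_forall fun r => by simpa using (b r).le_opNNNorm (u r))
  exact h

lemma integral_norm_dual_apply_le {X : Type*} [MeasurableSpace X] {μ : Measure X}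
    {p q : ℝ≥0∞} [p.HolderConjugate q] {b : X → StrongDual ℝ V} {u : X → V}
    (hb : MemLp b q μ) (hu : MemLp u p μ) :
    ∫ r, ‖b r (u r)‖ ∂μ ≤ (eLpNorm b q μ).toReal * (eLpNorm u p μ).toReal := by
  have h := eLpNorm_le_eLpNorm_mul_eLpNorm'_of_norm (r := 1) (p := q) (q := p)
    hb.aestronglyMeasurable hu.aestronglyMeasurable
    (fun (x : StrongDual ℝ V) (y : V) => x y) 1
    (Eventually.of_forall fun r => by simpa using (b r).le_opNorm (u r))
  have hi := hb.dual_apply hu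
  rw [integral_norm_eq_lintegral_enorm hi.aestronglyMeasurable, ← eLpNorm_one_eq_lintegral_enorm,
    ← ENNReal.toReal_mul]
  refine ENNReal.toReal_mono (ENNReal.mul_ne_top hb.eLpNorm_ne_top hu.eLpNorm_ne_top) ?_
  simpa using h

/-- Hölder's inequality for the duality pairing. -/
lemma abs_integral_dual_apply_le {X : Type*} [MeasurableSpace X] {μ : Measure X}
    {p q : ℝ≥0∞} [p.HolderConjugate q] {b : X → StrongDual ℝ V} {u : X → V}
    (hb : MemLp b q μ) (hu : MemLp u p μ) :
    |∫ r, b r (u r) ∂μ| ≤ (eLpNorm b q μ).toReal * (eLpNorm u p μ).toReal :=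
  (norm_integral_le_integral_norm _).trans (integral_norm_dual_apply_le hb hu)

lemma memLp_translate {E : Type*} [NormedAddCommGroup E] {p : ℝ≥0∞} {b : ℝ → E}
    (hb : MemLp b p volume) (τ : ℝ) :
    MemLp (fun r => b (r + τ)) p volume :=
  hb.comp_measurePreserving (measurePreserving_add_right volume τ)

lemma eLpNorm_translate {E : Type*} [NormedAddCommGroup E] {p : ℝ≥0∞} {b : ℝ → E}
    (hb : MemLp b p volume) (τ : ℝ) :
    eLpNorm (fun r => b (r + τ)) p volume = eLpNorm b p volume :=
  eLpNorm_comp_measurePreserving hb.aestronglyMeasurable (measurePreserving_add_right volume τ)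

lemma abs_integral_translate_pairing_sub_le {p q : ℝ≥0∞} [p.HolderConjugate q]
    {b : ℝ → StrongDual ℝ V} {u : ℝ → V} (hb : MemLp b q volume) (hu : MemLp u p volume) (τ : ℝ) :
    |(∫ r, b (r + τ) (u r)) - ∫ r, b r (u r)| ≤
      (eLpNorm b q volume).toReal * (eLpNorm (fun r => u (r - τ) - u r) p volume).toReal := by
  have hu' : MemLp (fun r => u (r - τ)) p volume := by
    simpa [sub_eq_add_neg] using memLp_translate hu (-τ)
  have h1 : (∫ r, b (r + τ) (u r)) = ∫ r, b r (u (r - τ)) := by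
    rw [← integral_add_right_eq_self (fun r => b r (u (r - τ))) τ]
    simp
  rw [h1, ← integral_sub (hb.dual_apply hu') (hb.dual_apply hu)]
  simp_rw [← map_sub]
  exact abs_integral_dual_apply_le hb (hu'.sub hu)

lemma integrableOn_of_memLp {E : Type*} [NormedAddCommGroup E] {p : ℝ≥0∞} (hp : 1 ≤ p)
    {b : ℝ → E} (hb : MemLp b p volume) {s : Set ℝ} (hs : volume s ≠ ∞) :
    IntegrableOn b s volume := by
  have : IsFiniteMeasure (volume.restrict s) := ⟨by simpa [lt_top_iff_ne_top] using hs⟩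
  exact (hb.restrict s).integrable hp

lemma intervalIntegrable_of_memLp {E : Type*} [NormedAddCommGroup E] {p : ℝ≥0∞} (hp : 1 ≤ p)
    {b : ℝ → E} (hb : MemLp b p volume) (x y : ℝ) : IntervalIntegrable b volume x y :=
  intervalIntegrable_iff.2 (integrableOn_of_memLp hp hb (by simp [uIoc]))

/-- Fubini for the pairing of a Steklov average with a function. -/
lemma integral_steklov_pairing {p q : ℝ≥0∞} [p.HolderConjugate q]
    {b : ℝ → StrongDual ℝ V} {u : ℝ → V} (hb : MemLp b q volume) (hu : MemLp u p volume)
    {h : ℝ} (hh : 0 ≤ h) :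
    (∫ r, (∫ ρ in r..(r + h), b ρ) (u r)) = ∫ τ in (0 : ℝ)..h, ∫ r, b (r + τ) (u r) := by
  have hq : 1 ≤ q := (ENNReal.HolderConjugate.symm (p := p) (q := q)).one_le
  have h1 : ∀ r, (∫ ρ in r..(r + h), b ρ) (u r) = ∫ τ in Ioc 0 h, b (r + τ) (u r) := by
    intro r
    have e : (∫ ρ in r..(r + h), b ρ) = ∫ τ in (0 : ℝ)..h, b (r + τ) := by
      rw [intervalIntegral.integral_comp_add_left]; simp
    have hi : IntegrableOn (fun τ => b (r + τ)) (Ioc 0 h) volume := by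
      refine integrableOn_of_memLp hq ?_ (by simp)
      simpa [add_comm] using memLp_translate hb r
    rw [e, intervalIntegral.integral_of_le hh]
    exact ContinuousLinearMap.integral_apply hi (u r)
  simp_rw [h1]
  rw [intervalIntegral.integral_of_le hh, integral_integral_swap]
  have hmeas : AEStronglyMeasurable (Function.uncurry fun r τ => b (r + τ) (u r))
      (volume.prod (volume.restrict (Ioc 0 h))) := by
    have hm1 : AEStronglyMeasurable (fun z : ℝ × ℝ => b (z.1 + z.2))
        (volume.prod (volume : Measure ℝ)) :=
      hb.aestronglyMeasurable.comp_quasiMeasurePreserving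
        (quasiMeasurePreserving_add volume volume)
    have hm1' := hm1.mono_measure (Measure.prod_mono le_rfl Measure.restrict_le_self :
      (volume : Measure ℝ).prod (volume.restrict (Ioc 0 h)) ≤ volume.prod volume)
    exact hm1'.dual_apply hu.aestronglyMeasurable.comp_fst
  -- integrability on the product: the translates of `b` all have the same norm in `L^q`
  rw [integrable_prod_iff' hmeas]
  refine ⟨Eventually.of_forall fun τ => (memLp_translate hb τ).dual_apply hu, ?_⟩
  refine Integrable.mono' (g := fun _ => (eLpNorm b q volume).toReal * (eLpNorm u p volume).toReal)
    (integrable_const _)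
    hmeas.norm.prod_swap.integral_prod_right' (Eventually.of_forall fun τ => ?_)
  have h2 := integral_norm_dual_apply_le (memLp_translate hb τ) hu
  rw [eLpNorm_translate hb] at h2
  rw [Real.norm_of_nonneg (integral_nonneg fun _ => norm_nonneg _)]
  exact h2

/-- Steklov averages converge in duality, uniformly for the functional in a ball of `L^q`. -/
lemma exists_steklov_pairing_close {p q : ℝ≥0∞} [p.HolderConjugate q] (hp : p ≠ ∞)
    {u : ℝ → V} (hu : MemLp u p volume) {ε : ℝ} (hε : 0 < ε) :
    ∃ δ > 0, ∀ h : ℝ, 0 < h → h < δ → ∀ b : ℝ → StrongDual ℝ V, MemLp b q volume →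
      |h⁻¹ * (∫ r, (∫ ρ in r..(r + h), b ρ) (u r)) - ∫ r, b r (u r)| ≤
        ε * (eLpNorm b q volume).toReal := by
  obtain ⟨δ, hδ, H⟩ := exists_eLpNorm_translate_sub_lt
    (ENNReal.HolderConjugate.one_le p q) hp hu hε
  refine ⟨δ, hδ, fun h hh hhδ b hb => ?_⟩
  rw [integral_steklov_pairing (p := p) hb hu hh.le]
  have hbd : ∀ τ ∈ uIoc (0 : ℝ) h, ‖(∫ r, b (r + τ) (u r)) - ∫ r, b r (u r)‖ ≤
      ε * (eLpNorm b q volume).toReal := by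
    intro τ hτ
    rw [uIoc_of_le hh.le] at hτ
    refine (abs_integral_translate_pairing_sub_le (p := p) hb hu τ).trans ?_
    rw [mul_comm]
    gcongr
    exact (H τ (by rw [abs_of_pos hτ.1]; linarith [hτ.2])).le
  have hint : IntervalIntegrable (fun τ => ∫ r, b (r + τ) (u r)) volume 0 h := by
    -- the pairing is continuous in the translation, since translations act continuously on `u`
    have hcont : Continuous (fun τ => ∫ r, b (r + τ) (u r)) := by
      refine continuous_iff_continuousAt.2 fun τ₀ => Metric.tendsto_nhds.2 fun η hη => ?_
      set M := (eLpNorm b q volume).toReal with hM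
      have hM0 : 0 ≤ M := ENNReal.toReal_nonneg
      obtain ⟨δ', hδ', H'⟩ := exists_eLpNorm_translate_sub_lt
        (ENNReal.HolderConjugate.one_le p q) hp hu (show 0 < η / (M + 1) by positivity)
      refine Metric.eventually_nhds_iff.2 ⟨δ', hδ', fun τ hτ => ?_⟩
      have h3 := abs_integral_translate_pairing_sub_le (p := p) (memLp_translate hb τ₀) hu (τ - τ₀)
      rw [eLpNorm_translate hb] at h3
      have h4 := H' (τ - τ₀) (by simpa [Real.dist_eq] using hτ)
      have h5 : ∀ r : ℝ, r + (τ - τ₀) + τ₀ = r + τ := fun r => by ring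
      simp only [h5] at h3
      rw [Real.dist_eq]
      refine h3.trans_lt ?_
      calc M * _ ≤ M * (η / (M + 1)) := by gcongr
        _ < η := by rw [mul_div_assoc', div_lt_iff₀ (by positivity)]; nlinarith
    exact hcont.intervalIntegrable _ _
  have e : h⁻¹ * (∫ τ in (0 : ℝ)..h, ∫ r, b (r + τ) (u r)) - ∫ r, b r (u r) =
      h⁻¹ * ∫ τ in (0 : ℝ)..h, ((∫ r, b (r + τ) (u r)) - ∫ r, b r (u r)) := by
    rw [intervalIntegral.integral_sub hint (by simp)]
    simp
    field_simp
  rw [e, abs_mul, abs_of_pos (inv_pos.2 hh)]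
  have h6 := intervalIntegral.norm_integral_le_of_norm_le_const hbd
  rw [Real.norm_eq_abs, sub_zero, abs_of_pos hh] at h6
  rw [inv_mul_le_iff₀ hh, mul_comm]
  exact h6

end Pairing

/-! ### The energy equality in a Gelfand triple -/

section Energy

lemma memLp_indicator_of_restrict {X E : Type*} [MeasurableSpace X] [NormedAddCommGroup E]
    {μ : Measure X} {q : ℝ≥0∞} {s : Set X} (hs : MeasurableSet s) {b : X → E}
    (hb : MemLp b q (μ.restrict s)) : MemLp (s.indicator b) q μ :=
  (memLp_indicator_iff_restrict hs).2 hb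

lemma eLpNorm_indicator_of_restrict {X E : Type*} [MeasurableSpace X] [NormedAddCommGroup E]
    {μ : Measure X} {q : ℝ≥0∞} {s : Set X} (hs : MeasurableSet s) {b : X → E} :
    eLpNorm (s.indicator b) q μ = eLpNorm b q (μ.restrict s) :=
  eLpNorm_indicator_eq_eLpNorm_restrict hs

variable {V : Type*} [NormedAddCommGroup V] [NormedSpace ℝ V]

lemma norm_intervalIntegral_dual_le {p q : ℝ≥0∞} [p.HolderConjugate q] (hp : p ≠ ∞)
    {b : ℝ → StrongDual ℝ V} {a T : ℝ} (hb : MemLp b q (volume.restrict (Icc a T)))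
    {r t : ℝ} (har : a ≤ r) (hrt : r ≤ t) (htT : t ≤ T) :
    ‖∫ ρ in r..t, b ρ‖ ≤
      (eLpNorm b q (volume.restrict (Icc a T))).toReal * (t - r) ^ (1 / p.toReal) := by
  have hq : 1 ≤ q := (ENNReal.HolderConjugate.symm (p := p) (q := q)).one_le
  have hsub : Ioc r t ⊆ Icc a T := fun x hx => ⟨har.trans hx.1.le, hx.2.trans htT⟩
  have hle : volume.restrict (Ioc r t) ≤ volume.restrict (Icc a T) :=
    Measure.restrict_mono hsub le_rfl
  have hb' := hb.mono_measure hle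
  have hbi : IntegrableOn b (Ioc r t) volume := by
    have : IsFiniteMeasure (volume.restrict (Ioc r t)) := ⟨by simp⟩
    exact hb'.integrable hq
  have hp0 : p ≠ 0 := (one_pos.trans_le (ENNReal.HolderConjugate.one_le p q)).ne'
  refine ContinuousLinearMap.opNorm_le_bound _ (by have := sub_nonneg.2 hrt; positivity) fun v => ?_
  rw [intervalIntegral.integral_of_le hrt, ContinuousLinearMap.integral_apply hbi]
  have : IsFiniteMeasure (volume.restrict (Ioc r t)) := ⟨by simp⟩
  refine (abs_integral_dual_apply_le (p := p) hb' (memLp_const v)).trans ?_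
  have e : (eLpNorm (fun _ : ℝ => v) p (volume.restrict (Ioc r t))).toReal =
      (t - r) ^ (1 / p.toReal) * ‖v‖ := by
    rw [eLpNorm_const' v hp0 hp, ENNReal.toReal_mul, mul_comm, ← ENNReal.toReal_rpow]
    simp [hrt]
  rw [e, ← mul_assoc]
  have := sub_nonneg.2 hrt
  gcongr
  · exact hb.eLpNorm_ne_top

variable {H : Type*} [NormedAddCommGroup H] [InnerProductSpace ℝ H]

@[simp]
lemma toDualV_apply (ι : V →L[ℝ] H) (h : H) (v : V) : toDualV ι h v = inner ℝ h (ι v) := rfl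


lemma intervalIntegral_indicator_Icc {E : Type*} [NormedAddCommGroup E] [NormedSpace ℝ E]
    {b : ℝ → E} {a T : ℝ} (hb : IntegrableOn b (Icc a T)) {r h : ℝ} (hr : r ∈ Icc a T)
    (hh : 0 ≤ h) :
    (∫ ρ in r..(r + h), (Icc a T).indicator b ρ) = ∫ ρ in r..(min (r + h) T), b ρ := by
  have hm : r ≤ min (r + h) T := le_min (by linarith) hr.2
  have hi : Integrable ((Icc a T).indicator b) := (integrable_indicator_iff measurableSet_Icc).2 hb
  rw [← intervalIntegral.integral_add_adjacent_intervals
    (hi.intervalIntegrable (a := r) (b := min (r + h) T)) hi.intervalIntegrable]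
  have e1 : (∫ ρ in r..(min (r + h) T), (Icc a T).indicator b ρ) =
      ∫ ρ in r..(min (r + h) T), b ρ := by
    apply intervalIntegral.integral_congr
    intro ρ hρ
    rw [uIcc_of_le hm] at hρ
    exact indicator_of_mem
      (show ρ ∈ Icc a T from ⟨hr.1.trans hρ.1, hρ.2.trans (min_le_right _ _)⟩) _
  have e2 : (∫ ρ in (min (r + h) T)..(r + h), (Icc a T).indicator b ρ) = 0 := by
    rcases le_total (r + h) T with h1 | h1
    · simp [h1]
    · rw [min_eq_right h1, intervalIntegral.integral_of_le h1]
      refine setIntegral_eq_zero_of_forall_eq_zero fun ρ hρ => ?_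
      exact indicator_of_notMem (fun h2 => absurd h2.2 (not_le.2 hρ.1)) _
  rw [e1, e2, add_zero]

/-- The telescoping estimate behind the energy inequality: `2 (x - y, y) ≤ |x|² - |y|²`. -/
lemma integral_inner_increment_le {W : ℝ → H} (hW : AEStronglyMeasurable W volume) {M : ℝ}
    (hM : ∀ r, ‖W r‖ ≤ M) {a T h L : ℝ} (haT : a < T) (hh : 0 < h) {w : H}
    (hT : ∀ r, T ≤ r → W r = w) (hL : ∀ r ∈ Ioo a (a + h), L ≤ ‖W r‖ ^ 2) :
    ∫ r in a..T, inner ℝ (W (r + h) - W r) (W r) ≤ h / 2 * (‖w‖ ^ 2 - L) := by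
  have hM0 : 0 ≤ M := (norm_nonneg _).trans (hM 0)
  have hWh : AEStronglyMeasurable (fun r => W (r + h)) volume :=
    hW.comp_measurePreserving (measurePreserving_add_right volume h)
  have hloc : ∀ {f : ℝ → ℝ} {C : ℝ}, AEStronglyMeasurable f volume → (∀ r, ‖f r‖ ≤ C) →
      ∀ x y, IntervalIntegrable f volume x y := by
    intro f C hf hC x y
    rw [intervalIntegrable_iff]
    exact Measure.integrableOn_of_bounded (by simp [uIoc]) hf
      (Eventually.of_forall hC)
  have hsq : ∀ r, ‖(‖W r‖ ^ 2)‖ ≤ M ^ 2 := fun r => by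
    rw [norm_pow, norm_norm]; have := hM r; gcongr
  have hy : ∀ x y, IntervalIntegrable (fun r => ‖W r‖ ^ 2) volume x y :=
    hloc (hW.norm.pow 2) hsq
  have hyh : ∀ x y, IntervalIntegrable (fun r => ‖W (r + h)‖ ^ 2) volume x y :=
    hloc (hWh.norm.pow 2) fun r => hsq (r + h)
  have hi : ∀ x y, IntervalIntegrable (fun r => inner ℝ (W (r + h) - W r) (W r)) volume x y := by
    refine hloc (C := (M + M) * M) ((hWh.sub hW).inner hW) fun r => ?_
    refine (norm_inner_le_norm _ _).trans ?_
    have h1 := hM r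
    have h2 := (norm_sub_le (W (r + h)) (W r)).trans (add_le_add (hM (r + h)) h1)
    gcongr
  have h1 : ∫ r in a..T, inner ℝ (W (r + h) - W r) (W r) ≤
      ∫ r in a..T, (1 / 2) * (‖W (r + h)‖ ^ 2 - ‖W r‖ ^ 2) := by
    refine intervalIntegral.integral_mono_on haT.le (hi _ _)
      (((hyh _ _).sub (hy _ _)).const_mul _) fun r _ => ?_
    have e : inner ℝ (W (r + h) - W r) (W r) = inner ℝ (W (r + h)) (W r) - ‖W r‖ ^ 2 := by
      rw [inner_sub_left, real_inner_self_eq_norm_sq]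
    have h3 := real_inner_le_norm (W (r + h)) (W r)
    have h4 := sq_nonneg (‖W (r + h)‖ - ‖W r‖)
    rw [e]
    nlinarith
  refine h1.trans ?_
  -- the integrals cancel except on a window of length `h` at either end
  rw [intervalIntegral.integral_const_mul, intervalIntegral.integral_sub (hyh _ _) (hy _ _),
    intervalIntegral.integral_comp_add_right (fun r => ‖W r‖ ^ 2),
    intervalIntegral.integral_interval_sub_interval_comm (hy _ _) (hy _ _) (hy _ _)]
  have h5 : ∫ r in (T + h)..T, ‖W r‖ ^ 2 = -(h * ‖w‖ ^ 2) := by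
    rw [intervalIntegral.integral_symm]
    have : ∫ r in T..(T + h), ‖W r‖ ^ 2 = ∫ r in T..(T + h), ‖w‖ ^ 2 := by
      apply intervalIntegral.integral_congr
      intro r hr
      rw [uIcc_of_le (by linarith)] at hr
      simp only [hT r hr.1]
    rw [this]; simp
  have h6 : h * L ≤ ∫ r in a..(a + h), ‖W r‖ ^ 2 := by
    have : ∫ r in a..(a + h), L ≤ ∫ r in a..(a + h), ‖W r‖ ^ 2 :=
      intervalIntegral.integral_mono_on_of_le_Ioo (by linarith) (by simp) (hy _ _) hL
    simpa using this
  rw [intervalIntegral.integral_symm a (a + h), h5]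
  linarith

set_option maxHeartbeats 400000 in
/-- The identity `(∫_r^{r+h} b)(u(r)) = (Z(r+h) - Z(r), Z(r))` and `2 (x - y, y) ≤ |x|² - |y|²`
bound the Steklov pairing by a telescoping expression. This survives a limit along a sequence
`b k` for which only the integrals over intervals converge, tested against vectors of `V`. -/
lemma eventually_two_mul_pairing_le (ι : V →L[ℝ] H) {p q : ℝ≥0∞} [p.HolderConjugate q]
    (hp : p ≠ ∞) {a T : ℝ} (haT : a < T) {u : ℝ → V} {Z : ℝ → H}
    (hu : MemLp u p (volume.restrict (Icc a T)))
    (huZ : ∀ᵐ r ∂(volume.restrict (Icc a T)), ι (u r) = Z r)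
    {M : ℝ} (hM : ∀ r ∈ Icc a T, ‖Z r‖ ≤ M)
    {b : ℕ → ℝ → StrongDual ℝ V} (hb : ∀ k, MemLp (b k) q (volume.restrict (Icc a T)))
    {R : ℝ} (hR : ∀ k, (eLpNorm (b k) q (volume.restrict (Icc a T))).toReal ≤ R)
    (hconv : ∀ (v : V) (r t : ℝ), a ≤ r → r ≤ t → t ≤ T →
      Tendsto (fun k => (∫ ρ in r..t, b k ρ) v) atTop (𝓝 (inner ℝ (Z t - Z r) (ι v))))
    (hweak : Tendsto (fun r => inner ℝ (Z r) (Z a)) (𝓝[>] a) (𝓝 (‖Z a‖ ^ 2)))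
    {ε : ℝ} (hε : 0 < ε) :
    ∀ᶠ k in atTop, 2 * ∫ r in a..T, b k r (u r) ≤ ‖Z T‖ ^ 2 - ‖Z a‖ ^ 2 + ε := by
  have hq : 1 ≤ q := (ENNReal.HolderConjugate.symm (p := p) (q := q)).one_le
  have hR0 : 0 ≤ R := ENNReal.toReal_nonneg.trans (hR 0)
  have hfin : IsFiniteMeasure (volume.restrict (Icc a T)) := ⟨by simp⟩
  -- extensions by zero to the whole line, where translations act
  obtain ⟨u', hu'⟩ : ∃ u' : ℝ → V, u' = (Icc a T).indicator u := ⟨_, rfl⟩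
  obtain ⟨b', hb'⟩ : ∃ b' : ℕ → ℝ → StrongDual ℝ V, ∀ k, b' k = (Icc a T).indicator (b k) :=
    ⟨_, fun _ => rfl⟩
  have hu'L : MemLp u' p volume := hu' ▸ memLp_indicator_of_restrict measurableSet_Icc hu
  have hb'L : ∀ k, MemLp (b' k) q volume := fun k => by
    rw [hb' k]
    exact memLp_indicator_of_restrict measurableSet_Icc (hb k)
  have hb'R : ∀ k, (eLpNorm (b' k) q volume).toReal ≤ R := fun k => by
    rw [hb', eLpNorm_indicator_of_restrict measurableSet_Icc]; exact hR k
  have hpair : ∀ k, ∫ r, b' k r (u' r) = ∫ r in a..T, b k r (u r) := by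
    intro k
    rw [intervalIntegral.integral_of_le haT.le, ← integral_Icc_eq_integral_Ioc,
      ← integral_indicator measurableSet_Icc]
    congr 1; ext r
    by_cases hr : r ∈ Icc a T <;> simp [hu', hb', hr]
  -- the Steklov pairing at a small step `h` is close to the pairing, uniformly in `k`
  obtain ⟨δ, hδ, Hδ⟩ := exists_steklov_pairing_close (p := p) (q := q) hp hu'L
    (show 0 < ε / (8 * (R + 1)) by positivity)
  -- weak right-continuity at `a` bounds `‖Z‖` from below near `a`
  have hlow : ∀ᶠ r in 𝓝[>] a, ‖Z a‖ ^ 2 - ε / 4 ≤ ‖Z r‖ ^ 2 := by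
    have := hweak.eventually (lt_mem_nhds (show ‖Z a‖ ^ 2 - ε / 8 < ‖Z a‖ ^ 2 by linarith))
    filter_upwards [this] with r hr
    have h1 := sq_nonneg (‖Z r‖ - ‖Z a‖)
    have h2 := real_inner_le_norm (Z r) (Z a)
    nlinarith
  obtain ⟨δ', hδ', Hδ'⟩ := mem_nhdsGT_iff_exists_Ioo_subset.1 hlow
  have hδ'' : a < δ' := hδ'
  obtain ⟨h, hh0, hhlt⟩ := exists_between
    (show 0 < min δ (min (δ' - a) (T - a)) from lt_min hδ (lt_min (by linarith) (by linarith)))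
  have hhδ : h < δ := hhlt.trans_le (min_le_left _ _)
  have hhδ' : a + h < δ' := by
    have := hhlt.trans_le ((min_le_right _ _).trans (min_le_left _ _)); linarith
  have hhT : a + h < T := by
    have := hhlt.trans_le ((min_le_right _ _).trans (min_le_right _ _)); linarith
  have hinc : ∀ k, ∀ r ∈ Icc a T, (∫ ρ in r..(r + h), b' k ρ) =
      ∫ ρ in r..(min (r + h) T), b k ρ := fun k r hr =>
    hb' k ▸ intervalIntegral_indicator_Icc ((hb k).integrable hq) hr hh0.le
  -- `W` extends `Z` by its final value, so that the increments beyond `T` vanish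
  set W : ℝ → H := fun r => if r ∈ Icc a T then Z r else if T ≤ r then Z T else 0 with hW
  have hWZ : ∀ r, a ≤ r → W r = Z (min r T) := by
    intro r hr
    by_cases h1 : r ≤ T
    · simp [hW, hr, h1]
    · push Not at h1
      simp [hW, hr, h1.le, not_le.2 h1]
  have hWm : AEStronglyMeasurable W volume := by
    have h1 : AEStronglyMeasurable (fun r => (Icc a T).indicator (fun r => ι (u r)) r +
        (Ioi T).indicator (fun _ => Z T) r) volume := by
      refine AEStronglyMeasurable.add ?_ ?_
      · exact (aestronglyMeasurable_indicator_iff measurableSet_Icc).2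
          (ι.continuous.comp_aestronglyMeasurable hu.aestronglyMeasurable)
      · exact (aestronglyMeasurable_const.indicator measurableSet_Ioi)
    refine h1.congr ?_
    rw [ae_restrict_iff' measurableSet_Icc] at huZ
    filter_upwards [huZ] with r hZ
    by_cases hr : r ∈ Icc a T
    · have h2 : ¬ T < r := not_lt.2 hr.2
      simp only [hW, if_pos hr, indicator_of_mem hr, hZ hr]
      simp [h2]
    · simp only [hW, if_neg hr, indicator_of_notMem hr]
      by_cases h2 : T < r
      · simp [h2, h2.le]
      · have h3 : ¬ T ≤ r := fun h3 => hr ⟨by linarith, not_lt.1 h2⟩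
        simp [h2, h3]
  have hWM : ∀ r, ‖W r‖ ≤ M := by
    intro r
    have hT' := hM T ⟨haT.le, le_rfl⟩
    simp only [hW]
    split_ifs with h1 h2
    · exact hM r h1
    · exact hT'
    · simpa using (norm_nonneg _).trans hT'
  have hWT : ∀ r, T ≤ r → W r = Z T := fun r hr => by
    rw [hWZ r (haT.le.trans hr), min_eq_right hr]
  have htel := integral_inner_increment_le hWm hWM haT hh0 hWT
    (L := ‖Z a‖ ^ 2 - ε / 4) (fun r hr => by
      rw [hWZ r hr.1.le, min_eq_left (hr.2.trans hhT).le]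
      exact Hδ' ⟨hr.1, hr.2.trans hhδ'⟩)
  -- for fixed `h` the limit in `k` is taken by dominated convergence: at almost every `r` the
  -- average of `b k` over `[r, r + h]`, paired with `u r`, converges to `(W (r + h) - W r, W r)`
  have hlim : Tendsto (fun k => ∫ r, (∫ ρ in r..(r + h), b' k ρ) (u' r)) atTop
      (𝓝 (∫ r in a..T, inner ℝ (W (r + h) - W r) (W r))) := by
    rw [intervalIntegral.integral_of_le haT.le, ← integral_Icc_eq_integral_Ioc,
      ← integral_indicator measurableSet_Icc]
    refine tendsto_integral_of_dominated_convergence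
      ((Icc a T).indicator fun r => R * (T - a) ^ (1 / p.toReal) * ‖u r‖) ?_ ?_ ?_ ?_
    · intro k
      refine AEStronglyMeasurable.dual_apply ?_ hu'L.aestronglyMeasurable
      have hii : ∀ x y, IntervalIntegrable (b' k) volume x y := fun x y =>
        intervalIntegrable_of_memLp hq (hb'L k) x y
      have hc : Continuous fun x => ∫ ρ in (0 : ℝ)..x, b' k ρ :=
        intervalIntegral.continuous_primitive hii 0
      have e : (fun r => ∫ ρ in r..(r + h), b' k ρ) =
          fun r => (∫ ρ in (0 : ℝ)..(r + h), b' k ρ) - ∫ ρ in (0 : ℝ)..r, b' k ρ := by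
        ext1 r
        rw [intervalIntegral.integral_interval_sub_left (hii _ _) (hii _ _)]
      rw [e]
      exact ((hc.comp (by fun_prop)).sub hc).aestronglyMeasurable
    · rw [integrable_indicator_iff measurableSet_Icc]
      exact ((hu.integrable (ENNReal.HolderConjugate.one_le p q)).norm).const_mul _
    · intro k
      refine Eventually.of_forall fun r => ?_
      by_cases hr : r ∈ Icc a T
      · rw [indicator_of_mem hr, hinc k r hr, hu', indicator_of_mem hr]
        refine (ContinuousLinearMap.le_opNorm _ _).trans ?_
        gcongr
        refine (norm_intervalIntegral_dual_le hp (hb k) hr.1 (le_min (by linarith) hr.2)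
          (min_le_right _ _)).trans ?_
        have h0 : 0 ≤ min (r + h) T - r := sub_nonneg.2 (le_min (by linarith) hr.2)
        have h1 : min (r + h) T - r ≤ T - a := by linarith [min_le_right (r + h) T, hr.1]
        have h2 := hR k
        gcongr
      · simp [hu', hr]
    · rw [ae_restrict_iff' measurableSet_Icc] at huZ
      filter_upwards [huZ] with r hZ
      by_cases hr : r ∈ Icc a T
      · have hr' : a ≤ r + h := by linarith [hr.1]
        simp only [indicator_of_mem hr, hu', hinc _ r hr, hWZ _ hr.1, hWZ _ hr', min_eq_left hr.2]
        rw [← hZ hr]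
        have := hconv (u r) r (min (r + h) T) hr.1 (le_min (by linarith) hr.2) (min_le_right _ _)
        rwa [← hZ hr] at this
      · simp [hu', hr]
  have hfinal := hlim.eventually (gt_mem_nhds (lt_add_of_pos_right
    (∫ r in a..T, inner ℝ (W (r + h) - W r) (W r)) (show 0 < h * (ε / 8) by positivity)))
  filter_upwards [hfinal] with k hk
  have h1 := Hδ h hh0 hhδ (b' k) (hb'L k)
  rw [hpair k] at h1
  have h2 : ε / (8 * (R + 1)) * (eLpNorm (b' k) q volume).toReal ≤ ε / 8 := by
    calc ε / (8 * (R + 1)) * (eLpNorm (b' k) q volume).toReal ≤ ε / (8 * (R + 1)) * R := by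
          have := hb'R k
          gcongr
      _ ≤ ε / 8 := by
          rw [div_mul_eq_mul_div, div_le_div_iff₀ (by positivity) (by positivity)]
          nlinarith
  have h3 := (abs_le.1 (h1.trans h2)).1
  have h4 : h⁻¹ * (∫ r, (∫ ρ in r..(r + h), b' k ρ) (u' r)) ≤
      1 / 2 * (‖Z T‖ ^ 2 - (‖Z a‖ ^ 2 - ε / 4)) + ε / 8 := by
    rw [inv_mul_le_iff₀ hh0]
    linarith
  linarith

/-- A bounded path that is continuous when tested against `V` is weakly continuous. -/
lemma continuousOn_inner_of_bounded {ι : V →L[ℝ] H} (hd : DenseRange ι) {a T : ℝ} {Z : ℝ → H}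
    {M : ℝ} (hM : ∀ r ∈ Icc a T, ‖Z r‖ ≤ M)
    (hv : ∀ v, ContinuousOn (fun r => inner ℝ (Z r) (ι v)) (Icc a T)) (h : H) :
    ContinuousOn (fun r => inner ℝ (Z r) h) (Icc a T) := by
  intro t ht
  refine Metric.tendsto_nhds.2 fun ε hε => ?_
  have hM0 : 0 ≤ M := (norm_nonneg _).trans (hM t ht)
  obtain ⟨v, hvh⟩ := hd.exists_dist_lt h (show 0 < ε / (3 * (M + 1)) by positivity)
  have h1 := Metric.tendsto_nhds.1 (hv v t ht) (ε / 3) (by positivity)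
  filter_upwards [h1, self_mem_nhdsWithin] with r hr hrI
  have key : ∀ s ∈ Icc a T, |inner ℝ (Z s) (h - ι v)| ≤ ε / 3 := by
    intro s hs
    calc |inner ℝ (Z s) (h - ι v)| ≤ ‖Z s‖ * ‖h - ι v‖ := abs_real_inner_le_norm _ _
      _ ≤ (M + 1) * (ε / (3 * (M + 1))) := by
          rw [dist_eq_norm] at hvh
          have := hM s hs
          gcongr
          linarith
      _ = ε / 3 := by field_simp
  have k1 := key r hrI
  have k2 := key t ht
  rw [Real.dist_eq] at hr ⊢
  rw [inner_sub_right, abs_le] at k1 k2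
  rw [abs_lt] at hr ⊢
  constructor <;> linarith

variable {ι : V →L[ℝ] H} {p q : ℝ≥0∞} {a T M : ℝ} {u : ℝ → V} {Z : ℝ → H}
  {b : ℝ → StrongDual ℝ V}

lemma inner_sub_eq_integral_of_integral_eq
    (hb : IntervalIntegrable b volume a T)
    (heq : ∀ t ∈ Icc a T, toDualV ι (Z t) = toDualV ι (Z a) + ∫ r in a..t, b r)
    (v : V) {r t : ℝ} (har : a ≤ r) (hrt : r ≤ t) (htT : t ≤ T) :
    inner ℝ (Z t - Z r) (ι v) = (∫ ρ in r..t, b ρ) v := by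
  have h1 := heq t ⟨har.trans hrt, htT⟩
  have h2 := heq r ⟨har, hrt.trans htT⟩
  have hab : ∀ s, a ≤ s → s ≤ T → IntervalIntegrable b volume a s := fun s h1 h2 =>
    hb.mono_set (by
      rw [uIcc_of_le h1, uIcc_of_le (h1.trans h2)]; exact Icc_subset_Icc le_rfl h2)
  have h3 : toDualV ι (Z t) - toDualV ι (Z r) = ∫ ρ in r..t, b ρ := by
    rw [h1, h2, ← intervalIntegral.integral_interval_sub_left (hab t (har.trans hrt) htT)
      (hab r har (hrt.trans htT))]
    abel
  have h4 := congrArg (fun φ : StrongDual ℝ V => φ v) h3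
  simpa [inner_sub_left] using h4

lemma continuousOn_inner_of_integral_eq (hd : DenseRange ι)
    (hM : ∀ r ∈ Icc a T, ‖Z r‖ ≤ M) (hb : IntegrableOn b (Icc a T) volume)
    (heq : ∀ t ∈ Icc a T, toDualV ι (Z t) = toDualV ι (Z a) + ∫ r in a..t, b r) (h : H) :
    ContinuousOn (fun r => inner ℝ (Z r) h) (Icc a T) := by
  refine continuousOn_inner_of_bounded hd hM (fun v => ?_) h
  have h1 : ContinuousOn (fun t => toDualV ι (Z a) v + (∫ r in a..t, b r) v) (Icc a T) := by
    refine continuousOn_const.add ?_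
    have := intervalIntegral.continuousOn_primitive_interval (a := a) (b := T) (f := b)
      (μ := volume)
    rcases le_or_gt a T with haT | haT
    · rw [uIcc_of_le haT] at this
      exact (ContinuousLinearMap.apply ℝ ℝ v).continuous.comp_continuousOn (this hb)
    · simp [haT]
  refine h1.congr fun t ht => ?_
  have h2 := congrArg (fun φ : StrongDual ℝ V => φ v) (heq t ht)
  simpa using h2

lemma two_mul_pairing_le [p.HolderConjugate q] (hd : DenseRange ι) (hp : p ≠ ∞) (haT : a < T)
    (hu : MemLp u p (volume.restrict (Icc a T)))
    (huZ : ∀ᵐ r ∂(volume.restrict (Icc a T)), ι (u r) = Z r)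
    (hM : ∀ r ∈ Icc a T, ‖Z r‖ ≤ M) (hb : MemLp b q (volume.restrict (Icc a T)))
    (heq : ∀ t ∈ Icc a T, toDualV ι (Z t) = toDualV ι (Z a) + ∫ r in a..t, b r) :
    2 * ∫ r in a..T, b r (u r) ≤ ‖Z T‖ ^ 2 - ‖Z a‖ ^ 2 := by
  have hq : 1 ≤ q := (ENNReal.HolderConjugate.symm (p := p) (q := q)).one_le
  have hfin : IsFiniteMeasure (volume.restrict (Icc a T)) := ⟨by simp⟩
  have hbi : IntegrableOn b (Icc a T) volume := hb.integrable hq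
  refine le_of_forall_pos_le_add fun ε hε => ?_
  have hw := continuousOn_inner_of_integral_eq hd hM hbi heq (Z a) a ⟨le_rfl, haT.le⟩
  have hw' : Tendsto (fun r => inner ℝ (Z r) (Z a)) (𝓝[>] a) (𝓝 (‖Z a‖ ^ 2)) := by
    rw [← real_inner_self_eq_norm_sq]
    have h2 : 𝓝[>] a ≤ 𝓝[Icc a T] a := by
      rw [← nhdsWithin_Ioc_eq_nhdsGT haT]
      exact nhdsWithin_mono _ Ioc_subset_Icc_self
    exact hw.tendsto.mono_left h2
  have h := eventually_two_mul_pairing_le ι (p := p) (q := q) hp haT hu huZ hM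
    (b := fun _ => b) (fun _ => hb) (fun _ => le_rfl) (fun v r t h1 h2 h3 => by
      rw [← inner_sub_eq_integral_of_integral_eq
        ((intervalIntegrable_iff_integrableOn_Icc_of_le haT.le).2 hbi) heq v h1 h2 h3]
      exact tendsto_const_nhds) hw' hε
  obtain ⟨k, hk⟩ := h.exists
  exact hk

/-- The energy equality `‖Z(T)‖² - ‖Z(a)‖² = 2 ∫ ⟨Z', Z⟩` for a bounded path `Z` in `H` that takes
values in `V` almost everywhere and whose derivative in `V*` lies in the dual Bochner space. The
reverse inequality is the direct one for the time-reversed path. -/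
theorem energy_eq [p.HolderConjugate q] (hd : DenseRange ι) (hp : p ≠ ∞) (haT : a ≤ T)
    (hu : MemLp u p (volume.restrict (Icc a T)))
    (huZ : ∀ᵐ r ∂(volume.restrict (Icc a T)), ι (u r) = Z r)
    (hM : ∀ r ∈ Icc a T, ‖Z r‖ ≤ M) (hb : MemLp b q (volume.restrict (Icc a T)))
    (heq : ∀ t ∈ Icc a T, toDualV ι (Z t) = toDualV ι (Z a) + ∫ r in a..t, b r) :
    ‖Z T‖ ^ 2 - ‖Z a‖ ^ 2 = 2 * ∫ r in a..T, b r (u r) := by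
  rcases haT.eq_or_lt with rfl | haT
  · simp
  have hq : 1 ≤ q := (ENNReal.HolderConjugate.symm (p := p) (q := q)).one_le
  have hfin : IsFiniteMeasure (volume.restrict (Icc a T)) := ⟨by simp⟩
  have hbi : IntervalIntegrable b volume a T :=
    (intervalIntegrable_iff_integrableOn_Icc_of_le haT.le).2 (hb.integrable hq)
  refine le_antisymm ?_ (two_mul_pairing_le hd hp haT hu huZ hM hb heq)
  have hpre : (fun r : ℝ => a + T - r) ⁻¹' (Icc a T) = Icc a T := by
    ext r; simp only [mem_preimage, mem_Icc]; constructor <;> rintro ⟨h1, h2⟩ <;>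
      constructor <;> linarith
  have hmp : MeasurePreserving (fun r : ℝ => a + T - r) (volume.restrict (Icc a T))
      (volume.restrict (Icc a T)) := by
    have := (Measure.measurePreserving_sub_left volume (a + T)).restrict_preimage
      (measurableSet_Icc (a := a) (b := T))
    rwa [hpre] at this
  have hmem : ∀ r ∈ Icc a T, a + T - r ∈ Icc a T := fun r hr => by rw [← hpre] at hr; exact hr
  have h := two_mul_pairing_le (u := fun r => u (a + T - r)) (Z := fun r => Z (a + T - r))
    (b := fun r => -b (a + T - r)) (M := M) (p := p) (q := q) hd hp haT
    (hu.comp_measurePreserving hmp) (hmp.quasiMeasurePreserving.ae huZ)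
    (fun r hr => hM _ (hmem r hr)) (hb.comp_measurePreserving hmp).neg ?_
  · have e : ∫ r in a..T, (-b (a + T - r)) (u (a + T - r)) = -∫ r in a..T, b r (u r) := by
      have := intervalIntegral.integral_comp_sub_left (a := a) (b := T)
        (fun r => (-b r) (u r)) (a + T)
      rw [this]
      simp
    rw [e] at h
    simp only [add_sub_cancel_right, add_sub_cancel_left] at h
    linarith
  · intro t ht
    have h1 := heq _ (hmem t ht)
    have h2 := heq T ⟨haT.le, le_rfl⟩
    have e : ∫ r in a..t, -b (a + T - r) = -∫ r in (a + T - t)..T, b r := by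
      rw [intervalIntegral.integral_comp_sub_left (fun r => -b r) (a + T)]
      simp
    have hab : ∀ s ∈ Icc a T, IntervalIntegrable b volume a s := fun s hs =>
      hbi.mono_set (by
        rw [uIcc_of_le hs.1, uIcc_of_le haT.le]; exact Icc_subset_Icc le_rfl hs.2)
    have h3 := intervalIntegral.integral_interval_sub_left hbi (hab _ (hmem t ht))
    simp only [add_sub_cancel_left]
    rw [e, h1, h2, ← h3]
    abel

/-- Under the hypotheses of the energy equality, the path is strongly continuous in `H`. -/
theorem continuousOn_of_integral_eq [p.HolderConjugate q] (hd : DenseRange ι) (hp : p ≠ ∞)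
    (hu : MemLp u p (volume.restrict (Icc a T)))
    (huZ : ∀ᵐ r ∂(volume.restrict (Icc a T)), ι (u r) = Z r)
    (hM : ∀ r ∈ Icc a T, ‖Z r‖ ≤ M) (hb : MemLp b q (volume.restrict (Icc a T)))
    (heq : ∀ t ∈ Icc a T, toDualV ι (Z t) = toDualV ι (Z a) + ∫ r in a..t, b r) :
    ContinuousOn Z (Icc a T) := by
  rcases lt_or_ge T a with haT | haT
  · simp [haT]
  have hq : 1 ≤ q := (ENNReal.HolderConjugate.symm (p := p) (q := q)).one_le
  have hfin : IsFiniteMeasure (volume.restrict (Icc a T)) := ⟨by simp⟩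
  have hbi : IntegrableOn b (Icc a T) volume := hb.integrable hq
  have hnorm : ContinuousOn (fun t => ‖Z t‖ ^ 2) (Icc a T) := by
    have hprim : ContinuousOn (fun t => ∫ r in a..t, b r (u r)) (Icc a T) := by
      have := intervalIntegral.continuousOn_primitive_interval (a := a) (b := T) (μ := volume)
        (f := fun r => b r (u r))
      rw [uIcc_of_le haT] at this
      exact this (hb.dual_apply hu)
    have : ContinuousOn (fun t => ‖Z a‖ ^ 2 + 2 * ∫ r in a..t, b r (u r)) (Icc a T) :=
      continuousOn_const.add (continuousOn_const.mul hprim)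
    refine this.congr fun t ht => ?_
    have hle : volume.restrict (Icc a t) ≤ volume.restrict (Icc a T) :=
      Measure.restrict_mono (Icc_subset_Icc le_rfl ht.2) le_rfl
    have hsub : Icc a t ⊆ Icc a T := Icc_subset_Icc le_rfl ht.2
    have := energy_eq (p := p) (q := q) hd hp ht.1 (hu.mono_measure hle)
      (ae_mono hle huZ) (fun r hr => hM r (hsub hr)) (hb.mono_measure hle)
      (fun s hs => heq s (hsub hs))
    simp only
    linarith
  intro t ht
  -- weak continuity and continuity of the norm give strong continuity
  have hw := continuousOn_inner_of_integral_eq hd hM hbi heq (Z t) t ht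
  have h1 : Tendsto (fun r => ‖Z r‖ ^ 2 - 2 * inner ℝ (Z r) (Z t) + ‖Z t‖ ^ 2) (𝓝[Icc a T] t)
      (𝓝 (‖Z t‖ ^ 2 - 2 * inner ℝ (Z t) (Z t) + ‖Z t‖ ^ 2)) :=
    (((hnorm t ht).tendsto).sub (hw.tendsto.const_mul 2)).add_const _
  have h2 : ‖Z t‖ ^ 2 - 2 * inner ℝ (Z t) (Z t) + ‖Z t‖ ^ 2 = 0 := by
    rw [real_inner_self_eq_norm_sq]; ring
  rw [h2] at h1
  rw [ContinuousWithinAt, tendsto_iff_norm_sub_tendsto_zero]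
  have h3 := h1.sqrt
  simp only [← norm_sub_sq_real, Real.sqrt_zero, Real.sqrt_sq (norm_nonneg _)] at h3
  exact h3

end Energy

/-! ### Grönwall's inequality in integral form -/

lemma le_mul_exp_of_le_add_mul_integral {φ : ℝ → ℝ} {a T K D : ℝ} (hK : 0 ≤ K)
    (hφ : ContinuousOn φ (Icc a T))
    (h : ∀ t ∈ Icc a T, φ t ≤ D + K * ∫ r in a..t, φ r) :
    ∀ t ∈ Icc a T, φ t ≤ D * Real.exp (K * (t - a)) := by
  intro t ht
  have haT : a ≤ T := ht.1.trans ht.2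
  set ψ : ℝ → ℝ := IccExtend haT ((Icc a T).domRestrict φ) with hψ
  have hψc : Continuous ψ := (continuousOn_iff_continuous_domRestrict.1 hφ).Icc_extend'
  have hψe : ∀ r ∈ Icc a T, ψ r = φ r := fun r hr => IccExtend_of_mem haT _ hr
  have hint : ∀ s ∈ Icc a T, ∫ r in a..s, ψ r = ∫ r in a..s, φ r := fun s hs =>
    intervalIntegral.integral_congr fun r hr => by
      rw [uIcc_of_le hs.1] at hr
      exact hψe r ⟨hr.1, hr.2.trans hs.2⟩
  have hd : ∀ s, HasDerivAt (fun s => ∫ r in a..s, ψ r) (ψ s) s := fun s =>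
    (hψc.integral_hasStrictDerivAt a s).hasDerivAt
  rcases hK.eq_or_lt with rfl | hK
  · simpa using h t ht
  have hG := le_gronwallBound_of_liminf_deriv_right_le (δ := 0) (K := K) (ε := D)
    (f := fun s => ∫ r in a..s, ψ r) (f' := ψ) (a := a) (b := T)
    (fun s _ => (hd s).continuousAt.continuousWithinAt)
    (fun s _ r hr => (hd s).hasDerivWithinAt.liminf_right_slope_le hr) (by simp)
    (fun s hs => by
      have hs' : s ∈ Icc a T := Ico_subset_Icc_self hs
      simp only [hint s hs', hψe s hs']
      linarith [h s hs']) t ht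
  simp only [hint t ht, gronwallBound_of_K_ne_0 hK.ne'] at hG
  have h1 := h t ht
  have h2 : K * ∫ r in a..t, φ r ≤ K * (0 * Real.exp (K * (t - a)) +
    D / K * (Real.exp (K * (t - a)) - 1)) := by gcongr
  have h3 : K * (0 * Real.exp (K * (t - a)) + D / K * (Real.exp (K * (t - a)) - 1)) =
    D * Real.exp (K * (t - a)) - D := by field_simp; ring
  linarith

/-! ### Gelfand triples -/

section Gelfand

/-- A subspace is dense if only the zero functional vanishes on it. -/
lemma Submodule.dense_of_forall_dual {E : Type*} [NormedAddCommGroup E] [NormedSpace ℝ E]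
    (S : Submodule ℝ E) (h : ∀ f : StrongDual ℝ E, (∀ x ∈ S, f x = 0) → f = 0) :
    Dense (S : Set E) := by
  intro x
  by_contra hx
  obtain ⟨f, w, hf, hfx⟩ := geometric_hahn_banach_closed_point
    (s := closure (S : Set E)) S.convex.closure isClosed_closure hx
  have h0 : ∀ y ∈ S, f y = 0 := by
    intro y hy
    by_contra hne
    have h1 := hf (((w + 1) / f y) • y) (subset_closure (S.smul_mem _ hy))
    rw [map_smul, smul_eq_mul, div_mul_cancel₀ _ hne] at h1
    linarith
  have h2 := hf 0 (subset_closure S.zero_mem)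
  rw [h f h0] at h2 hfx
  simp at h2 hfx
  linarith

/-- A normed space with a separable dual is separable. -/
lemma separableSpace_of_dual {E : Type*} [NormedAddCommGroup E] [NormedSpace ℝ E]
    [TopologicalSpace.SeparableSpace (StrongDual ℝ E)] : TopologicalSpace.SeparableSpace E := by
  obtain ⟨f, hf⟩ := TopologicalSpace.exists_dense_seq (StrongDual ℝ E)
  have hv : ∀ n, ∃ v : E, ‖v‖ ≤ 1 ∧ ‖f n‖ / 2 ≤ |f n v| := by
    intro n
    by_contra! hcon
    rcases eq_or_ne (f n) 0 with h0 | h0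
    · have := hcon 0 (by simp)
      simp [h0] at this
    · have hpos : 0 < ‖f n‖ := norm_pos_iff.2 h0
      have : ‖f n‖ ≤ ‖f n‖ / 2 := by
        refine ContinuousLinearMap.opNorm_le_of_unit_norm (by positivity) fun v hv => ?_
        exact (hcon v hv.le).le
      linarith
  choose v hv1 hv2 using hv
  have hd : Dense (Submodule.span ℝ (range v) : Set E) := by
    refine Submodule.dense_of_forall_dual _ fun g hg => ?_
    by_contra hne
    have hpos : 0 < ‖g‖ := norm_pos_iff.2 hne
    obtain ⟨n, hn⟩ := hf.exists_dist_lt g (show 0 < ‖g‖ / 4 by positivity)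
    rw [dist_eq_norm] at hn
    have h1 : |f n (v n)| ≤ ‖g - f n‖ := by
      have : f n (v n) = -((g - f n) (v n)) := by
        simp [hg (v n) (Submodule.subset_span (mem_range_self n))]
      rw [this, abs_neg]
      refine ((g - f n).le_opNorm (v n)).trans ?_
      nlinarith [hv1 n, norm_nonneg (g - f n)]
    have h2 := hv2 n
    have h3 := norm_sub_norm_le g (f n)
    linarith
  have hs : TopologicalSpace.IsSeparable (Submodule.span ℝ (range v) : Set E) :=
    (countable_range v).isSeparable.span
  have h2 := hs.closure
  rw [hd.closure_eq] at h2
  exact TopologicalSpace.isSeparable_univ_iff.1 h2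

variable {V : Type*} [NormedAddCommGroup V] [NormedSpace ℝ V]
  {H : Type*} [NormedAddCommGroup H] [InnerProductSpace ℝ H] {ι : V →L[ℝ] H}

/-- The embedding `H ⊆ V*` as a linear map. -/
noncomputable def toDualVₗ (ι : V →L[ℝ] H) : H →ₗ[ℝ] StrongDual ℝ V where
  toFun := toDualV ι
  map_add' x y := by ext v; simp [inner_add_left]
  map_smul' c x := by ext v; simp [inner_smul_left]

lemma norm_toDualV_le (h : H) : ‖toDualV ι h‖ ≤ ‖ι‖ * ‖h‖ := by
  refine ContinuousLinearMap.opNorm_le_bound _ (by positivity) fun v => ?_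
  rw [toDualV_apply]
  refine (norm_inner_le_norm _ _).trans ?_
  have := ι.le_opNorm v
  nlinarith [norm_nonneg h]

lemma continuous_toDualV (ι : V →L[ℝ] H) : Continuous (toDualV ι) :=
  ((toDualVₗ ι).mkContinuous ‖ι‖ norm_toDualV_le).continuous

lemma toDualV_injective (hd : DenseRange ι) : Function.Injective (toDualV ι) := by
  intro x y hxy
  refine hd.eq_of_inner_right (𝕜 := ℝ) ?_
  intro v
  rw [real_inner_comm, real_inner_comm y]
  exact congrArg (fun φ : StrongDual ℝ V => φ v) hxy

lemma IsGelfandTriple.denseRange_toDualV (hι : IsGelfandTriple ι) :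
    DenseRange (toDualV ι) := by
  have h := Submodule.dense_of_forall_dual (LinearMap.range (toDualVₗ ι)) fun φ hφ => by
    obtain ⟨v, rfl⟩ := hι.reflexive_V φ
    have h1 : ι v = 0 := by
      have : toDualV ι (ι v) v = 0 := hφ (toDualVₗ ι (ι v)) ⟨ι v, rfl⟩
      simpa using this
    have h2 : v = 0 := hι.injective (by simpa using h1)
    simp [h2]
  rw [LinearMap.coe_range] at h
  exact h

lemma IsGelfandTriple.separableSpace_dual (hι : IsGelfandTriple ι) :
    TopologicalSpace.SeparableSpace (StrongDual ℝ V) := by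
  have := hι.separable_H
  exact hι.denseRange_toDualV.separableSpace (continuous_toDualV ι)

lemma IsGelfandTriple.separableSpace (hι : IsGelfandTriple ι) :
    TopologicalSpace.SeparableSpace V := by
  have := hι.separableSpace_dual
  exact separableSpace_of_dual

lemma exists_extension_of_bound {E : Type*} [NormedAddCommGroup E] [NormedSpace ℝ E]
    (S : Submodule ℝ E) (φ : S →ₗ[ℝ] ℝ) {R : ℝ} (hR : 0 ≤ R) (hφ : ∀ x, ‖φ x‖ ≤ R * ‖x‖) :
    ∃ Φ : StrongDual ℝ E, (∀ x : S, Φ x = φ x) ∧ ‖Φ‖ ≤ R := by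
  obtain ⟨Φ, hΦ, hΦn⟩ := exists_extension_norm_eq S (φ.mkContinuous R hφ)
  exact ⟨Φ, hΦ, hΦn.le.trans (φ.mkContinuous_norm_le hR hφ)⟩

/-- Reflexivity of `V` in the form used for weak limits: a vector of `H` that acts on `H` as a
functional bounded by `R` times the norm of `V*` lies in the ball of radius `R` of `V`. -/
lemma IsGelfandTriple.exists_preimage (hι : IsGelfandTriple ι) {z : H} {R : ℝ} (hR : 0 ≤ R)
    (hz : ∀ h : H, |inner ℝ h z| ≤ R * ‖toDualV ι h‖) : ∃ v, ι v = z ∧ ‖v‖ ≤ R := by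
  let e := LinearEquiv.ofInjective (toDualVₗ ι) (toDualV_injective hι.denseRange)
  have hesymm : ∀ x, toDualV ι (e.symm x) = x := fun x =>
    congrArg Subtype.val (e.apply_symm_apply x)
  obtain ⟨Φ, hΦ, hΦn⟩ := exists_extension_of_bound _
    ((innerₗ H z).comp e.symm.toLinearMap) hR (fun x => by
      have := hz (e.symm x)
      rw [hesymm, real_inner_comm] at this
      exact this)
  obtain ⟨v, hv⟩ := hι.reflexive_V Φ
  have hact : ∀ h : H, inner ℝ h (ι v) = inner ℝ h z := by
    intro h
    have h1 := hΦ (e h)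
    rw [← hv, NormedSpace.dual_def] at h1
    have h2 : ((innerₗ H z).comp e.symm.toLinearMap) (e h) = inner ℝ z h := by
      simp
    rw [h2, real_inner_comm] at h1
    exact h1
  refine ⟨v, ext_inner_left ℝ hact, ?_⟩
  have h4 : ‖NormedSpace.inclusionInDoubleDual ℝ V v‖ = ‖v‖ :=
    (NormedSpace.inclusionInDoubleDualLi ℝ).norm_map v
  rw [← h4, hv]
  exact hΦn

/-- The Galerkin operator of a finite-dimensional subspace `W` of `V`: the orthogonal projection
of `H` onto `ι(W)`, followed by the inverse of `ι`. -/
structure IsGalerkinOp (ι : V →L[ℝ] H) (J : H →L[ℝ] V) : Prop where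
  symm : ∀ x y, inner ℝ (ι (J x)) y = inner ℝ x (ι (J y))
  idem : ∀ x, J (ι (J x)) = J x

lemma IsGalerkinOp.norm_le {J : H →L[ℝ] V} (hJ : IsGalerkinOp ι J) (x : H) :
    ‖ι (J x)‖ ≤ ‖x‖ := by
  have h1 : ‖ι (J x)‖ ^ 2 = inner ℝ x (ι (J x)) := by
    rw [← real_inner_self_eq_norm_sq, hJ.symm, hJ.idem]
  have h2 := real_inner_le_norm x (ι (J x))
  nlinarith [norm_nonneg (ι (J x)), norm_nonneg x, sq_nonneg (‖ι (J x)‖ - ‖x‖)]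

lemma exists_isGalerkinOp (hinj : Function.Injective ι) (W : Submodule ℝ V)
    [FiniteDimensional ℝ W] :
    ∃ J : H →L[ℝ] V, IsGalerkinOp ι J ∧ ∀ v ∈ W, J (ι v) = v := by
  let E : Submodule ℝ H := W.map ι.toLinearMap
  let e : W ≃ₗ[ℝ] E := Submodule.equivMapOfInjective ι.toLinearMap hinj W
  -- the inverse of `ι` on the image of `W`, bounded because its domain is finite-dimensional
  let j : E →L[ℝ] V := LinearMap.toContinuousLinearMap (W.subtype ∘ₗ e.symm.toLinearMap)
  have hj : ∀ x : E, ι (j x) = x := fun x => congrArg Subtype.val (e.apply_symm_apply x)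
  let J : H →L[ℝ] V := j.comp E.orthogonalProjectionOnto
  have hJ : ∀ x, ι (J x) = E.starProjection x := fun x => hj _
  have hJW : ∀ v ∈ W, J (ι v) = v := by
    intro v hv
    apply hinj
    rw [hJ, Submodule.starProjection_eq_self_iff]
    exact ⟨v, hv, rfl⟩
  refine ⟨J, ⟨fun x y => ?_, fun x => ?_⟩, hJW⟩
  · rw [hJ, hJ, Submodule.inner_starProjection_left_eq_right]
  · apply hJW
    change ((e.symm (E.orthogonalProjectionOnto x) : W) : V) ∈ W
    exact (e.symm _).2

/-- Galerkin operators onto the spans of the initial segments of a sequence. -/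
lemma exists_galerkin_scheme (hinj : Function.Injective ι) (d : ℕ → V) :
    ∃ J : ℕ → H →L[ℝ] V, (∀ n, IsGalerkinOp ι (J n)) ∧
      ∀ i n, i < n → J n (ι (d i)) = d i := by
  have h : ∀ n : ℕ, ∃ J : H →L[ℝ] V, IsGalerkinOp ι J ∧ ∀ i < n, J (ι (d i)) = d i := by
    intro n
    have hfd : FiniteDimensional ℝ (Submodule.span ℝ (d '' (Iio n))) :=
      FiniteDimensional.span_of_finite ℝ ((finite_Iio n).image d)
    obtain ⟨J, hJ, hJW⟩ := exists_isGalerkinOp hinj (Submodule.span ℝ (d '' (Iio n)))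
    exact ⟨J, hJ, fun i hi => hJW _ (Submodule.subset_span ⟨i, hi, rfl⟩)⟩
  choose J hJ hJd using h
  exact ⟨J, hJ, fun i n hi => hJd n i hi⟩

/-- Quantitative form of the compactness of `ι`: up to a small multiple of the norm of `V`, the
norm of `H` is controlled by finitely many functionals. -/
lemma IsCompactOperator.exists_finset_norm_sq_le (hι : IsCompactOperator ι) {η : ℝ} (hη : 0 < η) :
    ∃ F : Finset H, ∀ v, ‖ι v‖ ^ 2 ≤ η * ‖v‖ * ‖ι v‖ + ‖v‖ * ∑ h ∈ F, |inner ℝ (ι v) h| := by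
  have hc := hι.isCompact_closure_image_closedBall 1
  have htb : TotallyBounded (ι '' Metric.closedBall 0 1) :=
    hc.totallyBounded.subset subset_closure
  obtain ⟨F, hF, hcov⟩ := Metric.totallyBounded_iff.1 htb η hη
  refine ⟨hF.toFinset, fun v => ?_⟩
  rcases eq_or_ne v 0 with rfl | hv
  · simp
  have hpos : 0 < ‖v‖ := norm_pos_iff.2 hv
  have hmem : ι (‖v‖⁻¹ • v) ∈ ι '' Metric.closedBall 0 1 :=
    ⟨_, by simp [norm_smul, hpos.ne'], rfl⟩
  obtain ⟨h, hh, hdist⟩ := mem_iUnion₂.1 (hcov hmem)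
  rw [Metric.mem_ball, dist_eq_norm, map_smul] at hdist
  have hsum : |inner ℝ (ι v) h| ≤ ∑ h ∈ hF.toFinset, |inner ℝ (ι v) h| :=
    Finset.single_le_sum (f := fun h => |inner ℝ (ι v) h|) (fun _ _ => abs_nonneg _)
      (hF.mem_toFinset.2 hh)
  have e : ‖ι v‖ ^ 2 = ‖v‖ * (inner ℝ (ι v) (‖v‖⁻¹ • ι v - h) + inner ℝ (ι v) h) := by
    rw [← inner_add_right, sub_add_cancel, inner_smul_right, real_inner_self_eq_norm_sq]
    field_simp
  have h1 := (real_inner_le_norm (ι v) (‖v‖⁻¹ • ι v - h))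
  have h2 : ‖ι v‖ * ‖‖v‖⁻¹ • ι v - h‖ ≤ ‖ι v‖ * η := by gcongr
  rw [e]
  calc ‖v‖ * (inner ℝ (ι v) (‖v‖⁻¹ • ι v - h) + inner ℝ (ι v) h) ≤
      ‖v‖ * (‖ι v‖ * η + ∑ h ∈ hF.toFinset, |inner ℝ (ι v) h|) := by
        have := (le_abs_self _).trans hsum
        gcongr
        linarith
    _ = _ := by ring

/-- Bounded sequences of `V` that converge weakly in `H` converge strongly in `H`. -/
lemma IsCompactOperator.tendsto_of_tendsto_inner (hι : IsCompactOperator ι) {v : ℕ → V} {w : V}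
    {R : ℝ} (hR : ∀ k, ‖v k‖ ≤ R)
    (hv : ∀ h, Tendsto (fun k => inner ℝ (ι (v k)) h) atTop (𝓝 (inner ℝ (ι w) h))) :
    Tendsto (fun k => ι (v k)) atTop (𝓝 (ι w)) := by
  rw [tendsto_iff_norm_sub_tendsto_zero]
  have hsq : Tendsto (fun k => ‖ι (v k - w)‖ ^ 2) atTop (𝓝 0) := by
    set R' := R + ‖w‖ + 1 with hR'
    have hRpos : 0 < R' := by
      have := (norm_nonneg _).trans (hR 0)
      positivity
    have hb : ∀ k, ‖v k - w‖ ≤ R' := fun k => (norm_sub_le _ _).trans (by linarith [hR k])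
    refine Metric.tendsto_nhds.2 fun ε hε => ?_
    set K := R' * (‖ι‖ * R') with hK
    have hK0 : 0 ≤ K := by positivity
    obtain ⟨F, hF⟩ := hι.exists_finset_norm_sq_le (show 0 < ε / (2 * (K + 1)) by positivity)
    have hs : Tendsto (fun k => R' * ∑ h ∈ F, |inner ℝ (ι (v k - w)) h|) atTop (𝓝 0) := by
      have : Tendsto (fun k => R' * ∑ h ∈ F, |inner ℝ (ι (v k)) h - inner ℝ (ι w) h|) atTop
          (𝓝 (R' * ∑ h ∈ F, |inner ℝ (ι w) h - inner ℝ (ι w) h|)) :=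
        (tendsto_finsetSum _ fun h _ => ((hv h).sub_const _).abs).const_mul _
      simpa [inner_sub_left] using this
    filter_upwards [hs.eventually (gt_mem_nhds (half_pos hε))] with k hk
    rw [Real.dist_eq, sub_zero, abs_of_nonneg (by positivity)]
    refine (hF (v k - w)).trans_lt ?_
    have h1 : ‖v k - w‖ * ‖ι (v k - w)‖ ≤ K := by
      have h2 := (ι.le_opNorm (v k - w))
      have h3 : ‖ι (v k - w)‖ ≤ ‖ι‖ * R' := h2.trans (by gcongr; exact hb k)
      have := hb k
      rw [hK]
      gcongr
    have h4 : ε / (2 * (K + 1)) * ‖v k - w‖ * ‖ι (v k - w)‖ ≤ ε / 2 := by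
      rw [mul_assoc]
      calc _ ≤ ε / (2 * (K + 1)) * K := by gcongr
        _ ≤ ε / 2 := by
          rw [div_mul_eq_mul_div, div_le_div_iff₀ (by positivity) (by positivity)]
          nlinarith
    have h5 : ‖v k - w‖ * ∑ h ∈ F, |inner ℝ (ι (v k - w)) h| ≤
        R' * ∑ h ∈ F, |inner ℝ (ι (v k - w)) h| := by
      gcongr
      exact hb k
    linarith
  have h3 := hsq.sqrt
  simp only [Real.sqrt_zero, Real.sqrt_sq (norm_nonneg _), map_sub] at h3
  exact h3

end Gelfand

/-! ### Monotone drifts -/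

section Drift

variable {V : Type*} [NormedAddCommGroup V] [NormedSpace ℝ V]
  {H : Type*} [NormedAddCommGroup H] [InnerProductSpace ℝ H] {ι : V →L[ℝ] H}

/-- Minty's trick: a weakly monotone, hemicontinuous operator is sequentially continuous along
sequences that converge weakly in `V` and strongly in `H`, and whose image pairs to zero with the
error. -/
lemma tendsto_apply_of_minty {b : V → StrongDual ℝ V} {C : ℝ}
    (hmono : ∀ v₁ v₂, 2 * (b v₁ - b v₂) (v₁ - v₂) ≤ C * ‖ι (v₁ - v₂)‖ ^ 2)
    (hhemi : ∀ v₁ v₂ v, Continuous (fun s : ℝ => b (v₁ + s • v₂) v))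
    {u : ℕ → V} {w : V} (hweak : ∀ φ : StrongDual ℝ V, Tendsto (fun k => φ (u k)) atTop (𝓝 (φ w)))
    (hstrong : Tendsto (fun k => ι (u k)) atTop (𝓝 (ι w)))
    (hpair : Tendsto (fun k => b (u k) (u k - w)) atTop (𝓝 0)) (v : V) :
    Tendsto (fun k => b (u k) v) atTop (𝓝 (b w v)) := by
  have key : ∀ v : V, ∀ ε > 0, ∀ᶠ k in atTop, b w v - ε < b (u k) v := by
    intro v ε hε
    have hc : Tendsto (fun l : ℝ => b (w + l • v) v - C * l * ‖ι v‖ ^ 2 / 2) (𝓝[>] 0)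
        (𝓝 (b w v)) := by
      have h1 : Continuous (fun l : ℝ => b (w + l • v) v - C * l * ‖ι v‖ ^ 2 / 2) :=
        (hhemi w v v).sub (by fun_prop)
      have h2 := (h1.tendsto 0).mono_left (nhdsWithin_le_nhds (s := Ioi 0))
      simpa using h2
    obtain ⟨l, hl, hl0⟩ := ((hc.eventually (lt_mem_nhds
      (show b w v - ε < b w v by linarith))).and self_mem_nhdsWithin).exists
    have hl0' : 0 < l := hl0
    -- the lower bound for `b (u k) v` given by monotonicity between `u k` and `w + l v`
    have hlim : Tendsto (fun k => b (w + l • v) v + (b (u k) (u k - w) -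
        b (w + l • v) (u k - w)) / l - C * ‖ι (u k) - ι w - l • ι v‖ ^ 2 / (2 * l)) atTop
        (𝓝 (b (w + l • v) v + (0 - 0) / l - C * ‖ι w - ι w - l • ι v‖ ^ 2 / (2 * l))) := by
      refine ((hpair.sub ?_).div_const l |>.const_add _).sub
        (((((hstrong.sub_const _).sub_const _).norm.pow 2).const_mul C).div_const _)
      have := (hweak (b (w + l • v))).sub_const (b (w + l • v) w)
      simpa using this
    have e : b (w + l • v) v + (0 - 0) / l - C * ‖ι w - ι w - l • ι v‖ ^ 2 / (2 * l) =
        b (w + l • v) v - C * l * ‖ι v‖ ^ 2 / 2 := by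
      rw [sub_self, sub_self, zero_sub, norm_neg, norm_smul, Real.norm_of_nonneg hl0'.le]
      field_simp
      ring
    rw [e] at hlim
    filter_upwards [hlim.eventually (lt_mem_nhds hl)] with k hk
    refine hk.trans_le ?_
    have h3 := hmono (u k) (w + l • v)
    have e2 : u k - (w + l • v) = (u k - w) - l • v := by abel
    have e3 : ι (u k - (w + l • v)) = ι (u k) - ι w - l • ι v := by
      rw [e2, map_sub, map_sub, map_smul]
    rw [e3, e2] at h3
    simp only [sub_apply, map_sub (b (u k)), map_sub (b (w + l • v)),
      map_smul, smul_eq_mul] at h3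
    simp only [map_sub (b (u k)), map_sub (b (w + l • v))]
    have h4 : (b (w + l • v) v + (b (u k) (u k) - b (u k) w - (b (w + l • v) (u k) -
        b (w + l • v) w)) / l - C * ‖ι (u k) - ι w - l • ι v‖ ^ 2 / (2 * l)) * (2 * l) ≤
        b (u k) v * (2 * l) := by
      field_simp
      linarith
    exact le_of_mul_le_mul_right h4 (by positivity)
  refine Metric.tendsto_nhds.2 fun ε hε => ?_
  filter_upwards [key v ε hε, key (-v) ε hε] with k h1 h2
  rw [map_neg, map_neg] at h2
  rw [Real.dist_eq, abs_lt]
  constructor <;> linarith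

lemma IsVariationalSolution.apply_left {α : ℝ}
    {B : ℝ → V → StrongDual ℝ V} {s : ℝ} {z : H} {Z : ℝ → H} (hd : DenseRange ι)
    (hZ : IsVariationalSolution ι α B s z Z) : Z s = z := by
  obtain ⟨-, u, -, -, hu3⟩ := hZ
  have := (hu3 s le_rfl).2
  simp only [intervalIntegral.integral_same, add_zero] at this
  exact toDualV_injective hd this

lemma IsVariationalSolution.restart {α : ℝ}
    {B : ℝ → V → StrongDual ℝ V} {s r : ℝ} {z : H} {Z : ℝ → H} (hsr : s ≤ r)
    (hZ : IsVariationalSolution ι α B s z Z) : IsVariationalSolution ι α B r (Z r) Z := by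
  obtain ⟨hc, u, hu1, hu2, hu3⟩ := hZ
  refine ⟨hc.mono (Ici_subset_Ici.2 hsr), u, ?_, fun t => ?_, fun t ht => ?_⟩
  · exact ae_mono (Measure.restrict_mono (Ici_subset_Ici.2 hsr) le_rfl) hu1
  · exact (hu2 t).mono_measure (Measure.restrict_mono (Icc_subset_Icc_left hsr) le_rfl)
  · have h1 := hu3 t (hsr.trans ht)
    have h2 := hu3 r hsr
    refine ⟨h2.1.symm.trans h1.1, ?_⟩
    rw [h1.2, h2.2, ← intervalIntegral.integral_interval_sub_left h1.1 h2.1]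
    abel

variable [MeasurableSpace V]

/-- A deterministic drift `B : ℝ × V → V*` that is weakly monotone, coercive and of growth `α`,
with error function `g` bounded above on bounded intervals. -/
structure IsMonotoneDrift (ι : V →L[ℝ] H) (α : ℝ) (B : ℝ → V → StrongDual ℝ V) (C c : ℝ)
    (g : ℝ → ℝ) : Prop where
  measurable : Measurable (fun p : ℝ × V => B p.1 p.2)
  C_nonneg : 0 ≤ C
  c_pos : 0 < c
  exists_bound : ∀ a b, ∃ K, 0 ≤ K ∧ ∀ t ∈ Icc a b, g t ≤ K
  hemicontinuity : ∀ t v₁ v₂ v, Continuous (fun s : ℝ => B t (v₁ + s • v₂) v)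
  monotonicity : ∀ t v₁ v₂, 2 * (B t v₁ - B t v₂) (v₁ - v₂) ≤ C * ‖ι (v₁ - v₂)‖ ^ 2
  coercivity : ∀ t v, 2 * B t v v ≤ -c * ‖v‖ ^ α + g t
  growth : ∀ t v, ‖B t v‖ ^ (α / (α - 1)) ≤ C * ‖v‖ ^ α + g t

variable {α : ℝ} {B : ℝ → V → StrongDual ℝ V} {C c : ℝ} {g : ℝ → ℝ}

lemma holderConjugate_ofReal (hα : 1 < α) :
    (ENNReal.ofReal α).HolderConjugate (ENNReal.ofReal (α / (α - 1))) := by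
  have := Real.HolderConjugate.conjExponent hα
  exact this.ennrealOfReal

/-- The growth condition in unexponentiated form. -/
lemma IsMonotoneDrift.exists_norm_le (hB : IsMonotoneDrift ι α B C c g) (hα : 1 < α) (a T : ℝ) :
    ∃ K, 0 ≤ K ∧ ∀ t ∈ Icc a T, ∀ v, ‖B t v‖ ≤ K * (1 + ‖v‖) ^ (α - 1) := by
  obtain ⟨K, hK, hg⟩ := hB.exists_bound a T
  have hC := hB.C_nonneg
  refine ⟨(C + K) ^ ((α - 1) / α), by positivity, fun t ht v => ?_⟩
  have hα0 : 0 < α - 1 := by linarith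
  have h1 : ‖B t v‖ ^ (α / (α - 1)) ≤ (C + K) * (1 + ‖v‖) ^ α := by
    have h2 : ‖v‖ ^ α ≤ (1 + ‖v‖) ^ α := by
      gcongr
      linarith
    have h3 : 1 ≤ (1 + ‖v‖) ^ α :=
      Real.one_le_rpow (by linarith [norm_nonneg v]) (by linarith)
    have h4 := hB.growth t v
    have h5 := hg t ht
    nlinarith
  calc ‖B t v‖ = (‖B t v‖ ^ (α / (α - 1))) ^ ((α - 1) / α) := by
        rw [← Real.rpow_mul (norm_nonneg _)]
        have : α / (α - 1) * ((α - 1) / α) = 1 := by field_simp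
        rw [this, Real.rpow_one]
    _ ≤ ((C + K) * (1 + ‖v‖) ^ α) ^ ((α - 1) / α) := by
        have : 0 ≤ (α - 1) / α := by positivity
        gcongr
    _ = _ := by
        rw [Real.mul_rpow (by positivity) (by positivity), ← Real.rpow_mul (by positivity)]
        congr 2
        field_simp

lemma IsMonotoneDrift.exists_norm_le_linear (hB : IsMonotoneDrift ι α B C c g) (hα : 1 < α)
    (hα2 : α < 2) (a T : ℝ) :
    ∃ K, 0 ≤ K ∧ ∀ t ∈ Icc a T, ∀ v, ‖B t v‖ ≤ K * (1 + ‖v‖) := by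
  obtain ⟨K, hK, h⟩ := hB.exists_norm_le hα a T
  refine ⟨K, hK, fun t ht v => (h t ht v).trans ?_⟩
  gcongr
  calc (1 + ‖v‖) ^ (α - 1) ≤ (1 + ‖v‖) ^ (1 : ℝ) := by
        apply Real.rpow_le_rpow_of_exponent_le <;> linarith [norm_nonneg v]
    _ = 1 + ‖v‖ := Real.rpow_one _

/-- Demicontinuity of monotone drifts. -/
lemma IsMonotoneDrift.tendsto_apply (hB : IsMonotoneDrift ι α B C c g) (hα : 1 < α)
    (t : ℝ) {u : ℕ → V} {w : V} (hu : Tendsto u atTop (𝓝 w)) (v : V) :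
    Tendsto (fun k => B t (u k) v) atTop (𝓝 (B t w v)) := by
  refine tendsto_apply_of_minty (hB.monotonicity t) (hB.hemicontinuity t)
    (fun φ => (φ.continuous.tendsto _).comp hu) ((ι.continuous.tendsto _).comp hu) ?_ v
  obtain ⟨K, hK, h⟩ := hB.exists_norm_le hα t t
  have h0 : Tendsto (fun k => K * (1 + ‖u k‖) ^ (α - 1) * ‖u k - w‖) atTop
      (𝓝 (K * (1 + ‖w‖) ^ (α - 1) * ‖w - w‖)) := by
    refine Tendsto.mul (Tendsto.const_mul _ ?_) (hu.sub_const w).norm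
    exact (hu.norm.const_add 1).rpow_const (Or.inr (by linarith))
  simp only [sub_self, norm_zero, mul_zero] at h0
  refine squeeze_zero_norm (fun k => ((B t (u k)).le_opNorm _).trans ?_) h0
  gcongr
  exact h t ⟨le_rfl, le_rfl⟩ _

variable [BorelSpace V]

lemma IsMonotoneDrift.aestronglyMeasurable
    [SecondCountableTopology (StrongDual ℝ V)]
    (hB : IsMonotoneDrift ι α B C c g) {μ : Measure ℝ} {u : ℝ → V}
    (hu : AEStronglyMeasurable u μ) : AEStronglyMeasurable (fun r => B r (u r)) μ :=
  (hB.measurable.comp_aemeasurable (aemeasurable_id.prodMk hu.aemeasurable)).aestronglyMeasurable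

lemma IsMonotoneDrift.memLp [SecondCountableTopology (StrongDual ℝ V)]
    (hB : IsMonotoneDrift ι α B C c g) (hα : 1 < α) {a T : ℝ} {u : ℝ → V}
    (hu : MemLp u (ENNReal.ofReal α) (volume.restrict (Icc a T))) :
    MemLp (fun r => B r (u r)) (ENNReal.ofReal (α / (α - 1))) (volume.restrict (Icc a T)) := by
  have hα0 : 0 < α - 1 := by linarith
  have hq : 0 < α / (α - 1) := by positivity
  have hm := hB.aestronglyMeasurable hu.aestronglyMeasurable
  have hfin : IsFiniteMeasure (volume.restrict (Icc a T)) := ⟨by simp⟩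
  rw [← integrable_norm_rpow_iff hm (by simpa using hq) (by simp), ENNReal.toReal_ofReal hq.le]
  obtain ⟨K, hK, hg⟩ := hB.exists_bound a T
  have hi := hu.integrable_norm_rpow (by simp; linarith) (by simp)
  rw [ENNReal.toReal_ofReal (by linarith)] at hi
  refine Integrable.mono' ((hi.const_mul C).add (integrable_const K))
    ((hm.norm.aemeasurable.pow_const _).aestronglyMeasurable) ?_
  rw [ae_restrict_iff' measurableSet_Icc]
  refine Eventually.of_forall fun r hr => ?_
  rw [Real.norm_of_nonneg (by positivity)]
  have := hB.growth r (u r)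
  have := hg r hr
  simp only [Pi.add_apply]
  linarith

/-! ### A priori properties of variational solutions -/

/-- A solution on `[s, ∞)` together with its `V`-valued version, in the form needed for the energy
equality on every interval `[a, T]` with `s ≤ a`. -/
lemma IsVariationalSolution.exists_version [SecondCountableTopology (StrongDual ℝ V)]
    (hB : IsMonotoneDrift ι α B C c g) (hα : 1 < α) {s : ℝ} {z : H} {Z : ℝ → H}
    (hZ : IsVariationalSolution ι α B s z Z) :
    ∃ u : ℝ → V, ∀ a T, s ≤ a →
      MemLp u (ENNReal.ofReal α) (volume.restrict (Icc a T)) ∧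
      MemLp (fun r => B r (u r)) (ENNReal.ofReal (α / (α - 1))) (volume.restrict (Icc a T)) ∧
      (∀ᵐ r ∂(volume.restrict (Icc a T)), ι (u r) = Z r) ∧
      (∀ t ∈ Icc a T, toDualV ι (Z t) = toDualV ι (Z a) + ∫ r in a..t, B r (u r)) ∧
      ∃ M, ∀ r ∈ Icc a T, ‖Z r‖ ≤ M := by
  obtain ⟨hc, u, hu1, hu2, hu3⟩ := hZ
  refine ⟨u, fun a T hsa => ?_⟩
  have hsub : Icc a T ⊆ Icc s T := Icc_subset_Icc_left hsa
  have hm := (hu2 T).mono_measure (Measure.restrict_mono hsub le_rfl)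
  refine ⟨hm, hB.memLp hα hm, ?_, fun t ht => ?_, ?_⟩
  · exact ae_mono (Measure.restrict_mono (fun r hr => hsa.trans hr.1) le_rfl) hu1
  · have h1 := hu3 t (hsa.trans ht.1)
    have h2 := hu3 a hsa
    rw [h1.2, h2.2, ← intervalIntegral.integral_interval_sub_left h1.1 h2.1]
    abel
  · obtain ⟨M, hM⟩ := (isCompact_Icc (a := a) (b := T)).exists_bound_of_continuousOn
      (hc.mono fun r hr => hsa.trans hr.1)
    exact ⟨M, hM⟩

/-- Continuous dependence on the initial value. Uniqueness is the special case of equal initial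
values. -/
lemma IsVariationalSolution.norm_sub_sq_le [SecondCountableTopology (StrongDual ℝ V)]
    (hd : DenseRange ι) (hB : IsMonotoneDrift ι α B C c g) (hα : 1 < α)
    {s : ℝ} {z₁ z₂ : H} {Z₁ Z₂ : ℝ → H}
    (h₁ : IsVariationalSolution ι α B s z₁ Z₁) (h₂ : IsVariationalSolution ι α B s z₂ Z₂)
    {t : ℝ} (hst : s ≤ t) :
    ‖Z₁ t - Z₂ t‖ ^ 2 ≤ ‖z₁ - z₂‖ ^ 2 * Real.exp (C * (t - s)) := by
  have := holderConjugate_ofReal hα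
  obtain ⟨u₁, hu₁⟩ := h₁.exists_version hB hα
  obtain ⟨u₂, hu₂⟩ := h₂.exists_version hB hα
  have hcont : ContinuousOn (fun r => ‖Z₁ r - Z₂ r‖ ^ 2) (Icc s t) :=
    ((h₁.1.sub h₂.1).norm.pow 2).mono Icc_subset_Ici_self
  have key : ∀ x ∈ Icc s t, ‖Z₁ x - Z₂ x‖ ^ 2 ≤ ‖z₁ - z₂‖ ^ 2 +
      C * ∫ r in s..x, ‖Z₁ r - Z₂ r‖ ^ 2 := by
    intro x hx
    obtain ⟨m₁, n₁, e₁, i₁, M₁, b₁⟩ := hu₁ s x le_rfl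
    obtain ⟨m₂, n₂, e₂, i₂, M₂, b₂⟩ := hu₂ s x le_rfl
    have hq : 1 ≤ ENNReal.ofReal (α / (α - 1)) :=
      (ENNReal.HolderConjugate.symm (p := ENNReal.ofReal α)).one_le
    have hfin : ∀ y, IsFiniteMeasure (volume.restrict (Icc s y)) := fun y => ⟨by simp⟩
    have hE := energy_eq (u := fun r => u₁ r - u₂ r) (Z := fun r => Z₁ r - Z₂ r)
      (b := fun r => B r (u₁ r) - B r (u₂ r)) (M := M₁ + M₂) (p := ENNReal.ofReal α)
      (q := ENNReal.ofReal (α / (α - 1))) hd (by simp) hx.1 (m₁.sub m₂)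
      (by filter_upwards [e₁, e₂] with r h1 h2; rw [map_sub, h1, h2])
      (fun r hr => (norm_sub_le _ _).trans (add_le_add (b₁ r hr) (b₂ r hr))) (n₁.sub n₂)
      (fun y hy => by
        have hsub : Icc s y ⊆ Icc s x := Icc_subset_Icc_right hy.2
        have hi₁ : IntervalIntegrable (fun r => B r (u₁ r)) volume s y :=
          (intervalIntegrable_iff_integrableOn_Icc_of_le hy.1).2
            (IntegrableOn.mono_set (n₁.integrable hq) hsub)
        have hi₂ : IntervalIntegrable (fun r => B r (u₂ r)) volume s y :=
          (intervalIntegrable_iff_integrableOn_Icc_of_le hy.1).2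
            (IntegrableOn.mono_set (n₂.integrable hq) hsub)
        rw [intervalIntegral.integral_sub hi₁ hi₂]
        have e : ∀ w₁ w₂, toDualV ι (w₁ - w₂) = toDualV ι w₁ - toDualV ι w₂ :=
          fun w₁ w₂ => (toDualVₗ ι).map_sub w₁ w₂
        rw [e, e, i₁ y hy, i₂ y hy]
        abel)
    have hint := (n₁.sub n₂).dual_apply (p := ENNReal.ofReal α) (m₁.sub m₂)
    have hle : 2 * ∫ r in s..x, (B r (u₁ r) - B r (u₂ r)) (u₁ r - u₂ r) ≤
        C * ∫ r in s..x, ‖Z₁ r - Z₂ r‖ ^ 2 := by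
      rw [← intervalIntegral.integral_const_mul, ← intervalIntegral.integral_const_mul,
        intervalIntegral.integral_of_le hx.1, intervalIntegral.integral_of_le hx.1,
        ← integral_Icc_eq_integral_Ioc, ← integral_Icc_eq_integral_Ioc]
      refine integral_mono_ae (hint.const_mul 2) ?_ ?_
      · exact ((hcont.mono (Icc_subset_Icc_right hx.2)).const_mul C).integrableOn_Icc
      · filter_upwards [e₁, e₂] with r h1 h2
        have := hB.monotonicity r (u₁ r) (u₂ r)
        rwa [map_sub ι, h1, h2] at this
    rw [h₁.apply_left hd, h₂.apply_left hd] at hE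
    linarith
  exact le_mul_exp_of_le_add_mul_integral hB.C_nonneg hcont key t ⟨hst, le_rfl⟩

lemma IsVariationalSolution.unique [SecondCountableTopology (StrongDual ℝ V)]
    (hd : DenseRange ι) (hB : IsMonotoneDrift ι α B C c g) (hα : 1 < α)
    {s : ℝ} {z : H} {Z₁ Z₂ : ℝ → H}
    (h₁ : IsVariationalSolution ι α B s z Z₁) (h₂ : IsVariationalSolution ι α B s z Z₂)
    {t : ℝ} (hst : s ≤ t) : Z₁ t = Z₂ t := by
  have h := h₁.norm_sub_sq_le hd hB hα h₂ hst
  simp only [sub_self, norm_zero, ne_eq, OfNat.ofNat_ne_zero, not_false_eq_true, zero_pow,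
    zero_mul] at h
  have h2 : ‖Z₁ t - Z₂ t‖ = 0 := by nlinarith [norm_nonneg (Z₁ t - Z₂ t)]
  exact sub_eq_zero.1 (norm_eq_zero.1 h2)

end Drift

/-! ### Ordinary differential equations with a one-sided Lipschitz right-hand side -/

section Delay

variable {H : Type*} [NormedAddCommGroup H] [InnerProductSpace ℝ H]

/-- Tonelli's approximations to `x' = F(t, x)`, `x(s) = x₀`: the `k`-th Picard iterate of the
equation in which `F` is evaluated with delay `δ`. It solves the delayed equation up to time
`s + k δ`. -/
noncomputable def delayIterate (F : ℝ → H → H) (s δ : ℝ) (x₀ : H) : ℕ → ℝ → H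
  | 0, _ => x₀
  | k + 1, t => x₀ + ∫ r in s..(max s t), F r (delayIterate F s δ x₀ k (r - δ))

/-- Assumptions on the right-hand side of an ordinary differential equation on `[s, ∞)`: joint
measurability, linear growth, one-sided Lipschitz continuity and demicontinuity. -/
structure IsOneSidedLipschitz [MeasurableSpace H] (F : ℝ → H → H) (C : ℝ) : Prop where
  measurable : Measurable (fun p : ℝ × H => F p.1 p.2)
  C_nonneg : 0 ≤ C
  exists_norm_le : ∀ a T, ∃ K, 0 ≤ K ∧ ∀ t ∈ Icc a T, ∀ x, ‖F t x‖ ≤ K * (1 + ‖x‖)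
  inner_le : ∀ t x y, 2 * inner ℝ (F t x - F t y) (x - y) ≤ C * ‖x - y‖ ^ 2
  tendsto : ∀ t (x : ℕ → H) (y : H), Tendsto x atTop (𝓝 y) → ∀ h,
    Tendsto (fun k => inner ℝ (F t (x k)) h) atTop (𝓝 (inner ℝ (F t y) h))

lemma continuous_integral_max {G : ℝ → H} {s : ℝ}
    (hG : ∀ T, IntegrableOn G (Icc s T) volume) :
    Continuous (fun t => ∫ r in s..(max s t), G r) := by
  have hI : ∀ x y, IntervalIntegrable ((Ici s).indicator G) volume x y := by
    intro x y
    rw [intervalIntegrable_iff]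
    refine (integrableOn_indicator_iff measurableSet_Ici).2 ((hG (max x y)).mono_set ?_)
    rintro r ⟨h1, h2⟩
    exact ⟨h1, h2.2⟩
  have hc := (intervalIntegral.continuous_primitive hI s).comp
    (continuous_const.max continuous_id : Continuous fun t : ℝ => max s t)
  refine hc.congr fun t => ?_
  refine intervalIntegral.integral_congr fun r hr => ?_
  rw [uIcc_of_le (le_max_left s t)] at hr
  exact indicator_of_mem (show r ∈ Ici s from hr.1) G

lemma delayIterate_of_le {F : ℝ → H → H} {s δ : ℝ} (x₀ : H) (k : ℕ) {t : ℝ} (ht : t ≤ s) :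
    delayIterate F s δ x₀ k t = x₀ := by
  cases k with
  | zero => rfl
  | succ k => simp [delayIterate, max_eq_left ht]

lemma delayIterate_succ_eq {F : ℝ → H → H} {s δ : ℝ} (x₀ : H) (k : ℕ) {t : ℝ}
    (ht : t ≤ s + k * δ) :
    delayIterate F s δ x₀ (k + 1) t = delayIterate F s δ x₀ k t := by
  induction k generalizing t with
  | zero =>
    have hts : t ≤ s := by simpa using ht
    rw [delayIterate_of_le _ _ hts, delayIterate_of_le _ _ hts]
  | succ k ih =>
    rcases le_total t s with hts | hts
    · rw [delayIterate_of_le _ _ hts, delayIterate_of_le _ _ hts]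
    rw [delayIterate]
    conv_rhs => rw [delayIterate]
    congr 1
    refine intervalIntegral.integral_congr fun r hr => ?_
    rw [uIcc_of_le (le_max_left s t), max_eq_right hts] at hr
    push_cast at ht
    exact congrArg (F r) (ih (by linarith [hr.2]))

lemma one_add_norm_delayIterate_le {F : ℝ → H → H} {s δ K T : ℝ} (hδ : 0 ≤ δ) (hK : 0 ≤ K)
    (h : ∀ t ∈ Icc s T, ∀ x, ‖F t x‖ ≤ K * (1 + ‖x‖)) (x₀ : H)
    (k : ℕ) {t : ℝ} (ht : t ≤ T) :
    1 + ‖delayIterate F s δ x₀ k t‖ ≤ (1 + ‖x₀‖) * Real.exp (K * (max s t - s)) := by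
  have hmax : 0 ≤ max s t - s := sub_nonneg.2 (le_max_left s t)
  induction k generalizing t with
  | zero =>
    have : 1 ≤ Real.exp (K * (max s t - s)) := Real.one_le_exp (by positivity)
    simp only [delayIterate]
    nlinarith [norm_nonneg x₀]
  | succ k ih =>
    rcases le_total t s with hts | hts
    · rw [delayIterate_of_le _ _ hts, max_eq_left hts]
      simp
    rw [max_eq_right hts]
    have hstep : ‖∫ r in s..t, F r (delayIterate F s δ x₀ k (r - δ))‖ ≤
        ∫ r in s..t, K * ((1 + ‖x₀‖) * Real.exp (K * (r - s))) := by
      refine intervalIntegral.norm_integral_le_of_norm_le hts (Eventually.of_forall fun r hr => ?_)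
        (Continuous.intervalIntegrable (by fun_prop) _ _)
      have hrT : r ≤ T := hr.2.trans ht
      refine (h r ⟨hr.1.le, hrT⟩ _).trans ?_
      gcongr
      refine (ih (t := r - δ) (by linarith) (sub_nonneg.2 (le_max_left _ _))).trans ?_
      have : max s (r - δ) ≤ r := max_le hr.1.le (by linarith)
      gcongr
    have hint : ∫ r in s..t, K * ((1 + ‖x₀‖) * Real.exp (K * (r - s))) =
        (1 + ‖x₀‖) * Real.exp (K * (t - s)) - (1 + ‖x₀‖) := by
      have hd : ∀ r ∈ uIcc s t, HasDerivAt (fun r => (1 + ‖x₀‖) * Real.exp (K * (r - s)))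
          (K * ((1 + ‖x₀‖) * Real.exp (K * (r - s)))) r := by
        intro r _
        have h1 : HasDerivAt (fun r : ℝ => K * (r - s)) K r := by
          simpa using ((hasDerivAt_id r).sub_const s).const_mul K
        convert! (h1.exp).const_mul (1 + ‖x₀‖) using 1
        ring
      rw [intervalIntegral.integral_eq_sub_of_hasDerivAt hd
        (Continuous.intervalIntegrable (by fun_prop) _ _)]
      simp
    rw [delayIterate, max_eq_right hts]
    have := norm_add_le x₀ (∫ r in s..t, F r (delayIterate F s δ x₀ k (r - δ)))
    linarith

/-- The energy equality for primitives of bounded functions with values in a Hilbert space. -/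
lemma norm_sq_sub_norm_sq_eq_integral [CompleteSpace H] {a T : ℝ} (haT : a ≤ T) {y f : ℝ → H}
    (hy : ContinuousOn y (Icc a T)) (hf : AEStronglyMeasurable f (volume.restrict (Icc a T)))
    {L : ℝ} (hL : ∀ r ∈ Icc a T, ‖f r‖ ≤ L) (heq : ∀ t ∈ Icc a T, y t = y a + ∫ r in a..t, f r) :
    ‖y T‖ ^ 2 - ‖y a‖ ^ 2 = 2 * ∫ r in a..T, inner ℝ (f r) (y r) := by
  have hfin : IsFiniteMeasure (volume.restrict (Icc a T)) := ⟨by simp⟩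
  obtain ⟨M, hM⟩ := (isCompact_Icc (a := a) (b := T)).exists_bound_of_continuousOn hy
  have hfb : ∀ᵐ r ∂(volume.restrict (Icc a T)), ‖f r‖ ≤ L := by
    rw [ae_restrict_iff' measurableSet_Icc]
    exact Eventually.of_forall hL
  have hfi : IntegrableOn f (Icc a T) volume := (MemLp.of_bound (p := 1) hf L hfb).integrable le_rfl
  let Λ : H →L[ℝ] StrongDual ℝ H :=
    (toDualVₗ (ContinuousLinearMap.id ℝ H)).mkContinuous _ norm_toDualV_le
  have hΛ : ∀ h, Λ h = toDualV (ContinuousLinearMap.id ℝ H) h := fun _ => rfl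
  have hyb : ∀ᵐ r ∂(volume.restrict (Icc a T)), ‖y r‖ ≤ M := by
    rw [ae_restrict_iff' measurableSet_Icc]
    exact Eventually.of_forall hM
  have h := energy_eq (ι := ContinuousLinearMap.id ℝ H) (p := 2) (q := 2) (u := y) (Z := y)
    (b := fun r => Λ (f r)) (M := M) (Function.surjective_id.denseRange) (by simp) haT
    (MemLp.of_bound (hy.aestronglyMeasurable measurableSet_Icc) M hyb)
    (Eventually.of_forall fun _ => rfl) hM
    (MemLp.of_bound (Λ.continuous.comp_aestronglyMeasurable hf) (‖Λ‖ * L) (by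
      filter_upwards [hfb] with r hr
      exact (Λ.le_opNorm _).trans (by gcongr)))
    (fun t ht => by
      have hi : IntervalIntegrable f volume a t :=
        (intervalIntegrable_iff_integrableOn_Icc_of_le ht.1).2
          (hfi.mono_set (Icc_subset_Icc_right ht.2))
      rw [Λ.intervalIntegral_comp_comm hi, ← hΛ, ← hΛ, heq t ht, map_add])
  exact h

variable [MeasurableSpace H] [BorelSpace H] [SecondCountableTopology H]
  {F : ℝ → H → H} {C s : ℝ}

lemma IsOneSidedLipschitz.stronglyMeasurable (hF : IsOneSidedLipschitz F C) {y : ℝ → H}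
    (hy : Continuous y) : StronglyMeasurable (fun r => F r (y r)) :=
  (hF.measurable.comp (measurable_id.prodMk hy.measurable)).stronglyMeasurable

lemma IsOneSidedLipschitz.integrableOn (hF : IsOneSidedLipschitz F C) {y : ℝ → H}
    (hy : Continuous y) (a T : ℝ) : IntegrableOn (fun r => F r (y r)) (Icc a T) volume := by
  obtain ⟨K, hK, h⟩ := hF.exists_norm_le a T
  obtain ⟨M, hM⟩ := (isCompact_Icc (a := a) (b := T)).exists_bound_of_continuousOn hy.continuousOn
  refine Measure.integrableOn_of_bounded (M := K * (1 + M)) (by simp)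
    (hF.stronglyMeasurable hy).aestronglyMeasurable ?_
  rw [ae_restrict_iff' measurableSet_Icc]
  refine Eventually.of_forall fun r hr => (h r hr _).trans ?_
  have := hM r hr
  gcongr

lemma continuous_delayIterate (hF : IsOneSidedLipschitz F C) (δ : ℝ) (x₀ : H) (k : ℕ) :
    Continuous (delayIterate F s δ x₀ k) := by
  induction k with
  | zero => exact continuous_const
  | succ k ih =>
    exact continuous_const.add (continuous_integral_max fun T =>
      hF.integrableOn (ih.comp (continuous_sub_right δ)) s T)

/-- Solutions of two delayed equations with small delays are close to each other. -/
lemma IsOneSidedLipschitz.norm_sub_sq_le_of_delay [CompleteSpace H]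
    (hF : IsOneSidedLipschitz F C) {T L σ δ₁ δ₂ : ℝ} (hσ : 0 ≤ σ) (hL : 0 ≤ L) {y₁ y₂ : ℝ → H}
    (hc₁ : Continuous y₁) (hc₂ : Continuous y₂) (h0 : y₁ s = y₂ s)
    (hb₁ : ∀ r ∈ Icc s T, ‖F r (y₁ (r - δ₁))‖ ≤ L) (hb₂ : ∀ r ∈ Icc s T, ‖F r (y₂ (r - δ₂))‖ ≤ L)
    (hd : ∀ r ∈ Icc s T, ‖(y₁ r - y₂ r) - (y₁ (r - δ₁) - y₂ (r - δ₂))‖ ≤ L * σ)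
    (he₁ : ∀ t ∈ Icc s T, y₁ t = y₁ s + ∫ r in s..t, F r (y₁ (r - δ₁)))
    (he₂ : ∀ t ∈ Icc s T, y₂ t = y₂ s + ∫ r in s..t, F r (y₂ (r - δ₂))) {t : ℝ}
    (ht : t ∈ Icc s T) :
    ‖y₁ t - y₂ t‖ ^ 2 ≤
      (T - s) * (2 * C * (L * σ) ^ 2 + 4 * L * (L * σ)) * Real.exp (2 * C * (t - s)) := by
  have hC := hF.C_nonneg
  have hsT : s ≤ T := ht.1.trans ht.2
  have hm₁ : StronglyMeasurable fun r => F r (y₁ (r - δ₁)) :=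
    hF.stronglyMeasurable (hc₁.comp (continuous_sub_right δ₁))
  have hm₂ : StronglyMeasurable fun r => F r (y₂ (r - δ₂)) :=
    hF.stronglyMeasurable (hc₂.comp (continuous_sub_right δ₂))
  have hi₁ : ∀ x, IntegrableOn (fun r => F r (y₁ (r - δ₁))) (Icc s x) := fun x =>
    hF.integrableOn (hc₁.comp (continuous_sub_right δ₁)) s x
  have hi₂ : ∀ x, IntegrableOn (fun r => F r (y₂ (r - δ₂))) (Icc s x) := fun x =>
    hF.integrableOn (hc₂.comp (continuous_sub_right δ₂)) s x
  have hcw : Continuous (fun r => y₁ r - y₂ r) := hc₁.sub hc₂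
  refine le_mul_exp_of_le_add_mul_integral (φ := fun t => ‖y₁ t - y₂ t‖ ^ 2) (T := T)
    (by positivity) ((hcw.norm.pow 2).continuousOn) (fun x hx => ?_) t ht
  have hsub : Icc s x ⊆ Icc s T := Icc_subset_Icc_right hx.2
  have hE := norm_sq_sub_norm_sq_eq_integral (a := s) (T := x) hx.1
    (y := fun r => y₁ r - y₂ r) (f := fun r => F r (y₁ (r - δ₁)) - F r (y₂ (r - δ₂)))
    hcw.continuousOn (hm₁.sub hm₂).aestronglyMeasurable (L := L + L)
    (fun r hr => (norm_sub_le _ _).trans (add_le_add (hb₁ r (hsub hr)) (hb₂ r (hsub hr))))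
    (fun y hy => by
      rw [intervalIntegral.integral_sub
        ((intervalIntegrable_iff_integrableOn_Icc_of_le hy.1).2 (hi₁ y))
        ((intervalIntegrable_iff_integrableOn_Icc_of_le hy.1).2 (hi₂ y)),
        he₁ y (hsub hy), he₂ y (hsub hy)]
      abel)
  rw [h0, sub_self, norm_zero] at hE
  -- the one-sided Lipschitz condition applies to the difference `w'` of the delayed values, which
  -- is close to the difference `w` of the present ones
  have hpt : ∀ r ∈ Icc s x, 2 * inner ℝ (F r (y₁ (r - δ₁)) - F r (y₂ (r - δ₂))) (y₁ r - y₂ r) ≤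
      (2 * C * (L * σ) ^ 2 + 4 * L * (L * σ)) + 2 * C * ‖y₁ r - y₂ r‖ ^ 2 := by
    intro r hr
    set f := F r (y₁ (r - δ₁)) - F r (y₂ (r - δ₂)) with hf
    set w := y₁ r - y₂ r with hw
    set w' := y₁ (r - δ₁) - y₂ (r - δ₂) with hw'
    have h1 := hF.inner_le r (y₁ (r - δ₁)) (y₂ (r - δ₂))
    rw [← hf, ← hw'] at h1
    have h2 := hd r (hsub hr)
    rw [← hw, ← hw'] at h2
    have h3 : ‖f‖ ≤ L + L :=
      (norm_sub_le _ _).trans (add_le_add (hb₁ r (hsub hr)) (hb₂ r (hsub hr)))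
    have h4 : inner ℝ f w = inner ℝ f w' + inner ℝ f (w - w') := by
      rw [← inner_add_right]; congr 1; abel
    have h5 : inner ℝ f (w - w') ≤ (L + L) * (L * σ) :=
      (real_inner_le_norm _ _).trans (by gcongr)
    have h6 : ‖w'‖ ≤ ‖w‖ + L * σ := by
      have := norm_sub_le w (w - w')
      rw [sub_sub_cancel] at this
      linarith
    have h7 : ‖w'‖ ^ 2 ≤ 2 * ‖w‖ ^ 2 + 2 * (L * σ) ^ 2 := by
      have h8 : ‖w'‖ ^ 2 ≤ (‖w‖ + L * σ) ^ 2 := by gcongr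
      nlinarith [sq_nonneg (‖w‖ - L * σ)]
    have h9 : C * ‖w'‖ ^ 2 ≤ C * (2 * ‖w‖ ^ 2 + 2 * (L * σ) ^ 2) := by gcongr
    rw [h4]
    linarith
  have hint : ∫ r in s..x, 2 * inner ℝ (F r (y₁ (r - δ₁)) - F r (y₂ (r - δ₂))) (y₁ r - y₂ r) ≤
      ∫ r in s..x, ((2 * C * (L * σ) ^ 2 + 4 * L * (L * σ)) + 2 * C * ‖y₁ r - y₂ r‖ ^ 2) := by
    refine intervalIntegral.integral_mono_on hx.1 ?_
      (Continuous.intervalIntegrable (by fun_prop) _ _) hpt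
    refine (IntervalIntegrable.const_mul ?_ 2)
    rw [intervalIntegrable_iff_integrableOn_Icc_of_le hx.1]
    obtain ⟨M, hM⟩ := (isCompact_Icc (a := s) (b := x)).exists_bound_of_continuousOn
      hcw.continuousOn
    refine Measure.integrableOn_of_bounded (M := (L + L) * M) (by simp)
      ((hm₁.sub hm₂).inner hcw.stronglyMeasurable).aestronglyMeasurable ?_
    rw [ae_restrict_iff' measurableSet_Icc]
    refine Eventually.of_forall fun r hr => (norm_inner_le_norm _ _).trans ?_
    have h1 := hM r hr
    have h2 := (norm_sub_le _ _).trans (add_le_add (hb₁ r (hsub hr)) (hb₂ r (hsub hr)))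
    gcongr
  rw [intervalIntegral.integral_add (by simp) (Continuous.intervalIntegrable (by fun_prop) _ _),
    intervalIntegral.integral_const_mul, intervalIntegral.integral_const_mul,
    intervalIntegral.integral_const, smul_eq_mul] at hint
  have h10 : (x - s) * (2 * C * (L * σ) ^ 2 + 4 * L * (L * σ)) ≤
      (T - s) * (2 * C * (L * σ) ^ 2 + 4 * L * (L * σ)) := by
    have := hx.2
    gcongr
  linarith

/-- Uniform bounds for Tonelli's approximation with delay `1 / (m + 1)`. After `(m + 1) ^ 2`
iterations it solves the delayed equation up to time `s + (m + 1)`. -/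
lemma exists_norm_delay_bounds [CompleteSpace H] (hF : IsOneSidedLipschitz F C) (s T : ℝ)
    (x₀ : H) :
    ∃ L, 0 ≤ L ∧ ∀ m : ℕ, T ≤ s + (m + 1) → ∀ r ∈ Icc s T,
      ‖F r (delayIterate F s (1 / (m + 1)) x₀ ((m + 1) ^ 2) (r - 1 / (m + 1)))‖ ≤ L ∧
      ‖delayIterate F s (1 / (m + 1)) x₀ ((m + 1) ^ 2) r -
        delayIterate F s (1 / (m + 1)) x₀ ((m + 1) ^ 2) (r - 1 / (m + 1))‖ ≤ L * (1 / (m + 1)) ∧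
      delayIterate F s (1 / (m + 1)) x₀ ((m + 1) ^ 2) r = x₀ + ∫ ρ in s..r,
        F ρ (delayIterate F s (1 / (m + 1)) x₀ ((m + 1) ^ 2) (ρ - 1 / (m + 1))) := by
  obtain ⟨K, hK, hKF⟩ := hF.exists_norm_le s T
  refine ⟨K * ((1 + ‖x₀‖) * Real.exp (K * (T - s))), by positivity, fun m hm => ?_⟩
  set δ : ℝ := 1 / (m + 1) with hδ
  have hδ0 : 0 < δ := by positivity
  set y := delayIterate F s δ x₀ ((m + 1) ^ 2) with hy
  have hyc : Continuous y := continuous_delayIterate hF δ x₀ _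
  have hb : ∀ r ∈ Icc s T, ‖F r (y (r - δ))‖ ≤ K * ((1 + ‖x₀‖) * Real.exp (K * (T - s))) := by
    intro r hr
    refine (hKF r hr _).trans ?_
    gcongr
    refine (one_add_norm_delayIterate_le hδ0.le hK hKF x₀ _ (t := r - δ)
      (by linarith [hr.2])).trans ?_
    have : max s (r - δ) ≤ T := max_le (hr.1.trans hr.2) (by linarith [hr.2])
    gcongr
  have heq : ∀ r ∈ Icc s T, y r = x₀ + ∫ ρ in s..r, F ρ (y (ρ - δ)) := by
    intro r hr
    have h1 : r ≤ s + (((m + 1) ^ 2 : ℕ) : ℝ) * δ := by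
      refine hr.2.trans (hm.trans (le_of_eq ?_))
      rw [hδ]
      push_cast
      field_simp
    have h2 := delayIterate_succ_eq (F := F) x₀ _ h1
    rw [← hy] at h2
    rw [← h2, delayIterate, max_eq_right hr.1]
  refine fun r hr => ⟨hb r hr, ?_, heq r hr⟩
  have h1 : y (r - δ) = y (max s (r - δ)) := by
    rcases le_total s (r - δ) with h | h
    · rw [max_eq_right h]
    · rw [max_eq_left h, hy, delayIterate_of_le _ _ h, delayIterate_of_le _ _ le_rfl]
  have h2 : max s (r - δ) ≤ r := max_le hr.1 (by linarith)
  have hI : ∀ x, s ≤ x → IntervalIntegrable (fun ρ => F ρ (y (ρ - δ))) volume s x := fun x hx =>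
    (intervalIntegrable_iff_integrableOn_Icc_of_le hx).2
      (hF.integrableOn (hyc.comp (continuous_sub_right δ)) s x)
  rw [h1, heq r hr, heq _ ⟨le_max_left _ _, h2.trans hr.2⟩, add_sub_add_left_eq_sub,
    intervalIntegral.integral_interval_sub_left (hI _ hr.1) (hI _ (le_max_left _ _))]
  refine (intervalIntegral.norm_integral_le_of_norm_le_const fun ρ hρ => ?_).trans
    (mul_le_mul_of_nonneg_left ?_ (by positivity : (0 : ℝ) ≤ K * ((1 + ‖x₀‖) * _)))
  · rw [uIoc_of_le h2] at hρ
    exact hb ρ ⟨(le_max_left _ _).trans hρ.1.le, hρ.2.trans hr.2⟩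
  · rw [abs_of_nonneg (sub_nonneg.2 h2)]
    linarith [le_max_right s (r - δ)]

/-- Global solvability of one-sided Lipschitz equations: Tonelli's approximations form a Cauchy
sequence, so that neither compactness nor continuity in time is needed. -/
theorem IsOneSidedLipschitz.exists_solution [CompleteSpace H] (hF : IsOneSidedLipschitz F C)
    (s : ℝ) (x₀ : H) :
    ∃ x : ℝ → H, ContinuousOn x (Ici s) ∧ (∀ t, s ≤ t → x t = x₀ + ∫ r in s..t, F r (x r)) ∧
      ∀ t, s ≤ t → Tendsto (fun m : ℕ => delayIterate F s (1 / (m + 1)) x₀ ((m + 1) ^ 2) t)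
        atTop (𝓝 (x t)) := by
  set y : ℕ → ℝ → H := fun m => delayIterate F s (1 / (m + 1)) x₀ ((m + 1) ^ 2) with hy
  have hyc : ∀ m, Continuous (y m) := fun m => continuous_delayIterate hF _ x₀ _
  have hys : ∀ m, y m s = x₀ := fun m => delayIterate_of_le _ _ le_rfl
  have hCau : ∀ T, UniformCauchySeqOn y atTop (Icc s T) := by
    intro T
    rcases lt_or_ge T s with hTs | hsT
    · simp [hTs, UniformCauchySeqOn]
    obtain ⟨L, hL, hbd⟩ := exists_norm_delay_bounds hF s T x₀
    have hC := hF.C_nonneg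
    rw [Metric.uniformCauchySeqOn_iff]
    intro ε hε
    -- the bound for the distance of two approximations vanishes with the delays
    have hG : Tendsto (fun σ : ℝ => (T - s) * (2 * C * (L * σ) ^ 2 + 4 * L * (L * σ)) *
        Real.exp (2 * C * (T - s))) (𝓝 0) (𝓝 0) := by
      have : Continuous (fun σ : ℝ => (T - s) * (2 * C * (L * σ) ^ 2 + 4 * L * (L * σ)) *
        Real.exp (2 * C * (T - s))) := by fun_prop
      simpa using this.tendsto 0
    have hδ0 : Tendsto (fun m : ℕ => (2 : ℝ) * (1 / ((m : ℝ) + 1))) atTop (𝓝 0) := by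
      simpa using (tendsto_one_div_add_atTop_nhds_zero_nat (𝕜 := ℝ)).const_mul 2
    have h2 := (hG.comp hδ0).eventually (gt_mem_nhds (show 0 < ε ^ 2 by positivity))
    obtain ⟨N₀, hN₀⟩ := exists_nat_ge (T - s)
    obtain ⟨N, hN, hNN₀⟩ := (h2.and (eventually_ge_atTop N₀)).exists
    refine ⟨N, fun m hm n hn t ht => ?_⟩
    have hT : ∀ k : ℕ, N ≤ k → T ≤ s + (k + 1) := by
      intro k hk
      have h3 : (N₀ : ℝ) ≤ k := by exact_mod_cast hNN₀.trans hk
      linarith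
    have hδ : ∀ k : ℕ, N ≤ k → (1 : ℝ) / (k + 1) ≤ 1 / (N + 1) := by
      intro k hk
      have : (N : ℝ) ≤ k := by exact_mod_cast hk
      gcongr
    have h3 := hF.norm_sub_sq_le_of_delay (T := T) (σ := 2 * (1 / (N + 1)))
      (δ₁ := 1 / (m + 1)) (δ₂ := 1 / (n + 1)) (by positivity) hL (hyc m) (hyc n)
      ((hys m).trans (hys n).symm)
      (fun r hr => (hbd m (hT m hm) r hr).1) (fun r hr => (hbd n (hT n hn) r hr).1)
      (fun r hr => by
        have e1 := (hbd m (hT m hm) r hr).2.1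
        have e2 := (hbd n (hT n hn) r hr).2.1
        have e3 := mul_le_mul_of_nonneg_left (hδ m hm) hL
        have e4 := mul_le_mul_of_nonneg_left (hδ n hn) hL
        have e5 : (y m r - y n r) - (y m (r - 1 / (m + 1)) - y n (r - 1 / (n + 1))) =
            (y m r - y m (r - 1 / (m + 1))) - (y n r - y n (r - 1 / (n + 1))) := by abel
        rw [e5]
        refine (norm_sub_le _ _).trans ?_
        simp only [hy]
        linarith)
      (fun r hr => by rw [hys m]; exact (hbd m (hT m hm) r hr).2.2)
      (fun r hr => by rw [hys n]; exact (hbd n (hT n hn) r hr).2.2) ht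
    have h4 : (T - s) * (2 * C * (L * (2 * (1 / ((N : ℝ) + 1)))) ^ 2 +
        4 * L * (L * (2 * (1 / ((N : ℝ) + 1))))) * Real.exp (2 * C * (t - s)) ≤
        (T - s) * (2 * C * (L * (2 * (1 / ((N : ℝ) + 1)))) ^ 2 +
        4 * L * (L * (2 * (1 / ((N : ℝ) + 1))))) * Real.exp (2 * C * (T - s)) := by
      have := ht.2
      have h0 : 0 ≤ T - s := by linarith
      gcongr
    have h5 : ‖y m t - y n t‖ ^ 2 < ε ^ 2 := (h3.trans h4).trans_lt hN
    rw [dist_eq_norm]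
    exact lt_of_pow_lt_pow_left₀ 2 hε.le h5
  have hlim : ∀ t, ∃ l, s ≤ t → Tendsto (fun m => y m t) atTop (𝓝 l) := by
    intro t
    by_cases hst : s ≤ t
    · obtain ⟨l, hl⟩ := cauchySeq_tendsto_of_complete
        ((hCau t).cauchySeq (show t ∈ Icc s t from ⟨hst, le_rfl⟩))
      exact ⟨l, fun _ => hl⟩
    · exact ⟨0, fun h => absurd h hst⟩
  choose x hx using hlim
  have hunif : ∀ T, TendstoUniformlyOn y x atTop (Icc s T) := fun T =>
    (hCau T).tendstoUniformlyOn_of_tendsto fun t ht => hx t ht.1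
  have hxc : ∀ T, ContinuousOn x (Icc s T) := fun T =>
    (hunif T).continuousOn (Eventually.of_forall fun m => (hyc m).continuousOn).frequently
  refine ⟨x, fun t ht => ?_, fun t hst => ?_, hx⟩
  · refine (hxc (t + 1) t ⟨ht, by linarith⟩).mono_of_mem_nhdsWithin ?_
    rw [← Ici_inter_Iic]
    exact inter_mem_nhdsWithin _ (Iic_mem_nhds (by linarith))
  · obtain ⟨L, hL, hbd⟩ := exists_norm_delay_bounds hF s t x₀
    obtain ⟨N₀, hN₀⟩ := exists_nat_ge (t - s)
    have hT : ∀ᶠ m : ℕ in atTop, t ≤ s + (m + 1) := by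
      filter_upwards [eventually_ge_atTop N₀] with m hm
      have h3 : (N₀ : ℝ) ≤ m := by exact_mod_cast hm
      linarith
    have hδ0 := tendsto_one_div_add_atTop_nhds_zero_nat (𝕜 := ℝ)
    have hdel : ∀ r ∈ Icc s t, Tendsto (fun m : ℕ => y m (r - 1 / (m + 1))) atTop (𝓝 (x r)) := by
      intro r hr
      have h1 : Tendsto (fun m : ℕ => y m r - y m (r - 1 / (m + 1))) atTop (𝓝 0) := by
        refine squeeze_zero_norm' ?_ (a := fun m : ℕ => L * (1 / ((m : ℝ) + 1)))
          (by simpa using hδ0.const_mul L)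
        filter_upwards [hT] with m hm
        exact (hbd m hm r hr).2.1
      simpa using (hx r hr.1).sub h1
    -- a continuous extension of `x`, for measurability of the limiting integrand
    obtain ⟨x', hx'c, hx'⟩ : ∃ x' : ℝ → H, Continuous x' ∧ ∀ r ∈ Icc s t, x' r = x r :=
      ⟨IccExtend hst ((Icc s t).domRestrict x),
        (continuousOn_iff_continuous_domRestrict.1 (hxc t)).Icc_extend',
        fun r hr => IccExtend_of_mem hst _ hr⟩
    have hxi : IntervalIntegrable (fun r => F r (x r)) volume s t := by
      have h1 : IntervalIntegrable (fun r => F r (x' r)) volume s t :=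
        (intervalIntegrable_iff_integrableOn_Icc_of_le hst).2 (hF.integrableOn hx'c s t)
      refine h1.congr fun r hr => ?_
      rw [uIoc_of_le hst] at hr
      simp only [hx' r (Ioc_subset_Icc_self hr)]
    -- `F` is only demicontinuous, so the limit is taken after testing with `h`
    refine ext_inner_right ℝ fun h => ?_
    have hl1 : Tendsto (fun m => inner ℝ (y m t) h) atTop (𝓝 (inner ℝ (x t) h)) :=
      (hx t hst).inner tendsto_const_nhds
    have hint : ∀ {f : ℝ → H}, IntervalIntegrable f volume s t →
        inner ℝ (∫ r in s..t, f r) h = ∫ r in s..t, inner ℝ (f r) h := by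
      intro f hf
      have := (innerSL ℝ h).intervalIntegral_comp_comm hf
      simp only [innerSL_apply_apply] at this
      rw [real_inner_comm, ← this]
      exact intervalIntegral.integral_congr fun r _ => real_inner_comm _ _
    have hl2 : Tendsto (fun m : ℕ => inner ℝ x₀ h +
        ∫ r in s..t, inner ℝ (F r (y m (r - 1 / (m + 1)))) h) atTop
        (𝓝 (inner ℝ x₀ h + ∫ r in s..t, inner ℝ (F r (x r)) h)) := by
      refine Tendsto.const_add _ ?_
      refine intervalIntegral.tendsto_integral_filter_of_dominated_convergence
        (fun _ => L * ‖h‖) ?_ ?_ (by simp) ?_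
      · refine Eventually.of_forall fun m => ?_
        exact ((hF.stronglyMeasurable ((hyc m).comp (continuous_sub_right _))).inner
          stronglyMeasurable_const).aestronglyMeasurable
      · filter_upwards [hT] with m hm
        refine Eventually.of_forall fun r hr => ?_
        rw [uIoc_of_le hst] at hr
        refine (norm_inner_le_norm _ _).trans ?_
        gcongr
        exact (hbd m hm r (Ioc_subset_Icc_self hr)).1
      · refine Eventually.of_forall fun r hr => ?_
        rw [uIoc_of_le hst] at hr
        exact hF.tendsto r _ _ (hdel r (Ioc_subset_Icc_self hr)) h
    have hl3 : Tendsto (fun m => inner ℝ (y m t) h) atTop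
        (𝓝 (inner ℝ x₀ h + ∫ r in s..t, inner ℝ (F r (x r)) h)) := by
      refine hl2.congr' ?_
      filter_upwards [hT] with m hm
      rw [show y m t = _ from (hbd m hm t ⟨hst, le_rfl⟩).2.2, inner_add_left, hint]
      exact (intervalIntegrable_iff_integrableOn_Icc_of_le hst).2
        (hF.integrableOn ((hyc m).comp (continuous_sub_right _)) s t)
    rw [tendsto_nhds_unique hl1 hl3, inner_add_left, hint hxi]

end Delay

/-! ### Galerkin approximations -/

section Galerkin

variable {V : Type*} [NormedAddCommGroup V] [NormedSpace ℝ V]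
  {H : Type*} [NormedAddCommGroup H] [InnerProductSpace ℝ H] {ι : V →L[ℝ] H}

/-- A sequence of Galerkin approximations `X k = ι (U k)` to the solution of `Z' = B(t, Z)` with
`Z(s) = z`, relative to a sequence `d` of test vectors. -/
structure IsGalerkinApprox (ι : V →L[ℝ] H) (B : ℝ → V → StrongDual ℝ V) (s : ℝ) (z : H)
    (d : ℕ → V) (X : ℕ → ℝ → H) (U : ℕ → ℝ → V) : Prop where
  cont : ∀ k, ContinuousOn (U k) (Ici s)
  emb : ∀ k t, s ≤ t → ι (U k t) = X k t
  weak : ∀ i, ∀ᶠ k in atTop, ∀ r t, s ≤ r → r ≤ t →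
    inner ℝ (X k t - X k r) (ι (d i)) = ∫ ρ in r..t, B ρ (U k ρ) (d i)
  energy : ∀ k t, s ≤ t → ‖X k t‖ ^ 2 - ‖z‖ ^ 2 ≤ 2 * ∫ ρ in s..t, B ρ (U k ρ) (U k ρ)
  init : ∀ i, ∀ᶠ k in atTop, inner ℝ (X k s) (ι (d i)) = inner ℝ z (ι (d i))

lemma IsGalerkinApprox.memLp {B : ℝ → V → StrongDual ℝ V} {s : ℝ} {z : H} {d : ℕ → V}
    {X : ℕ → ℝ → H} {U : ℕ → ℝ → V} (h : IsGalerkinApprox ι B s z d X U) (k : ℕ) (T : ℝ)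
    {p : ℝ≥0∞} :
    MemLp (U k) p (volume.restrict (Icc s T)) := by
  have hfin : IsFiniteMeasure (volume.restrict (Icc s T)) := ⟨by simp⟩
  have hc := (h.cont k).mono (Icc_subset_Ici_self : Icc s T ⊆ Ici s)
  obtain ⟨M, hM⟩ := (isCompact_Icc (a := s) (b := T)).exists_bound_of_continuousOn hc
  refine MemLp.of_bound (hc.aestronglyMeasurable measurableSet_Icc) M ?_
  rw [ae_restrict_iff' measurableSet_Icc]
  exact Eventually.of_forall hM

lemma IsGalerkinApprox.comp {B : ℝ → V → StrongDual ℝ V} {s : ℝ} {z : H} {d : ℕ → V}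
    {X : ℕ → ℝ → H} {U : ℕ → ℝ → V} (h : IsGalerkinApprox ι B s z d X U) {φ : ℕ → ℕ}
    (hφ : StrictMono φ) : IsGalerkinApprox ι B s z d (fun k => X (φ k)) (fun k => U (φ k)) where
  cont _ := h.cont _
  emb _ := h.emb _
  weak i := hφ.tendsto_atTop.eventually (h.weak i)
  energy _ := h.energy _
  init i := hφ.tendsto_atTop.eventually (h.init i)

section VectorField

variable [CompleteSpace H]

/-- The Galerkin vector field on `H`: the Riesz representative of `h ↦ ⟨B(t, J x), J h⟩`. -/
noncomputable def galerkinField (J : H →L[ℝ] V) (B : ℝ → V → StrongDual ℝ V) (t : ℝ) (x : H) : H :=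
  (InnerProductSpace.toDual ℝ H).symm ((B t (J x)).comp J)

@[simp]
lemma inner_galerkinField (J : H →L[ℝ] V) (B : ℝ → V → StrongDual ℝ V) (t : ℝ) (x h : H) :
    inner ℝ (galerkinField J B t x) h = B t (J x) (J h) := by
  simp [galerkinField]

variable [MeasurableSpace V] [BorelSpace V]
  {α : ℝ} {B : ℝ → V → StrongDual ℝ V} {C c : ℝ} {g : ℝ → ℝ}

/-- The growth exponent `α - 1` of the drift is less than `1`, so that the Galerkin vector field
grows at most linearly. -/
lemma isOneSidedLipschitz_galerkinField [MeasurableSpace H] [BorelSpace H]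
    [SecondCountableTopology H] (hB : IsMonotoneDrift ι α B C c g) (hα : 1 < α) (hα2 : α < 2)
    {J : H →L[ℝ] V} (hJ : IsGalerkinOp ι J) : IsOneSidedLipschitz (galerkinField J B) C where
  measurable := by
    have h1 : Measurable (fun p : ℝ × H => B p.1 (J p.2)) :=
      hB.measurable.comp (measurable_fst.prodMk (J.continuous.measurable.comp measurable_snd))
    have h2 : Continuous (fun φ : StrongDual ℝ V =>
        (InnerProductSpace.toDual ℝ H).symm (φ.comp J)) :=
      (InnerProductSpace.toDual ℝ H).symm.continuous.comp (by fun_prop)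
    exact h2.measurable.comp h1
  C_nonneg := hB.C_nonneg
  exists_norm_le a T := by
    obtain ⟨K, hK, h⟩ := hB.exists_norm_le_linear hα hα2 a T
    refine ⟨K * ((1 + ‖J‖) * ‖J‖), by positivity, fun t ht x => ?_⟩
    rw [galerkinField, LinearIsometryEquiv.norm_map]
    calc ‖(B t (J x)).comp J‖ ≤ ‖B t (J x)‖ * ‖J‖ := ContinuousLinearMap.opNorm_comp_le _ _
      _ ≤ (K * (1 + ‖J‖ * ‖x‖)) * ‖J‖ := by
          gcongr
          refine (h t ht _).trans ?_
          gcongr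
          exact J.le_opNorm x
      _ ≤ (K * ((1 + ‖J‖) * (1 + ‖x‖))) * ‖J‖ := by
          gcongr
          nlinarith [norm_nonneg J, norm_nonneg x]
      _ = _ := by ring
  inner_le t x y := by
    rw [inner_sub_left, inner_galerkinField, inner_galerkinField, map_sub J]
    have h1 := hB.monotonicity t (J x) (J y)
    rw [sub_apply] at h1
    refine h1.trans ?_
    have h2 := hJ.norm_le (x - y)
    rw [map_sub] at h2
    have := hB.C_nonneg
    gcongr
  tendsto t x y hxy h := by
    simp only [inner_galerkinField]
    exact hB.tendsto_apply hα t ((J.continuous.tendsto y).comp hxy) (J h)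

/-- The solution of the Galerkin equation stays in the range of the Galerkin projection, and
satisfies the weak equation and the energy equality. -/
lemma galerkin_solution_properties [MeasurableSpace H] [BorelSpace H]
    [SecondCountableTopology H] (hB : IsMonotoneDrift ι α B C c g) (hα : 1 < α) (hα2 : α < 2)
    {J : H →L[ℝ] V} (hJ : IsGalerkinOp ι J) {s : ℝ} {z : H} {x : ℝ → H}
    (hxc : ContinuousOn x (Ici s))
    (hx : ∀ t, s ≤ t → x t = ι (J z) + ∫ r in s..t, galerkinField J B r (x r)) :
    (∀ t, s ≤ t → ι (J (x t)) = x t) ∧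
    (∀ h r t, s ≤ r → r ≤ t →
      inner ℝ (x t - x r) h = ∫ ρ in r..t, B ρ (J (x ρ)) (J h)) ∧
    ∀ t, s ≤ t → ‖x t‖ ^ 2 - ‖z‖ ^ 2 ≤ 2 * ∫ ρ in s..t, B ρ (J (x ρ)) (J (x ρ)) := by
  have hF := isOneSidedLipschitz_galerkinField hB hα hα2 hJ
  have hxs : x s = ι (J z) := by simpa using hx s le_rfl
  -- a continuous extension of `x` beyond `s`
  have hx'c : Continuous fun t => x (max s t) :=
    hxc.comp_continuous (by fun_prop) fun t => le_max_left s t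
  have hint : ∀ T, IntegrableOn (fun r => galerkinField J B r (x r)) (Icc s T) volume := fun T =>
    (hF.integrableOn hx'c s T).congr_fun (fun r hr => by simp only [max_eq_right hr.1])
      measurableSet_Icc
  have hI : ∀ r t, s ≤ r → r ≤ t →
      IntervalIntegrable (fun r => galerkinField J B r (x r)) volume r t := fun r t hr ht =>
    (intervalIntegrable_iff_integrableOn_Icc_of_le ht).2
      ((hint t).mono_set (Icc_subset_Icc_left hr))
  have hw : ∀ h r t, s ≤ r → r ≤ t →
      inner ℝ (x t - x r) h = ∫ ρ in r..t, B ρ (J (x ρ)) (J h) := by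
    intro h r t hr ht
    have e : x t - x r = ∫ ρ in r..t, galerkinField J B ρ (x ρ) := by
      rw [hx t (hr.trans ht), hx r hr, add_sub_add_left_eq_sub,
        intervalIntegral.integral_interval_sub_left (hI s t le_rfl (hr.trans ht))
          (hI s r le_rfl hr)]
    rw [e, real_inner_comm]
    have := (innerSL ℝ h).intervalIntegral_comp_comm (hI r t hr ht)
    simp only [innerSL_apply_apply] at this
    rw [← this]
    refine intervalIntegral.integral_congr fun ρ _ => ?_
    rw [real_inner_comm, inner_galerkinField]
  refine ⟨fun t ht => ?_, hw, fun t ht => ?_⟩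
  -- as `ι J` is a symmetric projection, `x t` and `ι (J (x t))` have the same inner products
  · refine ext_inner_right ℝ fun h => ?_
    have h1 := hw h s t le_rfl ht
    have h2 := hw (ι (J h)) s t le_rfl ht
    rw [hJ.idem, ← h1, hxs, inner_sub_left, inner_sub_left, ← hJ.symm (J := J) (ι (J z)),
      hJ.idem] at h2
    rw [hJ.symm]
    linarith
  · obtain ⟨K, hK, hKF⟩ := hF.exists_norm_le s t
    obtain ⟨M, hM⟩ := (isCompact_Icc (a := s) (b := t)).exists_bound_of_continuousOn
      (hxc.mono Icc_subset_Ici_self)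
    have hE := norm_sq_sub_norm_sq_eq_integral ht (hxc.mono Icc_subset_Ici_self)
      (hint t).aestronglyMeasurable (L := K * (1 + M)) (fun r hr => (hKF r hr _).trans (by
        have := hM r hr
        gcongr)) (fun r hr => by rw [hxs]; exact hx r hr.1)
    simp only [inner_galerkinField] at hE
    rw [hxs] at hE
    have h3 : ‖ι (J z)‖ ^ 2 ≤ ‖z‖ ^ 2 := by
      have := hJ.norm_le z
      gcongr
    linarith

end VectorField

variable [MeasurableSpace V] [BorelSpace V] [SecondCountableTopology (StrongDual ℝ V)]
  {α : ℝ} {B : ℝ → V → StrongDual ℝ V} {C c : ℝ} {g : ℝ → ℝ} {s : ℝ} {z : H} {d : ℕ → V}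
  {X : ℕ → ℝ → H} {U : ℕ → ℝ → V}

/-- The a priori bounds for Galerkin approximations on a bounded interval. -/
lemma IsGalerkinApprox.exists_bounds (hB : IsMonotoneDrift ι α B C c g) (hα : 1 < α)
    (h : IsGalerkinApprox ι B s z d X U) (T : ℝ) :
    ∃ R, 0 ≤ R ∧ ∀ k, (∀ t ∈ Icc s T, ‖X k t‖ ≤ R) ∧
      (eLpNorm (U k) (ENNReal.ofReal α) (volume.restrict (Icc s T))).toReal ≤ R ∧
      MemLp (fun r => B r (U k r)) (ENNReal.ofReal (α / (α - 1))) (volume.restrict (Icc s T)) ∧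
      (eLpNorm (fun r => B r (U k r)) (ENNReal.ofReal (α / (α - 1)))
        (volume.restrict (Icc s T))).toReal ≤ R := by
  have := holderConjugate_ofReal hα
  have hfin : IsFiniteMeasure (volume.restrict (Icc s T)) := ⟨by simp⟩
  have hα0 : 0 < α := by linarith
  have hα1 : 0 < α - 1 := by linarith
  have hq0 : 0 < α / (α - 1) := by positivity
  rcases lt_or_ge T s with hTs | hsT
  · refine ⟨0, le_rfl, fun k => ?_⟩
    simp [hTs]
  obtain ⟨K, hK, hg⟩ := hB.exists_bound s T
  have hc := hB.c_pos
  have hC := hB.C_nonneg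
  set M := ‖z‖ ^ 2 + K * (T - s) with hM
  have hM0 : 0 ≤ M := by have := sub_nonneg.2 hsT; positivity
  have hmem := fun k => h.memLp k T (p := ENNReal.ofReal α)
  have hBm := fun k => hB.memLp hα (hmem k)
  have hpow : ∀ k, Integrable (fun r => ‖U k r‖ ^ α) (volume.restrict (Icc s T)) := fun k => by
    have := (hmem k).integrable_norm_rpow (by simp [hα0]) (by simp)
    rwa [ENNReal.toReal_ofReal hα0.le] at this
  -- coercivity in the energy inequality
  have hen : ∀ k, ∀ t ∈ Icc s T, ‖X k t‖ ^ 2 + c * ∫ r in s..t, ‖U k r‖ ^ α ≤ M := by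
    intro k t ht
    have hle : volume.restrict (Icc s t) ≤ volume.restrict (Icc s T) :=
      Measure.restrict_mono (Icc_subset_Icc_right ht.2) le_rfl
    have h1 := h.energy k t ht.1
    have hi1 : IntervalIntegrable (fun r => ‖U k r‖ ^ α) volume s t :=
      (intervalIntegrable_iff_integrableOn_Icc_of_le ht.1).2 ((hpow k).mono_measure hle)
    have hi2 : IntervalIntegrable (fun r => B r (U k r) (U k r)) volume s t :=
      (intervalIntegrable_iff_integrableOn_Icc_of_le ht.1).2
        (((hBm k).dual_apply (hmem k)).mono_measure hle)
    have h2 : ∫ r in s..t, 2 * B r (U k r) (U k r) ≤ ∫ r in s..t, (-c * ‖U k r‖ ^ α + K) := by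
      refine intervalIntegral.integral_mono_on ht.1 (hi2.const_mul 2)
        ((hi1.const_mul (-c)).add (by simp)) fun r hr => ?_
      have h3 := hB.coercivity r (U k r)
      have h4 := hg r ⟨hr.1, hr.2.trans ht.2⟩
      linarith
    rw [intervalIntegral.integral_const_mul, intervalIntegral.integral_add (hi1.const_mul (-c))
      (by simp), intervalIntegral.integral_const_mul, intervalIntegral.integral_const,
      smul_eq_mul] at h2
    have h5 : (t - s) * K ≤ K * (T - s) := by
      rw [mul_comm]
      have := ht.2
      gcongr
    linarith
  have hUint : ∀ k, ∫ r in Icc s T, ‖U k r‖ ^ α ≤ M / c := by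
    intro k
    have h1 := hen k T ⟨hsT, le_rfl⟩
    rw [intervalIntegral.integral_of_le hsT, ← integral_Icc_eq_integral_Ioc] at h1
    rw [le_div_iff₀ hc]
    nlinarith [sq_nonneg ‖X k T‖]
  have hBint : ∀ k, ∫ r in Icc s T, ‖B r (U k r)‖ ^ (α / (α - 1)) ≤
      C * (M / c) + K * (T - s) := by
    intro k
    have h1 : ∫ r in Icc s T, ‖B r (U k r)‖ ^ (α / (α - 1)) ≤
        ∫ r in Icc s T, (C * ‖U k r‖ ^ α + K) := by
      have hi := (hBm k).integrable_norm_rpow (by simpa using hq0) (by simp)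
      rw [ENNReal.toReal_ofReal hq0.le] at hi
      refine setIntegral_mono_on hi (((hpow k).const_mul C).add (integrable_const K))
        measurableSet_Icc fun r hr => ?_
      have h3 := hB.growth r (U k r)
      have h4 := hg r hr
      linarith
    rw [integral_add ((hpow k).const_mul C) (integrable_const K), integral_const_mul] at h1
    have h2 : ∫ _ in Icc s T, K = K * (T - s) := by
      simp [hsT, mul_comm]
    rw [h2] at h1
    have := hUint k
    have h3 : C * ∫ r in Icc s T, ‖U k r‖ ^ α ≤ C * (M / c) := by gcongr
    linarith
  refine ⟨Real.sqrt M + (M / c) ^ α⁻¹ + (C * (M / c) + K * (T - s)) ^ (α / (α - 1))⁻¹, ?_,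
    fun k => ⟨fun t ht => ?_, ?_, hBm k, ?_⟩⟩
  · have := sub_nonneg.2 hsT
    positivity
  all_goals
    have h0 := sub_nonneg.2 hsT
    have e1 : 0 ≤ Real.sqrt M := by positivity
    have e2 : 0 ≤ (M / c) ^ α⁻¹ := by positivity
    have e3 : 0 ≤ (C * (M / c) + K * (T - s)) ^ (α / (α - 1))⁻¹ := by positivity
  · have h1 := hen k t ht
    have h2 : 0 ≤ ∫ r in s..t, ‖U k r‖ ^ α :=
      intervalIntegral.integral_nonneg ht.1 fun r _ => by positivity
    have h3 : ‖X k t‖ ≤ Real.sqrt M := Real.le_sqrt_of_sq_le (by nlinarith)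
    linarith
  · rw [(hmem k).eLpNorm_eq_integral_rpow_norm (by simp [hα0]) (by simp),
      ENNReal.toReal_ofReal hα0.le, ENNReal.toReal_ofReal (by positivity)]
    have h1 : (∫ r in Icc s T, ‖U k r‖ ^ α) ^ α⁻¹ ≤ (M / c) ^ α⁻¹ := by
      gcongr
      exact hUint k
    linarith
  · rw [(hBm k).eLpNorm_eq_integral_rpow_norm (by simpa using hq0) (by simp),
      ENNReal.toReal_ofReal hq0.le, ENNReal.toReal_ofReal (by positivity)]
    have h1 : (∫ r in Icc s T, ‖B r (U k r)‖ ^ (α / (α - 1))) ^ (α / (α - 1))⁻¹ ≤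
        (C * (M / c) + K * (T - s)) ^ (α / (α - 1))⁻¹ := by
      gcongr
      exact hBint k
    linarith

end Galerkin

/-! ### Weak convergence in the Hilbert space -/

section Weak

variable {H : Type*} [NormedAddCommGroup H] [InnerProductSpace ℝ H]

lemma norm_le_of_tendsto_inner {ι' : Type*} {l : Filter ι'} [l.NeBot] {x : ι' → H} {z : H} {R : ℝ}
    (h : Tendsto (fun k => inner ℝ (x k) z) l (𝓝 (inner ℝ z z))) (hR : ∀ᶠ k in l, ‖x k‖ ≤ R) :
    ‖z‖ ≤ R := by
  have h1 : inner ℝ z z ≤ R * ‖z‖ := le_of_tendsto h (by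
    filter_upwards [hR] with k hk
    exact (real_inner_le_norm _ _).trans (by gcongr))
  rw [real_inner_self_eq_norm_sq] at h1
  rcases (norm_nonneg z).eq_or_lt with h0 | h0
  · obtain ⟨k, hk⟩ := hR.exists
    rw [← h0]
    exact (norm_nonneg _).trans hk
  · nlinarith

/-- Weak lower semicontinuity of the squared norm. -/
lemma eventually_norm_sq_le_of_tendsto_inner {ι' : Type*} {l : Filter ι'} {x : ι' → H} {z : H}
    (h : Tendsto (fun k => inner ℝ (x k) z) l (𝓝 (inner ℝ z z))) {ε : ℝ} (hε : 0 < ε) :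
    ∀ᶠ k in l, ‖z‖ ^ 2 ≤ ‖x k‖ ^ 2 + ε := by
  rw [real_inner_self_eq_norm_sq] at h
  filter_upwards [h.eventually (lt_mem_nhds (show ‖z‖ ^ 2 - ε / 2 < ‖z‖ ^ 2 by linarith))]
    with k hk
  have := real_inner_le_norm (x k) z
  nlinarith [sq_nonneg (‖x k‖ - ‖z‖)]

/-- Boundedness reduces weak convergence to a dense set of test vectors. -/
lemma tendsto_apply_of_dense {E : Type*} [NormedAddCommGroup E] [NormedSpace ℝ E]
    {ι' : Type*} {l : Filter ι'} {φ : ι' → StrongDual ℝ E} {ψ : StrongDual ℝ E} {R : ℝ}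
    (hR : ∀ᶠ k in l, ‖φ k‖ ≤ R) {D : Set E} (hD : Dense D)
    (h : ∀ e ∈ D, Tendsto (fun k => φ k e) l (𝓝 (ψ e))) (x : E) :
    Tendsto (fun k => φ k x) l (𝓝 (ψ x)) := by
  refine Metric.tendsto_nhds.2 fun ε hε => ?_
  set K := |R| + ‖ψ‖ + 1 with hK
  have hK0 : 0 < K := by positivity
  obtain ⟨e, he, hxe⟩ := hD.exists_dist_lt x (show 0 < ε / (2 * K) by positivity)
  filter_upwards [hR, Metric.tendsto_nhds.1 (h e he) (ε / 2) (by positivity)] with k h1 h2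
  rw [Real.dist_eq] at h2 ⊢
  have e1 : φ k x - ψ x = (φ k - ψ) (x - e) + (φ k e - ψ e) := by
    simp only [sub_apply, map_sub]
    ring
  have h3 : ‖(φ k - ψ) (x - e)‖ ≤ K * (ε / (2 * K)) := by
    refine ((φ k - ψ).le_opNorm _).trans ?_
    rw [dist_eq_norm] at hxe
    have : ‖φ k - ψ‖ ≤ K := (norm_sub_le _ _).trans (by linarith [le_abs_self R])
    gcongr
  have h4 : K * (ε / (2 * K)) = ε / 2 := by field_simp
  rw [h4, Real.norm_eq_abs] at h3
  rw [e1]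
  exact (abs_add_le _ _).trans_lt (by linarith)

/-- A version of the Arzelà–Ascoli theorem for the weak topology of a Hilbert space: a sequence of
functions that is pointwise bounded, and equicontinuous when tested against a dense sequence, has a
subsequence that converges weakly at every time. -/
lemma exists_subseq_tendsto_inner [CompleteSpace H] {e : ℕ → H} (he : DenseRange e)
    {X : ℕ → ℝ → H} {s : ℝ} (hb : ∀ t, s ≤ t → ∃ R, ∀ k, ‖X k t‖ ≤ R)
    (heq : ∀ i t, s ≤ t → ∀ ε > 0, ∃ δ > 0, ∀ᶠ k in atTop, ∀ r, t ≤ r → r < t + δ →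
      |inner ℝ (X k r - X k t) (e i)| ≤ ε) :
    ∃ ψ : ℕ → ℕ, StrictMono ψ ∧ ∃ Z : ℝ → H, ∀ t, s ≤ t → ∀ h,
      Tendsto (fun k => inner ℝ (X (ψ k) t) h) atTop (𝓝 (inner ℝ (Z t) h)) := by
  choose! R hR using hb
  -- a subsequence converges at rational times when tested against the dense sequence
  let f : ℕ → ℚ × ℕ → ℝ := fun k p => inner ℝ (X k (max s p.1)) (e p.2)
  let L : ℚ × ℕ → ℝ := fun p => R (max s p.1) * ‖e p.2‖
  have hf : ∀ k, f k ∈ Set.pi univ fun p => Icc (-L p) (L p) := by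
    intro k p _
    refine abs_le.1 ((abs_real_inner_le_norm _ _).trans ?_)
    exact mul_le_mul_of_nonneg_right (hR (max s p.1) (le_max_left _ _) k) (norm_nonneg _)
  obtain ⟨a, -, ψ, hψ, hlim⟩ := (isCompact_univ_pi fun p => isCompact_Icc).tendsto_subseq hf
  rw [tendsto_pi_nhds] at hlim
  refine ⟨ψ, hψ, ?_⟩
  -- any other time is compared with a rational time just after it, by equicontinuity
  have hcau : ∀ t, s ≤ t → ∀ h, ∃ ℓ, Tendsto (fun k => inner ℝ (X (ψ k) t) h) atTop (𝓝 ℓ) := by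
    intro t ht h
    refine cauchySeq_tendsto_of_complete (Metric.cauchySeq_iff'.2 fun ε hε => ?_)
    set K := |R t| + 1 with hK
    have hK0 : 0 < K := by positivity
    obtain ⟨i, hi⟩ := he.exists_dist_lt h (show 0 < ε / (8 * K) by positivity)
    rw [dist_eq_norm] at hi
    obtain ⟨δ, hδ, hev⟩ := heq i t ht (ε / 8) (by positivity)
    obtain ⟨q, hq1, hq2⟩ := exists_rat_btwn (show t < t + δ by linarith)
    have hmax : max s (q : ℝ) = q := max_eq_right (ht.trans hq1.le)
    have hc := Metric.cauchySeq_iff'.1 (hlim (q, i)).cauchySeq (ε / 8) (by positivity)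
    obtain ⟨n₁, hn₁⟩ := hc
    obtain ⟨n₂, hn₂⟩ := eventually_atTop.1 (hψ.tendsto_atTop.eventually hev)
    have hclose : ∀ n ≥ max n₁ n₂,
        |inner ℝ (X (ψ n) t) h - f (ψ n₁) (q, i)| < 3 * ε / 8 := by
      intro n hn
      have h1 := hn₁ n (le_of_max_le_left hn)
      have h2 := hn₂ n (le_of_max_le_right hn) q hq1.le hq2
      rw [Real.dist_eq] at h1
      simp only [f, Function.comp_apply, hmax, inner_sub_left] at h1 h2 ⊢
      have h3 : |inner ℝ (X (ψ n) t) (h - e i)| ≤ ε / 8 := by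
        refine (abs_real_inner_le_norm _ _).trans ?_
        calc ‖X (ψ n) t‖ * ‖h - e i‖ ≤ K * (ε / (8 * K)) := by
              have := hR t ht (ψ n)
              gcongr
              linarith [le_abs_self (R t)]
          _ = ε / 8 := by field_simp
      rw [inner_sub_right] at h3
      rw [abs_lt] at h1 ⊢
      rw [abs_le] at h2 h3
      constructor <;> linarith
    refine ⟨max n₁ n₂, fun n hn => ?_⟩
    have h1 := hclose n hn
    have h2 := hclose _ le_rfl
    rw [Real.dist_eq]
    rw [abs_lt] at h1 h2 ⊢
    constructor <;> linarith
  choose! ℓ hℓ using hcau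
  have hZ : ∀ t, s ≤ t → ∃ z : H, ∀ h,
      Tendsto (fun k => inner ℝ (X (ψ k) t) h) atTop (𝓝 (inner ℝ z h)) := by
    intro t ht
    let Φ : H →L[ℝ] ℝ := continuousLinearMapOfTendsto (fun k => innerSL ℝ (X (ψ k) t))
      (f := ℓ t) (tendsto_pi_nhds.2 fun h => hℓ t ht h)
    refine ⟨(InnerProductSpace.toDual ℝ H).symm Φ, fun h => ?_⟩
    rw [InnerProductSpace.toDual_symm_apply]
    exact hℓ t ht h
  choose! Z hZ using hZ
  exact ⟨Z, hZ⟩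

/-- Weak measurability implies measurability. -/
lemma measurable_of_measurable_inner [CompleteSpace H] [MeasurableSpace H] [BorelSpace H]
    [SecondCountableTopology H] {Y : Type*} [MeasurableSpace Y] {F : Y → H} {e : ℕ → H}
    (he : DenseRange e) (hF : ∀ i, Measurable fun y => inner ℝ (F y) (e i)) : Measurable F := by
  let Φ : H → ℕ → ℝ := fun x i => inner ℝ x (e i)
  have hΦ : Continuous Φ := by fun_prop
  -- an injective continuous map between Polish spaces is a measurable embedding
  have hinj : Function.Injective Φ := fun x y hxy =>
    he.eq_of_inner_left (𝕜 := ℝ) (fun i => congrFun hxy i)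
  exact (hΦ.measurableEmbedding hinj).measurable_comp_iff.1 (measurable_pi_iff.2 hF)

end Weak

/-! ### Passage to the limit in integrals -/

lemma le_min_add_mul_rpow {x N p : ℝ} (hx : 0 ≤ x) (hN : 0 < N) (hp : 1 ≤ p) :
    x ≤ min x N + N ^ (1 - p) * x ^ p := by
  rcases le_total x N with h | h
  · rw [min_eq_left h]
    have : 0 ≤ N ^ (1 - p) * x ^ p := by positivity
    linarith
  · have hx0 : 0 < x := hN.trans_le h
    have h1 : x ≤ N ^ (1 - p) * x ^ p := by
      have e : x = x ^ (1 - p) * x ^ p := by rw [← Real.rpow_add hx0]; simp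
      calc x = x ^ (1 - p) * x ^ p := e
        _ ≤ _ := by
          gcongr ?_ * _
          exact Real.rpow_le_rpow_of_nonpos hN h (by linarith)
    have : 0 ≤ min x N := le_min hx hN.le
    linarith

/-- Functions bounded in `L^p`, `p > 1`, that converge almost everywhere converge in `L¹`. -/
lemma tendsto_integral_abs_of_rpow_bound {Y : Type*} [MeasurableSpace Y] {μ : Measure Y}
    [IsFiniteMeasure μ] {p : ℝ} (hp : 1 < p) {F : ℕ → Y → ℝ}
    (hF : ∀ k, AEStronglyMeasurable (F k) μ)
    (hFi : ∀ k, Integrable (fun y => |F k y| ^ p) μ) {R : ℝ} (hR : ∀ k, ∫ y, |F k y| ^ p ∂μ ≤ R)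
    (hlim : ∀ᵐ y ∂μ, Tendsto (fun k => F k y) atTop (𝓝 0)) :
    Tendsto (fun k => ∫ y, |F k y| ∂μ) atTop (𝓝 0) := by
  have hR0 : 0 ≤ R := (integral_nonneg fun y => by positivity).trans (hR 0)
  refine Metric.tendsto_nhds.2 fun ε hε => ?_
  -- a truncation level beyond which the `L^p` bound makes the tails small
  obtain ⟨N, hN, hNε⟩ : ∃ N : ℝ, 0 < N ∧ N ^ (1 - p) * R < ε / 2 := by
    have h1 : Tendsto (fun N : ℝ => N ^ (-(p - 1)) * R) atTop (𝓝 (0 * R)) :=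
      (tendsto_rpow_neg_atTop (by linarith)).mul_const R
    rw [zero_mul] at h1
    obtain ⟨N, h2, h3⟩ := ((h1.eventually (gt_mem_nhds (half_pos hε))).and
      (eventually_gt_atTop 0)).exists
    exact ⟨N, h3, by rwa [neg_sub] at h2⟩
  have hmin : Tendsto (fun k => ∫ y, min |F k y| N ∂μ) atTop (𝓝 (∫ _, (0 : ℝ) ∂μ)) := by
    refine tendsto_integral_of_dominated_convergence (fun _ => N) (fun k => ?_)
      (integrable_const N) (fun k => Eventually.of_forall fun y => ?_) ?_
    · exact (hF k).norm.inf aestronglyMeasurable_const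
    · rw [Real.norm_of_nonneg (le_min (abs_nonneg _) hN.le)]
      exact min_le_right _ _
    · filter_upwards [hlim] with y hy
      have := hy.abs.min (tendsto_const_nhds (x := N))
      simpa [hN.le] using this
  rw [integral_zero] at hmin
  filter_upwards [hmin.eventually (gt_mem_nhds (half_pos hε))] with k hk
  have hmi : Integrable (fun y => min |F k y| N) μ :=
    Integrable.mono' (integrable_const N) ((hF k).norm.inf aestronglyMeasurable_const)
      (Eventually.of_forall fun y => by
        rw [Real.norm_of_nonneg (le_min (abs_nonneg _) hN.le)]
        exact min_le_right _ _)
  have hle : ∫ y, |F k y| ∂μ ≤ ∫ y, (min |F k y| N + N ^ (1 - p) * |F k y| ^ p) ∂μ :=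
    integral_mono_of_nonneg (Eventually.of_forall fun y => abs_nonneg _)
      (hmi.add ((hFi k).const_mul _))
      (Eventually.of_forall fun y => le_min_add_mul_rpow (abs_nonneg _) hN hp.le)
  rw [integral_add hmi ((hFi k).const_mul _), integral_const_mul] at hle
  have h3 : N ^ (1 - p) * ∫ y, |F k y| ^ p ∂μ ≤ N ^ (1 - p) * R := by
    gcongr
    exact hR k
  rw [Real.dist_eq, sub_zero, abs_of_nonneg (integral_nonneg fun y => abs_nonneg _)]
  linarith

section Limit

variable {V : Type*} [NormedAddCommGroup V] [NormedSpace ℝ V]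
  {H : Type*} [NormedAddCommGroup H] [InnerProductSpace ℝ H] {ι : V →L[ℝ] H}

/-- By reflexivity, a weak limit in `H` of elements of `V` with finite lower limit of norms belongs
to `V`, and the norm of `V` is lower semicontinuous. -/
lemma IsGelfandTriple.exists_preimage_of_tendsto_inner (hι : IsGelfandTriple ι) {v : ℕ → V} {z : H}
    (hv : ∀ h, Tendsto (fun k => inner ℝ (ι (v k)) h) atTop (𝓝 (inner ℝ z h)))
    (hfin : liminf (fun k => ‖v k‖ₑ) atTop ≠ ∞) :
    ∃ w, ι w = z ∧ ‖w‖ₑ ≤ liminf (fun k => ‖v k‖ₑ) atTop := by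
  have key : ∀ R : NNReal, liminf (fun k => ‖v k‖ₑ) atTop < R → ∃ w, ι w = z ∧ ‖w‖ ≤ R := by
    intro R hR
    have hfr := frequently_lt_of_liminf_lt (by isBoundedDefault) hR
    refine hι.exists_preimage R.coe_nonneg fun h => ?_
    refine le_of_tendsto_of_frequently (hv h).abs (hfr.mono fun k hk => ?_) |> (fun H' => by
      rwa [real_inner_comm])
    have h1 : ‖v k‖ ≤ R := by
      have : ‖v k‖₊ < R := by exact_mod_cast hk
      exact_mod_cast this.le
    rw [real_inner_comm, ← toDualV_apply, mul_comm]
    exact ((toDualV ι h).le_opNorm _).trans (by gcongr)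
  obtain ⟨R, hR⟩ := ENNReal.lt_iff_exists_nnreal_btwn.1 (lt_top_iff_ne_top.2 hfin)
  obtain ⟨w, hw, -⟩ := key R hR.1
  refine ⟨w, hw, le_of_forall_gt_imp_ge_of_dense fun a ha => ?_⟩
  rcases eq_or_ne a ∞ with rfl | htop
  · exact le_top
  · lift a to NNReal using htop
    obtain ⟨w', hw', hn⟩ := key a ha
    rw [hι.injective (hw.trans hw'.symm)]
    exact_mod_cast hn

variable {Y : Type*} [MeasurableSpace Y] {μ : Measure Y}

/-- A Fatou lemma for weak limits: weak limits of functions bounded in `L^α(V)` belong to `L^α(V)`.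
Here `W` is a left inverse of the embedding. -/
lemma IsGelfandTriple.memLp_of_tendsto_inner (hι : IsGelfandTriple ι) [MeasurableSpace V]
    [BorelSpace V] [SecondCountableTopology V]
    {α : ℝ} (hα : 0 < α) {U : ℕ → Y → V} {R : ℝ}
    (hUm : ∀ k, MemLp (U k) (ENNReal.ofReal α) μ)
    (hR : ∀ k, (eLpNorm (U k) (ENNReal.ofReal α) μ).toReal ≤ R) {Z : Y → H}
    (hZ : ∀ᵐ y ∂μ, ∀ h, Tendsto (fun k => inner ℝ (ι (U k y)) h) atTop (𝓝 (inner ℝ (Z y) h)))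
    {W : H → V} (hW : ∀ v, W (ι v) = v) (hWm : AEStronglyMeasurable (fun y => W (Z y)) μ) :
    MemLp (fun y => W (Z y)) (ENNReal.ofReal α) μ ∧ ∀ᵐ y ∂μ, ι (W (Z y)) = Z y := by
  have hα0 : ENNReal.ofReal α ≠ 0 := by simpa using hα
  have hint : ∫⁻ y, liminf (fun k => ‖U k y‖ₑ ^ α) atTop ∂μ ≤ ENNReal.ofReal R ^ α := by
    refine (lintegral_liminf_le' fun k => ((hUm k).1.enorm.pow_const α)).trans ?_
    refine liminf_le_of_frequently_le' (Frequently.of_forall fun k => ?_)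
    have h1 : eLpNorm (U k) (ENNReal.ofReal α) μ ≤ ENNReal.ofReal R :=
      ENNReal.le_ofReal_iff_toReal_le (hUm k).2.ne (ENNReal.toReal_nonneg.trans (hR k)) |>.2 (hR k)
    rw [eLpNorm_eq_lintegral_rpow_enorm_toReal hα0 (by simp), ENNReal.toReal_ofReal hα.le] at h1
    calc ∫⁻ y, ‖U k y‖ₑ ^ α ∂μ = ((∫⁻ y, ‖U k y‖ₑ ^ α ∂μ) ^ (1 / α)) ^ α := by
          rw [← ENNReal.rpow_mul, one_div, inv_mul_cancel₀ hα.ne', ENNReal.rpow_one]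
      _ ≤ _ := by gcongr
  have hmeas : AEMeasurable (fun y => liminf (fun k => ‖U k y‖ₑ ^ α) atTop) μ := by
    simp_rw [liminf_eq_iSup_iInf_of_nat]
    exact .iSup fun n => .biInf _ (to_countable _) fun k _ => (hUm k).1.enorm.pow_const α
  have hpow : ∀ y, liminf (fun k => ‖U k y‖ₑ ^ α) atTop =
      (liminf (fun k => ‖U k y‖ₑ) atTop) ^ α := fun y =>
    ((ENNReal.orderIsoRpow α hα).liminf_apply (u := fun k => ‖U k y‖ₑ) (f := atTop)
      (by isBoundedDefault) (by isBoundedDefault) (by isBoundedDefault)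
      (by isBoundedDefault)).symm
  have hRtop : ENNReal.ofReal R ^ α < ∞ := ENNReal.rpow_lt_top_of_nonneg hα.le (by simp)
  have hae : ∀ᵐ y ∂μ, ι (W (Z y)) = Z y ∧
      ‖W (Z y)‖ₑ ^ α ≤ liminf (fun k => ‖U k y‖ₑ ^ α) atTop := by
    filter_upwards [hZ, ae_lt_top' hmeas (hint.trans_lt hRtop).ne] with y hy hfin
    rw [hpow] at hfin ⊢
    obtain ⟨w, hw, hwn⟩ := hι.exists_preimage_of_tendsto_inner hy (fun h => by
      rw [h, ENNReal.top_rpow_of_pos hα] at hfin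
      exact lt_irrefl _ hfin)
    rw [← hw, hW]
    exact ⟨rfl, by gcongr⟩
  refine ⟨⟨hWm, ?_⟩, hae.mono fun y hy => hy.1⟩
  rw [eLpNorm_lt_top_iff_lintegral_rpow_enorm_lt_top hα0 (by simp), ENNReal.toReal_ofReal hα.le]
  exact (lintegral_mono_ae (hae.mono fun y hy => hy.2)).trans_lt (hint.trans_lt hRtop)

variable [IsFiniteMeasure μ]

lemma integrable_abs_inner {E : Y → H} (hE : AEStronglyMeasurable E μ) {M : ℝ}
    (hM : ∀ᵐ y ∂μ, ‖E y‖ ≤ M) (h : H) : Integrable (fun y => |inner ℝ (E y) h|) μ := by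
  refine Integrable.mono' (integrable_const (M * ‖h‖))
    (continuous_abs.comp_aestronglyMeasurable (hE.inner aestronglyMeasurable_const)) ?_
  filter_upwards [hM] with y hy
  rw [Real.norm_eq_abs, abs_abs]
  exact (abs_real_inner_le_norm _ _).trans (by gcongr)

lemma tendsto_integral_inner_of_bounded {E : ℕ → Y → H} (hE : ∀ k, AEStronglyMeasurable (E k) μ)
    {M : ℝ} (hM : ∀ k, ∀ᵐ y ∂μ, ‖E k y‖ ≤ M)
    (hlim : ∀ᵐ y ∂μ, ∀ h, Tendsto (fun k => inner ℝ (E k y) h) atTop (𝓝 0)) (h : H) :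
    Tendsto (fun k => ∫ y, |inner ℝ (E k y) h| ∂μ) atTop (𝓝 0) := by
  have h1 := tendsto_integral_of_dominated_convergence (μ := μ)
    (F := fun k y => |inner ℝ (E k y) h|) (f := fun _ => (0 : ℝ)) (fun _ => M * ‖h‖)
    (fun k => (integrable_abs_inner (hE k) (hM k) h).1) (integrable_const _)
    (fun k => by
      filter_upwards [hM k] with y hy
      rw [Real.norm_eq_abs, abs_abs]
      exact (abs_real_inner_le_norm _ _).trans (by gcongr))
    (by
      filter_upwards [hlim] with y hy
      simpa using (hy h).abs)
  simpa using h1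

/-- Uniformly bounded additive functionals on `L^q` that converge to zero on indicator functions
with values in a dense set converge to zero everywhere. -/
lemma tendsto_zero_of_memLp_of_dense {E : Type*} [NormedAddCommGroup E] {q : ℝ≥0∞} (hq0 : q ≠ 0)
    (hq : q ≠ ∞) {D : Set E} (hD : Dense D) {Λ : ℕ → (Y → E) → ℝ}
    (hadd : ∀ k a b, MemLp a q μ → MemLp b q μ → Λ k (a + b) = Λ k a + Λ k b) {R : ℝ} (hR : 0 ≤ R)
    (hΛ : ∀ k a, MemLp a q μ → |Λ k a| ≤ (eLpNorm a q μ).toReal * R)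
    (hlim : ∀ c ∈ D, ∀ t, MeasurableSet t →
      Tendsto (fun k => Λ k (t.indicator fun _ => c)) atTop (𝓝 0))
    {b : Y → E} (hb : MemLp b q μ) : Tendsto (fun k => Λ k b) atTop (𝓝 0) := by
  refine Metric.tendsto_nhds.2 fun ε hε => ?_
  set δ := ε / (2 * (R + 1)) with hδ
  have hδ0 : 0 < δ := by positivity
  obtain ⟨a, ha, ham, hlim'⟩ := MemLp.induction_dense hq
    (fun a : Y → E => MemLp a q μ ∧ Tendsto (fun k => Λ k a) atTop (𝓝 0))
    (fun c t ht _ η hη => by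
      obtain ⟨δ', hδ', hδη⟩ : ∃ δ' : ℝ, 0 < δ' ∧
          ∀ x : E, ‖x‖ ≤ δ' → eLpNorm (fun _ : Y => x) q μ ≤ η := by
        have h1 : Tendsto (fun δ' : ℝ => ENNReal.ofReal δ' * μ univ ^ (1 / q.toReal)) (𝓝[>] 0)
            (𝓝 (ENNReal.ofReal 0 * μ univ ^ (1 / q.toReal))) := by
          refine ENNReal.Tendsto.mul_const
            ((ENNReal.continuous_ofReal.tendsto 0).mono_left nhdsWithin_le_nhds) (Or.inr ?_)
          exact ENNReal.rpow_ne_top_of_nonneg (by positivity) (measure_ne_top μ _)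
        rw [ENNReal.ofReal_zero, zero_mul] at h1
        obtain ⟨δ', h2, h3⟩ := ((h1.eventually (gt_mem_nhds (pos_iff_ne_zero.2 hη))).and
          self_mem_nhdsWithin).exists
        refine ⟨δ', h3, fun x hx => ?_⟩
        rcases eq_or_ne μ 0 with rfl | hμ
        · simp
        rw [eLpNorm_const x hq0 hμ]
        refine le_trans ?_ h2.le
        gcongr
        rw [← ofReal_norm]
        exact ENNReal.ofReal_le_ofReal hx
      obtain ⟨h, hhD, hh⟩ := hD.exists_dist_lt c hδ'
      refine ⟨t.indicator fun _ => h, ?_, memLp_indicator_of_restrict ht (memLp_const _),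
        hlim h hhD t ht⟩
      rw [← indicator_sub']
      refine (eLpNorm_indicator_le _).trans (hδη (h - c) ?_)
      rw [← dist_eq_norm, dist_comm]
      exact hh.le)
    (fun a a' h1 h2 => ⟨h1.1.add h2.1, by
      have h3 := h1.2.add h2.2
      rw [add_zero] at h3
      exact h3.congr fun k => (hadd k a a' h1.1 h2.1).symm⟩)
    (fun a h => h.1.1) hb (ε := ENNReal.ofReal δ) (by simpa using hδ0)
  have hsub : MemLp (b - a) q μ := hb.sub ham
  filter_upwards [Metric.tendsto_nhds.1 hlim' (ε / 2) (by positivity)] with k hk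
  rw [dist_zero_right, Real.norm_eq_abs] at hk ⊢
  have h1 := hΛ k _ hsub
  have h2 : (eLpNorm (b - a) q μ).toReal ≤ δ := ENNReal.toReal_le_of_le_ofReal hδ0.le ha
  have h3 := hadd k _ _ hsub ham
  rw [sub_add_cancel] at h3
  have h4 : (eLpNorm (b - a) q μ).toReal * R ≤ δ * R := by gcongr
  have h5 : δ * R < ε / 2 := by
    rw [hδ, div_mul_eq_mul_div, div_lt_div_iff₀ (by positivity) (by positivity)]
    nlinarith
  rw [abs_le] at h1
  rw [abs_lt] at hk ⊢
  constructor <;> linarith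

/-- Weak convergence in `L^p(V)`, from boundedness and weak convergence in `H` at almost every
point. -/
lemma IsGelfandTriple.tendsto_integral_dual_apply (hι : IsGelfandTriple ι)
    {p q : ℝ≥0∞} [p.HolderConjugate q] (hq : q ≠ ∞) {w : ℕ → Y → V} (hw : ∀ k, MemLp (w k) p μ)
    {R : ℝ} (hR : ∀ k, (eLpNorm (w k) p μ).toReal ≤ R)
    {M : ℝ} (hM : ∀ k, ∀ᵐ y ∂μ, ‖ι (w k y)‖ ≤ M)
    (hlim : ∀ᵐ y ∂μ, ∀ h, Tendsto (fun k => inner ℝ (ι (w k y)) h) atTop (𝓝 0))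
    {b : Y → StrongDual ℝ V} (hb : MemLp b q μ) :
    Tendsto (fun k => ∫ y, b y (w k y) ∂μ) atTop (𝓝 0) := by
  have hE : ∀ k, AEStronglyMeasurable (fun y => ι (w k y)) μ := fun k =>
    ι.continuous.comp_aestronglyMeasurable (hw k).1
  refine tendsto_zero_of_memLp_of_dense (Λ := fun k a => ∫ y, a y (w k y) ∂μ)
    (ENNReal.HolderConjugate.symm (p := p) (q := q)).ne_zero hq hι.denseRange_toDualV
    (fun k a a' ha ha' => ?_) (ENNReal.toReal_nonneg.trans (hR 0)) (fun k a ha => ?_) ?_ hb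
  · rw [← integral_add (ha.dual_apply (hw k)) (ha'.dual_apply (hw k))]
    rfl
  · exact (abs_integral_dual_apply_le (p := p) ha (hw k)).trans (by gcongr; exact hR k)
  · rintro _ ⟨h, rfl⟩ t ht
    have h1 := tendsto_integral_inner_of_bounded hE hM hlim h
    refine squeeze_zero_norm (fun k => (norm_integral_le_integral_norm _).trans ?_) h1
    refine integral_mono_of_nonneg (Eventually.of_forall fun y => norm_nonneg _)
      (integrable_abs_inner (hE k) (hM k) h) (Eventually.of_forall fun y => ?_)
    by_cases hy : y ∈ t
    · simp [hy, real_inner_comm]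
    · simp [hy]

/-- Strong convergence in `L²(H)` from the compactness of the embedding. -/
lemma IsCompactOperator.tendsto_integral_norm_sq (hι : IsCompactOperator ι)
    {α : ℝ} (hα : 1 < α) {w : ℕ → Y → V} (hw : ∀ k, MemLp (w k) (ENNReal.ofReal α) μ)
    {R : ℝ} (hR : ∀ k, ∫ y, ‖w k y‖ ^ α ∂μ ≤ R)
    {M : ℝ} (hM : ∀ k, ∀ᵐ y ∂μ, ‖ι (w k y)‖ ≤ M)
    (hlim : ∀ᵐ y ∂μ, ∀ h, Tendsto (fun k => inner ℝ (ι (w k y)) h) atTop (𝓝 0)) :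
    Tendsto (fun k => ∫ y, ‖ι (w k y)‖ ^ 2 ∂μ) atTop (𝓝 0) := by
  have hα0 : 0 < α := by linarith
  have hE : ∀ k, AEStronglyMeasurable (fun y => ι (w k y)) μ := fun k =>
    ι.continuous.comp_aestronglyMeasurable (hw k).1
  have hR0 : 0 ≤ R := (integral_nonneg fun y => by positivity).trans (hR 0)
  have hpow : ∀ k, Integrable (fun r => ‖w k r‖ ^ α) μ := fun k => by
    have := (hw k).integrable_norm_rpow (by simp [hα0]) (by simp)
    rwa [ENNReal.toReal_ofReal hα0.le] at this
  set M' := |M| with hM'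
  have hMM : ∀ k, ∀ᵐ y ∂μ, ‖ι (w k y)‖ ≤ M' := fun k =>
    (hM k).mono fun y hy => hy.trans (le_abs_self M)
  have hM0 : 0 ≤ M' := abs_nonneg _
  set Q := μ.real univ with hQ
  refine Metric.tendsto_nhds.2 fun ε hε => ?_
  -- `η` makes the first term of `IsCompactOperator.exists_finset_norm_sq_le` small; in the second
  -- one, `‖w k‖` is truncated at a level `N` with small tails
  set η := ε / (4 * (M' * (R + Q) + 1)) with hη
  have hQ0 : 0 ≤ Q := measureReal_nonneg
  have hη0 : 0 < η := by positivity
  obtain ⟨F, hF⟩ := hι.exists_finset_norm_sq_le hη0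
  set S := M' * ∑ h ∈ F, ‖h‖ with hS
  have hS0 : 0 ≤ S := by positivity
  obtain ⟨N, hN, hNε⟩ : ∃ N : ℝ, 0 < N ∧ N ^ (1 - α) * (S * R) < ε / 4 := by
    have h1 : Tendsto (fun N : ℝ => N ^ (-(α - 1)) * (S * R)) atTop (𝓝 (0 * (S * R))) :=
      (tendsto_rpow_neg_atTop (by linarith)).mul_const _
    rw [zero_mul] at h1
    obtain ⟨N, h2, h3⟩ := ((h1.eventually (gt_mem_nhds (by positivity : 0 < ε / 4))).and
      (eventually_gt_atTop 0)).exists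
    exact ⟨N, h3, by rwa [neg_sub] at h2⟩
  have hint : ∀ k h, Integrable (fun y => |inner ℝ (ι (w k y)) h|) μ := fun k h =>
    integrable_abs_inner (hE k) (hM k) h
  have hsum : Tendsto (fun k => N * ∑ h ∈ F, ∫ y, |inner ℝ (ι (w k y)) h| ∂μ) atTop
      (𝓝 (N * ∑ h ∈ F, (0 : ℝ))) :=
    (tendsto_finsetSum _ fun h _ => tendsto_integral_inner_of_bounded hE hM hlim h).const_mul N
  simp only [Finset.sum_const_zero, mul_zero] at hsum
  filter_upwards [hsum.eventually (gt_mem_nhds (show 0 < ε / 4 by positivity))] with k hk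
  have hI₁ : Integrable (fun y => 1 + ‖w k y‖ ^ α) μ := (integrable_const 1).add (hpow k)
  have hI₂ : Integrable (fun y => N * ∑ h ∈ F, |inner ℝ (ι (w k y)) h|) μ :=
    (integrable_finsetSum _ fun h _ => hint k h).const_mul N
  have hI₃ : Integrable (fun y => N ^ (1 - α) * S * ‖w k y‖ ^ α) μ := (hpow k).const_mul _
  have hI₄ : Integrable (fun y => N * ∑ h ∈ F, |inner ℝ (ι (w k y)) h| +
      N ^ (1 - α) * S * ‖w k y‖ ^ α) μ := hI₂.add hI₃
  have hle : ∫ y, ‖ι (w k y)‖ ^ 2 ∂μ ≤ ∫ y, (η * M' * (1 + ‖w k y‖ ^ α) +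
      (N * ∑ h ∈ F, |inner ℝ (ι (w k y)) h| + N ^ (1 - α) * S * ‖w k y‖ ^ α)) ∂μ := by
    refine integral_mono_of_nonneg (Eventually.of_forall fun y => by positivity)
      ((hI₁.const_mul (η * M')).add hI₄) ?_
    filter_upwards [hMM k] with y hy
    refine (hF (w k y)).trans (add_le_add ?_ ?_)
    · have h1 := le_min_add_mul_rpow (norm_nonneg (w k y)) one_pos hα.le
      rw [Real.one_rpow, one_mul] at h1
      have h2 : ‖w k y‖ ≤ 1 + ‖w k y‖ ^ α := h1.trans (by gcongr; exact min_le_right _ _)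
      calc η * ‖w k y‖ * ‖ι (w k y)‖ ≤ η * (1 + ‖w k y‖ ^ α) * M' := by gcongr
        _ = _ := by ring
    · have h1 := le_min_add_mul_rpow (norm_nonneg (w k y)) hN hα.le
      have h2 : ‖w k y‖ ≤ N + N ^ (1 - α) * ‖w k y‖ ^ α :=
        h1.trans (by gcongr; exact min_le_right _ _)
      have h3 : ∑ h ∈ F, |inner ℝ (ι (w k y)) h| ≤ S := by
        rw [hS, Finset.mul_sum]
        exact Finset.sum_le_sum fun h _ => (abs_real_inner_le_norm _ _).trans (by gcongr)
      have h4 : 0 ≤ ∑ h ∈ F, |inner ℝ (ι (w k y)) h| := Finset.sum_nonneg fun _ _ => abs_nonneg _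
      calc ‖w k y‖ * ∑ h ∈ F, |inner ℝ (ι (w k y)) h|
          ≤ (N + N ^ (1 - α) * ‖w k y‖ ^ α) * ∑ h ∈ F, |inner ℝ (ι (w k y)) h| := by gcongr
        _ = N * ∑ h ∈ F, |inner ℝ (ι (w k y)) h| +
            N ^ (1 - α) * (∑ h ∈ F, |inner ℝ (ι (w k y)) h|) * ‖w k y‖ ^ α := by ring
        _ ≤ _ := by gcongr
  rw [integral_add (hI₁.const_mul _) hI₄, integral_add hI₂ hI₃, integral_const_mul,
    integral_const_mul, integral_const_mul, integral_add (integrable_const 1) (hpow k),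
    integral_finsetSum _ (fun h _ => hint k h), integral_const, smul_eq_mul, mul_one] at hle
  have h1 : η * M' * (Q + ∫ y, ‖w k y‖ ^ α ∂μ) ≤ η * M' * (Q + R) := by
    gcongr
    exact hR k
  have h2 : η * M' * (Q + R) < ε / 4 := by
    rw [hη, div_mul_eq_mul_div, div_mul_eq_mul_div, div_lt_div_iff₀ (by positivity) (by positivity)]
    nlinarith
  have h3 : N ^ (1 - α) * S * ∫ y, ‖w k y‖ ^ α ∂μ ≤ N ^ (1 - α) * S * R := by
    gcongr
    exact hR k
  rw [Real.dist_eq, sub_zero, abs_of_nonneg (integral_nonneg fun y => by positivity)]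
  linarith

end Limit

/-! ### Convergence of Galerkin approximations -/

lemma integral_norm_rpow_le_of_eLpNorm_le {Y E : Type*} [MeasurableSpace Y] [NormedAddCommGroup E]
    {μ : Measure Y} {p : ℝ} (hp : 0 < p) {F : Y → E} (hF : MemLp F (ENNReal.ofReal p) μ) {R : ℝ}
    (hR : (eLpNorm F (ENNReal.ofReal p) μ).toReal ≤ R) :
    Integrable (fun y => ‖F y‖ ^ p) μ ∧ ∫ y, ‖F y‖ ^ p ∂μ ≤ R ^ p := by
  have h0 := hF.integrable_norm_rpow (by simp [hp]) (by simp)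
  rw [ENNReal.toReal_ofReal hp.le] at h0
  refine ⟨h0, ?_⟩
  have hI : 0 ≤ ∫ y, ‖F y‖ ^ p ∂μ := integral_nonneg fun y => by positivity
  rw [hF.eLpNorm_eq_integral_rpow_norm (by simp [hp]) (by simp), ENNReal.toReal_ofReal hp.le,
    ENNReal.toReal_ofReal (by positivity)] at hR
  calc ∫ y, ‖F y‖ ^ p ∂μ = ((∫ y, ‖F y‖ ^ p ∂μ) ^ p⁻¹) ^ p := by
        rw [← Real.rpow_mul hI, inv_mul_cancel₀ hp.ne', Real.rpow_one]
    _ ≤ R ^ p := by gcongr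

lemma toReal_eLpNorm_sub_le {Y E : Type*} [MeasurableSpace Y] [NormedAddCommGroup E]
    {μ : Measure Y} {p : ℝ≥0∞} (hp : 1 ≤ p) {F G : Y → E} (hF : MemLp F p μ) (hG : MemLp G p μ) :
    (eLpNorm (fun y => F y - G y) p μ).toReal ≤
      (eLpNorm F p μ).toReal + (eLpNorm G p μ).toReal := by
  rw [← ENNReal.toReal_add hF.2.ne hG.2.ne]
  exact ENNReal.toReal_mono (ENNReal.add_ne_top.2 ⟨hF.2.ne, hG.2.ne⟩)
    (eLpNorm_sub_le hF.1 hG.1 hp)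

section Pointwise

variable {V : Type*} [NormedAddCommGroup V] [NormedSpace ℝ V] [MeasurableSpace V]
  {H : Type*} [NormedAddCommGroup H] [InnerProductSpace ℝ H] {ι : V →L[ℝ] H}
  {α : ℝ} {B : ℝ → V → StrongDual ℝ V} {C c : ℝ} {g : ℝ → ℝ}

/-- Along a weakly convergent sequence in `H`, smallness of the defect in the monotonicity
inequality gives a bound in `V` by coercivity, hence weak convergence of the images by Minty's
trick. -/
lemma IsMonotoneDrift.tendsto_apply_of_defect (hB : IsMonotoneDrift ι α B C c g) (hα : 1 < α)
    (hα2 : α < 2) (hι : IsGelfandTriple ι) (hcomp : IsCompactOperator ι) (t : ℝ) {v : ℕ → V} {w : V}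
    (hv : ∀ h, Tendsto (fun k => inner ℝ (ι (v k)) h) atTop (𝓝 (inner ℝ (ι w) h)))
    (hdef : Tendsto (fun k => C * ‖ι (v k - w)‖ ^ 2 - 2 * (B t (v k) - B t w) (v k - w)) atTop
      (𝓝 0))
    (x : V) : Tendsto (fun k => B t (v k) x) atTop (𝓝 (B t w x)) := by
  have hα1 : 0 < α - 1 := by linarith
  have hc := hB.c_pos
  have hC := hB.C_nonneg
  obtain ⟨D, hD⟩ := hdef.bddAbove_range
  obtain ⟨K, hK, hBK⟩ := hB.exists_norm_le_linear hα hα2 t t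
  -- coercivity gives `c ‖v k‖ ^ α ≤ L (1 + ‖v k‖)`, which is a bound for `‖v k‖` as `1 < α`
  set L := |g t| + |D| + 2 * K * ‖w‖ + 2 * ‖B t w‖ * (1 + ‖w‖) with hL
  have hL0 : 0 ≤ L := by positivity
  have hbd : ∀ k, ‖v k‖ ≤ 1 + (2 * L / c) ^ (α - 1)⁻¹ := by
    intro k
    have h1 := hB.coercivity t (v k)
    have h2 : C * ‖ι (v k - w)‖ ^ 2 - 2 * (B t (v k) - B t w) (v k - w) ≤ D := hD ⟨k, rfl⟩
    have h3 : ‖B t (v k) w‖ ≤ K * (1 + ‖v k‖) * ‖w‖ :=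
      ((B t (v k)).le_opNorm w).trans (by gcongr; exact hBK t ⟨le_rfl, le_rfl⟩ _)
    have h4 := (B t w).le_opNorm (v k)
    have h5 := (B t w).le_opNorm w
    have h6 : 0 ≤ C * ‖ι (v k - w)‖ ^ 2 := by positivity
    simp only [sub_apply, map_sub (B t (v k)), map_sub (B t w), Real.norm_eq_abs, abs_le]
      at h2 h3 h4 h5
    have h7 : c * ‖v k‖ ^ α ≤ L * (1 + ‖v k‖) := by
      have e1 := le_abs_self (g t)
      have e2 := le_abs_self D
      have e3 : 0 ≤ (|g t| + |D|) * ‖v k‖ := by positivity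
      have e4 : 0 ≤ ‖B t w‖ * (1 + ‖w‖ * ‖v k‖) := by positivity
      have e5 : L * (1 + ‖v k‖) = |g t| + |D| + (|g t| + |D|) * ‖v k‖ +
          2 * (K * (1 + ‖v k‖) * ‖w‖) + 2 * (‖B t w‖ * ‖v k‖) + 2 * (‖B t w‖ * ‖w‖) +
          2 * (‖B t w‖ * (1 + ‖w‖ * ‖v k‖)) := by rw [hL]; ring
      linarith [h3.1, h4.2, h4.1, h5.1, h5.2]
    rcases le_total ‖v k‖ 1 with h8 | h8
    · have : 0 ≤ (2 * L / c) ^ (α - 1)⁻¹ := by positivity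
      linarith
    · have hpos : 0 < ‖v k‖ := by linarith
      have h9 : ‖v k‖ ^ (α - 1) ≤ 2 * L / c := by
        rw [le_div_iff₀ hc]
        have e : ‖v k‖ ^ α = ‖v k‖ ^ (α - 1) * ‖v k‖ := by
          rw [← Real.rpow_add_one hpos.ne']; ring_nf
        rw [e] at h7
        have h10 : ‖v k‖ ^ (α - 1) * c * ‖v k‖ ≤ 2 * L * ‖v k‖ := by nlinarith
        exact le_of_mul_le_mul_right h10 hpos
      have h11 : ‖v k‖ ≤ (2 * L / c) ^ (α - 1)⁻¹ := by
        calc ‖v k‖ = (‖v k‖ ^ (α - 1)) ^ (α - 1)⁻¹ := by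
              rw [← Real.rpow_mul hpos.le, mul_inv_cancel₀ hα1.ne', Real.rpow_one]
          _ ≤ _ := by gcongr
      linarith
  have hstrong := hcomp.tendsto_of_tendsto_inner hbd hv
  have hweak : ∀ φ : StrongDual ℝ V, Tendsto (fun k => φ (v k)) atTop (𝓝 (φ w)) := by
    intro φ
    refine tendsto_apply_of_dense (φ := fun k => NormedSpace.inclusionInDoubleDual ℝ V (v k))
      (ψ := NormedSpace.inclusionInDoubleDual ℝ V w) (Eventually.of_forall fun k =>
        (NormedSpace.double_dual_bound ℝ V (v k)).trans (hbd k)) hι.denseRange_toDualV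
      (fun e he => ?_) φ
    obtain ⟨h, rfl⟩ := he
    simp only [NormedSpace.dual_def, toDualV_apply]
    simpa only [real_inner_comm] using hv h
  refine tendsto_apply_of_minty (hB.monotonicity t) (hB.hemicontinuity t) hweak hstrong ?_ x
  have h1 : Tendsto (fun k => C * ‖ι (v k - w)‖ ^ 2) atTop (𝓝 0) := by
    have h2 := ((hstrong.sub_const (ι w)).norm.pow 2).const_mul C
    simpa using h2
  have h3 : Tendsto (fun k => B t w (v k - w)) atTop (𝓝 0) := by
    have := (hweak (B t w)).sub_const (B t w w)
    simpa using this
  have h4 := ((h1.sub hdef).div_const 2).add h3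
  simp only [sub_zero, zero_div, add_zero] at h4
  refine h4.congr fun k => ?_
  rw [sub_apply]
  ring

end Pointwise

section GalerkinLimit

variable {V : Type*} [NormedAddCommGroup V] [NormedSpace ℝ V] [MeasurableSpace V] [BorelSpace V]
  [SecondCountableTopology (StrongDual ℝ V)]
  {H : Type*} [NormedAddCommGroup H] [InnerProductSpace ℝ H] {ι : V →L[ℝ] H}
  {α : ℝ} {B : ℝ → V → StrongDual ℝ V} {C c : ℝ} {g : ℝ → ℝ} {s : ℝ} {z : H} {d : ℕ → V}
  {X : ℕ → ℝ → H} {U : ℕ → ℝ → V}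

lemma IsGalerkinApprox.inner_sub_eq (hB : IsMonotoneDrift ι α B C c g) (hα : 1 < α)
    (h : IsGalerkinApprox ι B s z d X U) (i : ℕ) :
    ∀ᶠ k in atTop, ∀ r t, s ≤ r → r ≤ t →
      inner ℝ (X k t - X k r) (ι (d i)) = (∫ ρ in r..t, B ρ (U k ρ)) (d i) := by
  have := holderConjugate_ofReal hα
  filter_upwards [h.weak i] with k hk r t hr ht
  have hq : 1 ≤ ENNReal.ofReal (α / (α - 1)) :=
    (ENNReal.HolderConjugate.symm (p := ENNReal.ofReal α)).one_le
  have hfin : IsFiniteMeasure (volume.restrict (Icc s t)) := ⟨by simp⟩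
  have hi : IntervalIntegrable (fun ρ => B ρ (U k ρ)) volume r t :=
    (intervalIntegrable_iff_integrableOn_Icc_of_le ht).2
      (IntegrableOn.mono_set ((hB.memLp hα (h.memLp k t)).integrable hq)
        (Icc_subset_Icc_left hr))
  rw [hk r t hr ht, ContinuousLinearMap.intervalIntegral_apply hi]

/-- A subsequence of Galerkin approximations converges weakly in `H`, at every time. -/
lemma IsGalerkinApprox.exists_subseq [CompleteSpace H] (hB : IsMonotoneDrift ι α B C c g)
    (hα : 1 < α) (hι : IsGelfandTriple ι) (hd : DenseRange d)
    (h : IsGalerkinApprox ι B s z d X U) :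
    ∃ ψ : ℕ → ℕ, StrictMono ψ ∧ ∃ Z : ℝ → H, ∀ t, s ≤ t → ∀ h,
      Tendsto (fun k => inner ℝ (X (ψ k) t) h) atTop (𝓝 (inner ℝ (Z t) h)) := by
  have := holderConjugate_ofReal hα
  have hα0 : 0 < α := by linarith
  refine exists_subseq_tendsto_inner (e := fun i => ι (d i)) (s := s)
    (hι.denseRange.comp hd ι.continuous) (fun t ht => ?_) (fun i t ht ε hε => ?_)
  · obtain ⟨R, -, hR⟩ := h.exists_bounds hB hα t
    exact ⟨R, fun k => (hR k).1 t ⟨ht, le_rfl⟩⟩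
  · obtain ⟨R, hR0, hR⟩ := h.exists_bounds hB hα (t + 1)
    -- by Hölder's inequality, the increments are of order `δ ^ (1 / α)` when tested against `d i`
    have h1 : Tendsto (fun δ : ℝ => R * δ ^ (1 / α) * ‖d i‖) (𝓝[>] 0)
        (𝓝 (R * 0 ^ (1 / α) * ‖d i‖)) :=
      (((Real.continuous_rpow_const (by positivity)).tendsto 0).mono_left
        nhdsWithin_le_nhds).const_mul R |>.mul_const _
    rw [Real.zero_rpow (by positivity), mul_zero, zero_mul] at h1
    obtain ⟨δ, ⟨h2, h3⟩, h4⟩ := ((h1.eventually (gt_mem_nhds hε)).and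
      (Ioo_mem_nhdsGT (show (0 : ℝ) < 1 by norm_num))).exists.imp fun δ hδ =>
        (⟨⟨hδ.1, hδ.2.1⟩, hδ.2.2⟩ : (_ ∧ _) ∧ _)
    refine ⟨δ, h3, ?_⟩
    filter_upwards [h.inner_sub_eq hB hα i] with k hk r hr hrδ
    rw [hk t r ht hr, ← Real.norm_eq_abs]
    refine (ContinuousLinearMap.le_opNorm _ _).trans (le_trans ?_ h2.le)
    gcongr
    have h5 := norm_intervalIntegral_dual_le (p := ENNReal.ofReal α) (by simp)
      (hR k).2.2.1 ht hr (by linarith)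
    rw [ENNReal.toReal_ofReal hα0.le] at h5
    refine h5.trans ?_
    have h6 := (hR k).2.2.2
    have h7 : 0 ≤ r - t := by linarith
    gcongr
    linarith

lemma IsGalerkinApprox.tendsto_integral (hB : IsMonotoneDrift ι α B C c g)
    (hα : 1 < α) (hd : DenseRange d) (h : IsGalerkinApprox ι B s z d X U) {Z : ℝ → H}
    (hZ : ∀ t, s ≤ t → ∀ h, Tendsto (fun k => inner ℝ (X k t) h) atTop (𝓝 (inner ℝ (Z t) h)))
    {r t : ℝ} (hr : s ≤ r) (ht : r ≤ t) (v : V) :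
    Tendsto (fun k => (∫ ρ in r..t, B ρ (U k ρ)) v) atTop (𝓝 (inner ℝ (Z t - Z r) (ι v))) := by
  have := holderConjugate_ofReal hα
  obtain ⟨R, hR0, hR⟩ := h.exists_bounds hB hα t
  rw [← toDualV_apply]
  refine tendsto_apply_of_dense (R := R * (t - r) ^ (1 / (ENNReal.ofReal α).toReal))
    (Eventually.of_forall fun k => ?_) hd (fun e he => ?_) v
  · refine (norm_intervalIntegral_dual_le (p := ENNReal.ofReal α) (by simp)
      (hR k).2.2.1 hr ht le_rfl).trans ?_
    have h7 : 0 ≤ t - r := by linarith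
    have h6 := (hR k).2.2.2
    gcongr
  · obtain ⟨i, rfl⟩ := he
    rw [toDualV_apply, inner_sub_left]
    refine ((hZ t (hr.trans ht) _).sub (hZ r hr _)).congr' ?_
    filter_upwards [h.inner_sub_eq hB hα i] with k hk
    rw [← inner_sub_left, hk r t hr ht]

variable {Z : ℝ → H}

lemma IsGalerkinApprox.continuousOn_inner (hB : IsMonotoneDrift ι α B C c g)
    (hα : 1 < α) (hι : IsGelfandTriple ι) (hd : DenseRange d) (h : IsGalerkinApprox ι B s z d X U)
    (hZ : ∀ t, s ≤ t → ∀ h, Tendsto (fun k => inner ℝ (X k t) h) atTop (𝓝 (inner ℝ (Z t) h)))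
    {T M : ℝ} (hM : ∀ r ∈ Icc s T, ‖Z r‖ ≤ M) (x : H) :
    ContinuousOn (fun r => inner ℝ (Z r) x) (Icc s T) := by
  have := holderConjugate_ofReal hα
  have hα0 : 0 < α := by linarith
  obtain ⟨R, hR0, hR⟩ := h.exists_bounds hB hα T
  refine continuousOn_inner_of_bounded hι.denseRange hM (fun v => ?_) x
  have key : ∀ r t, s ≤ r → r ≤ t → t ≤ T →
      |inner ℝ (Z t) (ι v) - inner ℝ (Z r) (ι v)| ≤ R * |t - r| ^ (1 / α) * ‖v‖ := by
    intro r t hr ht htT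
    rw [← inner_sub_left]
    refine le_of_tendsto (h.tendsto_integral hB hα hd hZ hr ht v).abs
      (Eventually.of_forall fun k => ?_)
    rw [← Real.norm_eq_abs]
    refine (ContinuousLinearMap.le_opNorm _ _).trans ?_
    gcongr
    have h5 := norm_intervalIntegral_dual_le (p := ENNReal.ofReal α) (by simp)
      (hR k).2.2.1 hr ht htT
    rw [ENNReal.toReal_ofReal hα0.le] at h5
    have h6 := (hR k).2.2.2
    have h7 : 0 ≤ t - r := by linarith
    rw [abs_of_nonneg h7]
    exact h5.trans (by gcongr)
  intro t ht
  rw [ContinuousWithinAt, tendsto_iff_norm_sub_tendsto_zero]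
  have h1 : Tendsto (fun r : ℝ => R * |r - t| ^ (1 / α) * ‖v‖) (𝓝[Icc s T] t)
      (𝓝 (R * |t - t| ^ (1 / α) * ‖v‖)) := by
    have h2 : Continuous fun r : ℝ => R * |r - t| ^ (1 / α) * ‖v‖ :=
      (((continuous_id.sub continuous_const).abs.rpow_const fun _ =>
        Or.inr (by positivity)).const_mul R).mul_const _
    exact (h2.tendsto t).mono_left nhdsWithin_le_nhds
  rw [sub_self, abs_zero, Real.zero_rpow (by positivity), mul_zero, zero_mul] at h1
  refine squeeze_zero' (Eventually.of_forall fun r => norm_nonneg _) ?_ h1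
  filter_upwards [self_mem_nhdsWithin] with r hr
  rw [Real.norm_eq_abs]
  rcases le_total r t with hrt | htr
  · rw [abs_sub_comm, abs_sub_comm r]
    exact key r t hr.1 hrt ht.2
  · exact key t r ht.1 htr hr.2

/-- The weak limit of Galerkin approximations takes values in `V` at almost every time. -/
lemma IsGalerkinApprox.exists_memLp [CompleteSpace H] [SecondCountableTopology H]
    [CompleteSpace V] [SecondCountableTopology V] (hB : IsMonotoneDrift ι α B C c g) (hα : 1 < α)
    (hι : IsGelfandTriple ι) (hd : DenseRange d) (h : IsGalerkinApprox ι B s z d X U)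
    (hZ : ∀ t, s ≤ t → ∀ h, Tendsto (fun k => inner ℝ (X k t) h) atTop (𝓝 (inner ℝ (Z t) h))) :
    ∃ u : ℝ → V, ∀ T, MemLp u (ENNReal.ofReal α) (volume.restrict (Icc s T)) ∧
      ∀ᵐ r ∂(volume.restrict (Icc s T)), ι (u r) = Z r := by
  borelize H
  have hXc : ∀ k, Continuous fun t => X k (max s t) := fun k => by
    have h1 : Continuous fun t => ι (U k (max s t)) :=
      ι.continuous.comp ((h.cont k).comp_continuous (by fun_prop) fun t => le_max_left s t)
    exact h1.congr fun t => h.emb k _ (le_max_left s t)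
  have hZm : Measurable fun t => Z (max s t) := by
    refine measurable_of_measurable_inner (e := fun i => ι (d i))
      (hι.denseRange.comp hd ι.continuous) fun i => ?_
    refine measurable_of_tendsto_metrizable (f := fun k t => inner ℝ (X k (max s t)) (ι (d i)))
      (fun k => ((hXc k).inner continuous_const).measurable) ?_
    exact tendsto_pi_nhds.2 fun t => hZ _ (le_max_left s t) _
  -- a measurable left inverse of `ι`, to choose `u` measurably
  have hemb : MeasurableEmbedding ι := ι.continuous.measurableEmbedding hι.injective
  set W : H → V := Function.extend ι id fun _ => 0 with hW
  have hWm : Measurable W := hemb.measurable_extend measurable_id measurable_const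
  have hWι : ∀ v, W (ι v) = v := fun v => hι.injective.extend_apply _ _ v
  refine ⟨fun t => W (Z t), fun T => ?_⟩
  obtain ⟨R, hR0, hR⟩ := h.exists_bounds hB hα T
  refine hι.memLp_of_tendsto_inner (by linarith) (fun k => h.memLp k T) (fun k => (hR k).2.1)
    ?_ hWι ?_
  · rw [ae_restrict_iff' measurableSet_Icc]
    refine Eventually.of_forall fun t ht x => ?_
    simp only [h.emb _ t ht.1]
    exact hZ t ht.1 x
  · refine (hWm.comp hZm).aestronglyMeasurable.congr ?_
    rw [EventuallyEq, ae_restrict_iff' measurableSet_Icc]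
    refine Eventually.of_forall fun t ht => ?_
    simp only [Function.comp_apply, max_eq_right ht.1]

/-- The weak limit of Galerkin approximations satisfies the equation. The energy inequality of
the approximations, compared with the one-sided energy estimate for the limit, shows that the
defect in the monotonicity inequality tends to zero in `L¹`. -/
lemma IsGalerkinApprox.toDualV_eq [CompleteSpace H] (hB : IsMonotoneDrift ι α B C c g) (hα : 1 < α)
    (hα2 : α < 2) (hι : IsGelfandTriple ι) (hcomp : IsCompactOperator ι) (hd : DenseRange d)
    (h : IsGalerkinApprox ι B s z d X U)
    (hZ : ∀ t, s ≤ t → ∀ h, Tendsto (fun k => inner ℝ (X k t) h) atTop (𝓝 (inner ℝ (Z t) h)))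
    {u : ℝ → V} {T : ℝ} (hsT : s ≤ T) (hu : MemLp u (ENNReal.ofReal α) (volume.restrict (Icc s T)))
    (huZ : ∀ᵐ r ∂(volume.restrict (Icc s T)), ι (u r) = Z r) :
    toDualV ι (Z T) = toDualV ι z + ∫ r in s..T, B r (u r) := by
  have := holderConjugate_ofReal hα
  have hα0 : 0 < α := by linarith
  have hα1 : 0 < α - 1 := by linarith
  have hq0 : 0 < α / (α - 1) := by positivity
  have hq1 : 1 < α / (α - 1) := by rw [lt_div_iff₀ hα1]; linarith
  have hq : 1 ≤ ENNReal.ofReal (α / (α - 1)) :=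
    (ENNReal.HolderConjugate.symm (p := ENNReal.ofReal α)).one_le
  have hp : 1 ≤ ENNReal.ofReal α := ENNReal.HolderConjugate.one_le _ (ENNReal.ofReal (α / (α - 1)))
  have hZs : Z s = z := by
    refine (hι.denseRange.comp hd ι.continuous).eq_of_inner_left (𝕜 := ℝ) fun i => ?_
    exact tendsto_nhds_unique (hZ s le_rfl _) (tendsto_const_nhds.congr' (by
      filter_upwards [h.init i] with k hk using hk.symm))
  rcases hsT.eq_or_lt with rfl | hsT'
  · simp [hZs]
  set μ := volume.restrict (Icc s T) with hμ
  have hfin : IsFiniteMeasure μ := ⟨by simp [hμ]⟩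
  obtain ⟨R, hR0, hR⟩ := h.exists_bounds hB hα T
  have hbk := fun k => (hR k).2.2.1
  have hUk := fun k => h.memLp k T (p := ENNReal.ofReal α)
  have hb := hB.memLp hα hu
  have hZR : ∀ r ∈ Icc s T, ‖Z r‖ ≤ R := fun r hr =>
    norm_le_of_tendsto_inner (hZ r hr.1 _) (Eventually.of_forall fun k => (hR k).1 r hr)
  have hw : ∀ k, MemLp (fun r => U k r - u r) (ENNReal.ofReal α) μ := fun k => (hUk k).sub hu
  have hwR : ∀ k, (eLpNorm (fun r => U k r - u r) (ENNReal.ofReal α) μ).toReal ≤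
      R + (eLpNorm u (ENNReal.ofReal α) μ).toReal := fun k =>
    (toReal_eLpNorm_sub_le hp (hUk k) hu).trans (by gcongr; exact (hR k).2.1)
  have hιw : ∀ᵐ r ∂μ, ∀ k, ι (U k r - u r) = X k r - Z r := by
    filter_upwards [huZ, ae_restrict_mem measurableSet_Icc] with r h1 h2 k
    rw [map_sub, h1, h.emb k r h2.1]
  have hιwM : ∀ k, ∀ᵐ r ∂μ, ‖ι (U k r - u r)‖ ≤ R + R := fun k => by
    filter_upwards [hιw, ae_restrict_mem measurableSet_Icc] with r h1 h2
    rw [h1]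
    exact (norm_sub_le _ _).trans (add_le_add ((hR k).1 r h2) (hZR r h2))
  have hιlim : ∀ᵐ r ∂μ, ∀ x, Tendsto (fun k => inner ℝ (ι (U k r - u r)) x) atTop (𝓝 0) := by
    filter_upwards [hιw, ae_restrict_mem measurableSet_Icc] with r h1 h2 x
    simp only [h1, inner_sub_left]
    have := (hZ r h2.1 x).sub_const (inner ℝ (Z r) x)
    simpa using this
  -- `U k - u` tends to zero weakly in `L^α(V)` and strongly in `L²(H)`
  have I1 := hι.tendsto_integral_dual_apply (by simp) hw hwR hιwM hιlim hb
  have hwpow := fun k => integral_norm_rpow_le_of_eLpNorm_le hα0 (hw k) (hwR k)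
  have I2 := hcomp.tendsto_integral_norm_sq hα hw (fun k => (hwpow k).2) hιwM hιlim
  have hIcc : ∀ {F : ℝ → ℝ}, ∫ r in s..T, F r = ∫ r, F r ∂μ := fun {F} => by
    rw [intervalIntegral.integral_of_le hsT, hμ, integral_Icc_eq_integral_Ioc]
  -- the one-sided energy estimate for the limit bounds the pairings with `u` from above
  have I3 : ∀ ε > 0, ∀ᶠ k in atTop,
      2 * ∫ r, B r (U k r) (u r) ∂μ ≤ ‖Z T‖ ^ 2 - ‖z‖ ^ 2 + ε := by
    intro ε hε
    have h1 := eventually_two_mul_pairing_le ι (p := ENNReal.ofReal α)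
      (q := ENNReal.ofReal (α / (α - 1))) (by simp) hsT' hu huZ hZR
      (b := fun k r => B r (U k r)) hbk (fun k => (hR k).2.2.2)
      (fun v r t hr ht _ => h.tendsto_integral hB hα hd hZ hr ht v) (by
        have h2 := h.continuousOn_inner hB hα hι hd hZ hZR (Z s) s ⟨le_rfl, hsT⟩
        rw [ContinuousWithinAt, real_inner_self_eq_norm_sq] at h2
        exact h2.mono_left (nhdsWithin_le_of_mem (Icc_mem_nhdsGT hsT'))) hε
    rw [hZs] at h1
    simpa only [hIcc] using h1
  -- the defect in the monotonicity inequality: it is nonnegative, and its integral is bounded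
  -- above by terms that tend to zero
  set F : ℕ → ℝ → ℝ := fun k r => C * ‖ι (U k r - u r)‖ ^ 2 -
    2 * (B r (U k r) - B r (u r)) (U k r - u r) with hF
  have hF0 : ∀ k r, 0 ≤ F k r := fun k r => sub_nonneg.2 (hB.monotonicity r _ _)
  have hsq : ∀ k, Integrable (fun r => ‖ι (U k r - u r)‖ ^ 2) μ := fun k => by
    have hm : AEStronglyMeasurable (fun r => ι (U k r - u r)) μ :=
      ι.continuous.comp_aestronglyMeasurable (hw k).1
    refine Integrable.mono' (integrable_const ((R + R) ^ 2)) (hm.norm.pow 2) ?_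
    filter_upwards [hιwM k] with r hr
    rw [Real.norm_of_nonneg (by positivity)]
    gcongr
  have hi1 : ∀ k, Integrable (fun r => B r (U k r) (U k r)) μ := fun k => (hbk k).dual_apply (hUk k)
  have hi2 : ∀ k, Integrable (fun r => B r (U k r) (u r)) μ := fun k => (hbk k).dual_apply hu
  have hi3 : ∀ k, Integrable (fun r => B r (u r) (U k r - u r)) μ := fun k => hb.dual_apply (hw k)
  have hFe : ∀ k, F k = fun r => C * ‖ι (U k r - u r)‖ ^ 2 + (-2 * B r (U k r) (U k r) +
      (2 * B r (U k r) (u r) + 2 * B r (u r) (U k r - u r))) := fun k => by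
    funext r
    simp only [hF, sub_apply, map_sub]
    ring
  have hi4 : ∀ k, Integrable (fun r => 2 * B r (U k r) (u r) + 2 * B r (u r) (U k r - u r)) μ :=
    fun k => ((hi2 k).const_mul 2).add ((hi3 k).const_mul 2)
  have hi5 : ∀ k, Integrable (fun r => -2 * B r (U k r) (U k r) +
      (2 * B r (U k r) (u r) + 2 * B r (u r) (U k r - u r))) μ :=
    fun k => ((hi1 k).const_mul _).add (hi4 k)
  have hFi : ∀ k, Integrable (F k) μ := fun k => by
    rw [hFe]
    exact ((hsq k).const_mul C).add (hi5 k)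
  have hFint : ∀ k, ∫ r, F k r ∂μ = C * ∫ r, ‖ι (U k r - u r)‖ ^ 2 ∂μ +
      (-2 * ∫ r, B r (U k r) (U k r) ∂μ + (2 * ∫ r, B r (U k r) (u r) ∂μ +
        2 * ∫ r, B r (u r) (U k r - u r) ∂μ)) := fun k => by
    rw [hFe, integral_add ((hsq k).const_mul C) (hi5 k), integral_add ((hi1 k).const_mul _) (hi4 k),
      integral_add ((hi2 k).const_mul 2) ((hi3 k).const_mul 2)]
    simp only [integral_const_mul]
  have hFlim : Tendsto (fun k => ∫ r, F k r ∂μ) atTop (𝓝 0) := by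
    refine tendsto_order.2 ⟨fun a ha => Eventually.of_forall fun k =>
      ha.trans_le (integral_nonneg (hF0 k)), fun ε hε => ?_⟩
    have e1 := (I2.const_mul C).eventually (gt_mem_nhds
      (show C * 0 < ε / 8 by rw [mul_zero]; positivity))
    have e2 := (I1.const_mul 2).eventually (gt_mem_nhds
      (show (2 : ℝ) * 0 < ε / 8 by rw [mul_zero]; positivity))
    filter_upwards [e1, e2, I3 (ε / 8) (by positivity),
      eventually_norm_sq_le_of_tendsto_inner (hZ T hsT (Z T)) (show 0 < ε / 8 by positivity)]
      with k h1 h2 h3 h4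
    have h5 := h.energy k T hsT
    rw [hIcc] at h5
    rw [hFint]
    linarith
  -- along a subsequence the defect vanishes almost everywhere, so that Minty's trick applies at
  -- almost every time
  have hmeas : TendstoInMeasure μ F atTop (fun _ => (0 : ℝ)) := by
    refine tendstoInMeasure_of_tendsto_eLpNorm_of_ne_top (p := 1) one_ne_zero ENNReal.one_ne_top
      (fun k => (hFi k).1) aestronglyMeasurable_const ?_
    have h1 := (ENNReal.continuous_ofReal.tendsto 0).comp hFlim
    rw [ENNReal.ofReal_zero] at h1
    refine h1.congr fun k => ?_
    have e : F k - (fun _ => (0 : ℝ)) = F k := by funext r; simp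
    rw [e, eLpNorm_one_eq_lintegral_enorm, ← ofReal_integral_norm_eq_lintegral_enorm (hFi k)]
    simp only [Function.comp_apply]
    congr 2
    funext r
    rw [Real.norm_of_nonneg (hF0 k r)]
  obtain ⟨ns, hns, hae⟩ := hmeas.exists_seq_tendsto_ae
  have hZlim : ∀ᵐ r ∂μ, ∀ v, Tendsto (fun k => B r (U (ns k) r) v) atTop (𝓝 (B r (u r) v)) := by
    filter_upwards [hae, huZ, ae_restrict_mem measurableSet_Icc] with r h1 h2 h3 v
    refine hB.tendsto_apply_of_defect hα hα2 hι hcomp r (fun x => ?_) h1 v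
    rw [h2]
    simp only [h.emb _ r h3.1]
    exact (hZ r h3.1 x).comp hns.tendsto_atTop
  have hbi : IntervalIntegrable (fun r => B r (u r)) volume s T :=
    (intervalIntegrable_iff_integrableOn_Icc_of_le hsT).2 (hb.integrable hq)
  have hbki : ∀ k, IntervalIntegrable (fun r => B r (U k r)) volume s T := fun k =>
    (intervalIntegrable_iff_integrableOn_Icc_of_le hsT).2 ((hbk k).integrable hq)
  -- the images are bounded in `L^q`, so that convergence almost everywhere carries over to the
  -- integrals
  ext v
  rw [add_apply, ← sub_eq_iff_eq_add', ← hZs, toDualV_apply, toDualV_apply, ← inner_sub_left]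
  refine tendsto_nhds_unique
    ((h.tendsto_integral hB hα hd hZ le_rfl hsT v).comp hns.tendsto_atTop) ?_
  rw [tendsto_iff_norm_sub_tendsto_zero]
  set Q := (R + (eLpNorm (fun r => B r (u r)) (ENNReal.ofReal (α / (α - 1))) μ).toReal) *
    ‖v‖ with hQ
  have hdm : ∀ k, MemLp (fun r => B r (U k r) - B r (u r)) (ENNReal.ofReal (α / (α - 1))) μ :=
    fun k => (hbk k).sub hb
  have hdp := fun k => integral_norm_rpow_le_of_eLpNorm_le hq0 (hdm k)
    ((toReal_eLpNorm_sub_le hq (hbk k) hb).trans (add_le_add_left (hR k).2.2.2 _))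
  have hevm : ∀ k, AEStronglyMeasurable (fun r => (B r (U k r) - B r (u r)) v) μ := fun k =>
    (hdm k).1.dual_apply aestronglyMeasurable_const
  have hple : ∀ k r, |(B r (U k r) - B r (u r)) v| ^ (α / (α - 1)) ≤
      ‖B r (U k r) - B r (u r)‖ ^ (α / (α - 1)) * ‖v‖ ^ (α / (α - 1)) := fun k r => by
    rw [← Real.mul_rpow (norm_nonneg _) (norm_nonneg _), ← Real.norm_eq_abs]
    gcongr
    exact ContinuousLinearMap.le_opNorm _ _
  have hpi : ∀ k, Integrable (fun r => |(B r (U k r) - B r (u r)) v| ^ (α / (α - 1))) μ := fun k =>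
    Integrable.mono' ((hdp k).1.mul_const (‖v‖ ^ (α / (α - 1))))
      (((hevm k).norm.aemeasurable.pow_const _).aestronglyMeasurable)
      (Eventually.of_forall fun r => by
        rw [Real.norm_of_nonneg (by positivity)]
        exact hple k r)
  have hlim := tendsto_integral_abs_of_rpow_bound hq1
    (F := fun k r => (B r (U (ns k) r) - B r (u r)) v) (fun k => hevm _) (fun k => hpi _)
    (R := (R + (eLpNorm (fun r => B r (u r)) (ENNReal.ofReal (α / (α - 1))) μ).toReal) ^
      (α / (α - 1)) * ‖v‖ ^ (α / (α - 1))) (fun k => by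
        refine (integral_mono (hpi _) ((hdp (ns k)).1.mul_const _) (hple _)).trans ?_
        rw [integral_mul_const]
        gcongr
        exact (hdp (ns k)).2) (by
      filter_upwards [hZlim] with r hr
      have := (hr v).sub_const (B r (u r) v)
      simpa using this)
  refine squeeze_zero (fun k => norm_nonneg _) (fun k => ?_) hlim
  simp only [Function.comp_apply]
  rw [← sub_apply, ← intervalIntegral.integral_sub (hbki _) hbi,
    ContinuousLinearMap.intervalIntegral_apply ((hbki _).sub hbi), hIcc]
  exact norm_integral_le_integral_norm _

/-- Galerkin approximations that converge weakly at every time converge to a solution. -/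
theorem IsGalerkinApprox.isVariationalSolution [CompleteSpace H] [SecondCountableTopology H]
    [CompleteSpace V] [SecondCountableTopology V] (hB : IsMonotoneDrift ι α B C c g) (hα : 1 < α)
    (hα2 : α < 2) (hι : IsGelfandTriple ι) (hcomp : IsCompactOperator ι) (hd : DenseRange d)
    (h : IsGalerkinApprox ι B s z d X U)
    (hZ : ∀ t, s ≤ t → ∀ h, Tendsto (fun k => inner ℝ (X k t) h) atTop (𝓝 (inner ℝ (Z t) h))) :
    IsVariationalSolution ι α B s z Z := by
  have := holderConjugate_ofReal hα
  have hq : 1 ≤ ENNReal.ofReal (α / (α - 1)) :=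
    (ENNReal.HolderConjugate.symm (p := ENNReal.ofReal α)).one_le
  obtain ⟨u, hu⟩ := h.exists_memLp hB hα hι hd hZ
  have heq : ∀ t, s ≤ t → toDualV ι (Z t) = toDualV ι z + ∫ r in s..t, B r (u r) := fun t ht =>
    h.toDualV_eq hB hα hα2 hι hcomp hd hZ ht (hu t).1 (hu t).2
  have hZs : Z s = z := toDualV_injective hι.denseRange (by simpa using heq s le_rfl)
  have hcont : ∀ T, ContinuousOn Z (Icc s T) := fun T => by
    obtain ⟨R, hR0, hR⟩ := h.exists_bounds hB hα T
    refine continuousOn_of_integral_eq (p := ENNReal.ofReal α)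
      (q := ENNReal.ofReal (α / (α - 1))) hι.denseRange (by simp) (hu T).1 (hu T).2
      (M := R) (fun r hr => norm_le_of_tendsto_inner (hZ r hr.1 _)
        (Eventually.of_forall fun k => (hR k).1 r hr)) (hB.memLp hα (hu T).1) fun t ht => ?_
    rw [hZs]
    exact heq t ht.1
  refine ⟨fun t ht => ?_, u, ?_, fun t => (hu t).1, fun t ht => ⟨?_, heq t ht⟩⟩
  · refine (hcont (t + 1) t ⟨ht, by linarith⟩).mono_of_mem_nhdsWithin ?_
    filter_upwards [self_mem_nhdsWithin, mem_nhdsWithin_of_mem_nhds (Iio_mem_nhds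
      (show t < t + 1 by linarith))] with r h1 h2
    exact ⟨h1, le_of_lt h2⟩
  · have hcov : Ici s ⊆ ⋃ n : ℕ, Icc s (s + n) := fun r hr => by
      obtain ⟨n, hn⟩ := exists_nat_ge (r - s)
      exact mem_iUnion.2 ⟨n, hr, by linarith⟩
    refine ae_mono (Measure.restrict_mono hcov le_rfl) ?_
    exact (ae_restrict_iUnion_iff _ _).2 fun n => (hu _).2
  · have hfin : IsFiniteMeasure (volume.restrict (Icc s t)) := ⟨by simp⟩
    exact (intervalIntegrable_iff_integrableOn_Icc_of_le ht).2
      ((hB.memLp hα (hu t).1).integrable hq)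

end GalerkinLimit

/-! ### Existence of solutions -/

section Existence

variable {V : Type*} [NormedAddCommGroup V] [NormedSpace ℝ V] [MeasurableSpace V] [BorelSpace V]
  [SecondCountableTopology (StrongDual ℝ V)]
  {H : Type*} [NormedAddCommGroup H] [InnerProductSpace ℝ H] [CompleteSpace H]
  [SecondCountableTopology H] {ι : V →L[ℝ] H} [CompleteSpace V] [SecondCountableTopology V]

/-- Existence of solutions. The solution is obtained from explicit approximations, by first a strong
and then a weak limit; this is what makes it depend measurably on parameters. -/
theorem IsMonotoneDrift.exists_isVariationalSolution
    {α : ℝ} {B : ℝ → V → StrongDual ℝ V} {C c : ℝ} {g : ℝ → ℝ}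
    (hB : IsMonotoneDrift ι α B C c g) (hα : 1 < α) (hα2 : α < 2)
    (hι : IsGelfandTriple ι) (hcomp : IsCompactOperator ι) {d : ℕ → V} (hd : DenseRange d)
    {J : ℕ → H →L[ℝ] V} (hJ : ∀ n, IsGalerkinOp ι (J n)) (hJd : ∀ i n, i < n → J n (ι (d i)) = d i)
    (s : ℝ) (z : H) :
    ∃ Z : ℝ → H, IsVariationalSolution ι α B s z Z ∧ ∀ t, s ≤ t → ∃ y : ℕ → H,
      (∀ k, Tendsto (fun m : ℕ => delayIterate (galerkinField (J k) B) s (1 / (m + 1)) (ι (J k z))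
        ((m + 1) ^ 2) t) atTop (𝓝 (y k))) ∧
      ∀ h, Tendsto (fun k => inner ℝ (y k) h) atTop (𝓝 (inner ℝ (Z t) h)) := by
  borelize H
  choose x hxc hx hlim using fun k => (isOneSidedLipschitz_galerkinField hB hα hα2
    (hJ k)).exists_solution s (ι (J k z))
  have hprop := fun k => galerkin_solution_properties hB hα hα2 (hJ k) (hxc k) (hx k)
  have happ : IsGalerkinApprox ι B s z d x (fun k t => J k (x k t)) :=
    { cont := fun k => (J k).continuous.comp_continuousOn (hxc k)
      emb := fun k => (hprop k).1
      weak := fun i => by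
        filter_upwards [eventually_gt_atTop i] with k hk r t hr ht
        rw [(hprop k).2.1 (ι (d i)) r t hr ht, hJd i k hk]
      energy := fun k => (hprop k).2.2
      init := fun i => by
        filter_upwards [eventually_gt_atTop i] with k hk
        rw [hx k s le_rfl, intervalIntegral.integral_same, add_zero, (hJ k).symm, hJd i k hk] }
  obtain ⟨ψ, hψ, Z, hZ⟩ := happ.exists_subseq hB hα hι hd
  have hsol := (happ.comp hψ).isVariationalSolution hB hα hα2 hι hcomp hd hZ
  refine ⟨Z, hsol, fun t ht => ⟨fun k => x k t, fun k => hlim k t ht, fun h => ?_⟩⟩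
  -- every subsequence has a further subsequence converging to a solution, which is unique
  refine tendsto_of_subseq_tendsto fun ns hns => ?_
  obtain ⟨φ, hφ, hnφ⟩ := strictMono_subseq_of_tendsto_atTop hns
  obtain ⟨ψ', hψ', Z', hZ'⟩ := (happ.comp hnφ).exists_subseq hB hα hι hd
  have hsol' := ((happ.comp hnφ).comp hψ').isVariationalSolution hB hα hα2 hι hcomp hd hZ'
  refine ⟨fun k => φ (ψ' k), ?_⟩
  rw [hsol.unique hι.denseRange hB hα hsol' ht]
  exact hZ' t ht h

end Existence

/-! ### Measurable dependence on parameters -/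

section Measurability

variable {Ω : Type*} [MeasurableSpace Ω] {H : Type*} [NormedAddCommGroup H]
  [MeasurableSpace H] [BorelSpace H]

lemma measurable_galerkinField [InnerProductSpace ℝ H] [CompleteSpace H]
    {V : Type*} [NormedAddCommGroup V] [NormedSpace ℝ V] [MeasurableSpace V] [BorelSpace V]
    {B : Ω → ℝ → V → StrongDual ℝ V}
    (hB : Measurable fun p : Ω × ℝ × V => B p.1 p.2.1 p.2.2) (J : H →L[ℝ] V) :
    Measurable fun p : Ω × ℝ × H => galerkinField J (B p.1) p.2.1 p.2.2 := by
  have h1 : Measurable fun p : Ω × ℝ × H => B p.1 p.2.1 (J p.2.2) :=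
    hB.comp (measurable_fst.prodMk (measurable_snd.fst.prodMk
      (J.continuous.measurable.comp measurable_snd.snd)))
  have h2 : Continuous (fun φ : StrongDual ℝ V =>
      (InnerProductSpace.toDual ℝ H).symm (φ.comp J)) :=
    (InnerProductSpace.toDual ℝ H).symm.continuous.comp (by fun_prop)
  exact h2.measurable.comp h1

variable [SecondCountableTopology H]

lemma measurable_delayIterate [InnerProductSpace ℝ H] {F : Ω → ℝ → H → H}
    (hF : Measurable fun p : Ω × ℝ × H => F p.1 p.2.1 p.2.2) (s δ : ℝ) {x₀ : Ω → H}
    (hx₀ : Measurable x₀) (k : ℕ) :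
    Measurable fun p : Ω × ℝ => delayIterate (F p.1) s δ (x₀ p.1) k p.2 := by
  induction k with
  | zero => exact hx₀.comp measurable_fst
  | succ k ih =>
    simp only [delayIterate]
    refine (hx₀.comp measurable_fst).add ?_
    have h1 : Measurable fun q : (Ω × ℝ) × ℝ =>
        F q.1.1 q.2 (delayIterate (F q.1.1) s δ (x₀ q.1.1) k (q.2 - δ)) :=
      hF.comp (measurable_fst.fst.prodMk (measurable_snd.prodMk
        (ih.comp (measurable_fst.fst.prodMk (measurable_snd.sub_const δ)))))
    have h2 : MeasurableSet {q : (Ω × ℝ) × ℝ | s < q.2 ∧ q.2 ≤ max s q.1.2} :=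
      (measurableSet_lt measurable_const measurable_snd).inter
        (measurableSet_le measurable_snd (measurable_const.max measurable_fst.snd))
    have h3 := (h1.indicator h2).stronglyMeasurable.integral_prod_right' (ν := volume)
    convert! h3.measurable using 1
    funext p
    rw [intervalIntegral.integral_of_le (le_max_left s p.2),
      ← integral_indicator measurableSet_Ioc]
    rfl

lemma measurable_of_tendsto_inner [InnerProductSpace ℝ H] [CompleteSpace H] {F : ℕ → Ω → H}
    {G : Ω → H} (hF : ∀ k, Measurable (F k))
    (hlim : ∀ ω h, Tendsto (fun k => inner ℝ (F k ω) h) atTop (𝓝 (inner ℝ (G ω) h))) :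
    Measurable G := by
  obtain ⟨e, he⟩ := TopologicalSpace.exists_dense_seq H
  refine measurable_of_measurable_inner he fun i => ?_
  exact measurable_of_tendsto_metrizable (fun k => (hF k).inner measurable_const)
    (tendsto_pi_nhds.2 fun ω => hlim ω _)

/-- Solutions depend measurably on parameters on which drift and initial value depend
measurably. -/
theorem measurable_of_isVariationalSolution [InnerProductSpace ℝ H] [CompleteSpace H]
    {V : Type*} [NormedAddCommGroup V] [NormedSpace ℝ V] [MeasurableSpace V] [BorelSpace V]
    [SecondCountableTopology (StrongDual ℝ V)] [CompleteSpace V] [SecondCountableTopology V]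
    {ι : V →L[ℝ] H} {α : ℝ} {B : Ω → ℝ → V → StrongDual ℝ V} {C c : Ω → ℝ} {g : Ω → ℝ → ℝ}
    (hB : ∀ ω, IsMonotoneDrift ι α (B ω) (C ω) (c ω) (g ω)) (hα : 1 < α) (hα2 : α < 2)
    (hι : IsGelfandTriple ι) (hcomp : IsCompactOperator ι)
    (hBm : Measurable fun p : Ω × ℝ × V => B p.1 p.2.1 p.2.2) {s t : ℝ} (hst : s ≤ t) {z : Ω → H}
    (hz : Measurable z) {Z : Ω → ℝ → H}
    (hZ : ∀ ω, IsVariationalSolution ι α (B ω) s (z ω) (Z ω)) : Measurable fun ω => Z ω t := by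
  obtain ⟨d, hd⟩ := TopologicalSpace.exists_dense_seq V
  obtain ⟨J, hJ, hJd⟩ := exists_galerkin_scheme hι.injective d
  choose Y hY hYlim using fun ω =>
    (hB ω).exists_isVariationalSolution hα hα2 hι hcomp hd hJ hJd s (z ω)
  choose y hy1 hy2 using fun ω => hYlim ω t hst
  have hm : ∀ k, Measurable fun ω => y ω k := fun k => by
    refine measurable_of_tendsto_metrizable (f := fun (m : ℕ) ω =>
      delayIterate (galerkinField (J k) (B ω)) s (1 / (m + 1)) (ι (J k (z ω))) ((m + 1) ^ 2) t)
      (fun m => ?_) (tendsto_pi_nhds.2 fun ω => hy1 ω k)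
    have h1 := measurable_delayIterate (F := fun ω => galerkinField (J k) (B ω))
      (measurable_galerkinField hBm (J k)) s (1 / ((m : ℝ) + 1)) (x₀ := fun ω => ι (J k (z ω)))
      ((ι.continuous.comp (J k).continuous).measurable.comp hz) ((m + 1) ^ 2)
    exact h1.comp (measurable_id.prodMk measurable_const)
  refine measurable_of_tendsto_inner (fun k => hm k) fun ω h => ?_
  rw [(hZ ω).unique hι.denseRange (hB ω) hα (hY ω) hst]
  exact hy2 ω h

end Measurability

/-! ### Compactness and decay of solutions -/

section Dissipativity

variable {V : Type*} [NormedAddCommGroup V] [NormedSpace ℝ V] [MeasurableSpace V] [BorelSpace V]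
  [SecondCountableTopology (StrongDual ℝ V)]
  {H : Type*} [NormedAddCommGroup H] [InnerProductSpace ℝ H] {ι : V →L[ℝ] H}
  {α : ℝ} {B : ℝ → V → StrongDual ℝ V} {C c : ℝ} {g : ℝ → ℝ} {s : ℝ} {z : H} {Z : ℝ → H}

/-- The energy inequality, for a `V`-valued version of the solution. -/
lemma IsVariationalSolution.exists_energy (hd : DenseRange ι) (hB : IsMonotoneDrift ι α B C c g)
    (hα : 1 < α) (hZ : IsVariationalSolution ι α B s z Z) :
    ∃ u : ℝ → V, ∀ r t, s ≤ r → r ≤ t →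
      MemLp u (ENNReal.ofReal α) (volume.restrict (Icc r t)) ∧
      (∀ᵐ x ∂(volume.restrict (Icc r t)), ι (u x) = Z x) ∧
      ∀ F : ℝ → ℝ, IntervalIntegrable F volume r t →
        (∀ᵐ x ∂(volume.restrict (Ioc r t)), -c * ‖u x‖ ^ α + g x ≤ F x) →
        ‖Z t‖ ^ 2 - ‖Z r‖ ^ 2 ≤ ∫ x in r..t, F x := by
  have := holderConjugate_ofReal hα
  obtain ⟨u, hu⟩ := hZ.exists_version hB hα
  refine ⟨u, fun r t hr ht => ?_⟩
  obtain ⟨h1, h2, h3, h4, M, h5⟩ := hu r t hr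
  refine ⟨h1, h3, fun F hF hle => ?_⟩
  have hE := energy_eq (p := ENNReal.ofReal α) (q := ENNReal.ofReal (α / (α - 1))) hd (by simp)
    ht h1 h3 h5 h2 h4
  rw [hE, ← intervalIntegral.integral_const_mul]
  have hi : IntegrableOn (fun x => B x (u x) (u x)) (Icc r t) volume :=
    h2.dual_apply (p := ENNReal.ofReal α) h1
  rw [intervalIntegral.integral_of_le ht, intervalIntegral.integral_of_le ht]
  refine integral_mono_ae ((hi.mono_set Ioc_subset_Icc_self).const_mul 2)
    ((intervalIntegrable_iff_integrableOn_Ioc_of_le ht).1 hF) ?_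
  filter_upwards [hle] with x hx
  exact (hB.coercivity x (u x)).trans hx

/-- Solutions with bounded initial values are relatively compact at later times. -/
lemma exists_subseq_tendsto_of_isVariationalSolution [CompleteSpace H] (hd : DenseRange ι)
    (hcomp : IsCompactOperator ι) (hB : IsMonotoneDrift ι α B C c g) (hα : 1 < α)
    {z : ℕ → H} {Z : ℕ → ℝ → H} (hZ : ∀ n, IsVariationalSolution ι α B s (z n) (Z n)) {R : ℝ}
    (hR : ∀ n, ‖z n‖ ≤ R) {t : ℝ} (hst : s < t) :
    ∃ φ : ℕ → ℕ, StrictMono φ ∧ ∃ w, Tendsto (fun n => Z (φ n) t) atTop (𝓝 w) := by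
  have hα0 : 0 < α := by linarith
  have hc := hB.c_pos
  obtain ⟨K, hK, hg⟩ := hB.exists_bound s t
  choose u hu using fun n => (hZ n).exists_energy hd hB hα
  have hpow : ∀ n, Integrable (fun r => ‖u n r‖ ^ α) (volume.restrict (Icc s t)) := fun n => by
    have := (hu n s t le_rfl hst.le).1.integrable_norm_rpow (by simp [hα0]) (by simp)
    rwa [ENNReal.toReal_ofReal hα0.le] at this
  set M := (R ^ 2 + K * (t - s)) / c with hM
  have hR0 : 0 ≤ R := (norm_nonneg _).trans (hR 0)
  -- coercivity bounds the solutions in `L^α(V)`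
  have hint : ∀ n, ∫ r in Icc s t, ‖u n r‖ ^ α ≤ M := by
    intro n
    have hi1 : IntervalIntegrable (fun r => ‖u n r‖ ^ α) volume s t :=
      (intervalIntegrable_iff_integrableOn_Icc_of_le hst.le).2 (hpow n)
    have h1 := (hu n s t le_rfl hst.le).2.2 (fun r => -c * ‖u n r‖ ^ α + K)
      ((hi1.const_mul _).add (by simp)) (by
        filter_upwards [ae_restrict_mem measurableSet_Ioc] with x hx
        have := hg x ⟨hx.1.le, hx.2⟩
        linarith)
    rw [intervalIntegral.integral_add (hi1.const_mul _) (by simp),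
      intervalIntegral.integral_const_mul, intervalIntegral.integral_const, smul_eq_mul,
      (hZ n).apply_left hd, intervalIntegral.integral_of_le hst.le,
      ← integral_Icc_eq_integral_Ioc] at h1
    rw [hM, le_div_iff₀ hc]
    have h2 : ‖z n‖ ^ 2 ≤ R ^ 2 := by
      have := hR n
      gcongr
    nlinarith [sq_nonneg ‖Z n t‖]
  have hM0 : 0 ≤ M := (integral_nonneg fun y => by positivity).trans (hint 0)
  have hmeas : ∀ n, AEMeasurable (fun r => ‖u n r‖ₑ ^ α) (volume.restrict (Icc s t)) := fun n =>
    (hu n s t le_rfl hst.le).1.1.enorm.pow_const α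
  have hfatou : ∫⁻ r in Icc s t, liminf (fun n => ‖u n r‖ₑ ^ α) atTop ≤ ENNReal.ofReal M := by
    refine (lintegral_liminf_le' hmeas).trans
      (liminf_le_of_frequently_le' (Frequently.of_forall fun n => ?_))
    have e : ∀ r, ‖u n r‖ₑ ^ α = ENNReal.ofReal (‖u n r‖ ^ α) := fun r => by
      rw [← ENNReal.ofReal_rpow_of_nonneg (norm_nonneg _) hα0.le, ofReal_norm]
    simp only [e]
    rw [← ofReal_integral_eq_lintegral_ofReal (hpow n)
      (Eventually.of_forall fun r => by positivity)]
    exact ENNReal.ofReal_le_ofReal (hint n)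
  have hlimm : AEMeasurable (fun r => liminf (fun n => ‖u n r‖ₑ ^ α) atTop)
      (volume.restrict (Icc s t)) := by
    simp_rw [liminf_eq_iSup_iInf_of_nat]
    exact .iSup fun n => .biInf _ (to_countable _) fun k _ => hmeas k
  have hae : ∀ᵐ r ∂(volume.restrict (Icc s t)), r ∈ Icc s t ∧ (∀ n, ι (u n r) = Z n r) ∧
      liminf (fun n => ‖u n r‖ₑ ^ α) atTop < ∞ := by
    filter_upwards [ae_restrict_mem measurableSet_Icc,
      ae_all_iff.2 fun n => (hu n s t le_rfl hst.le).2.1,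
      ae_lt_top' hlimm (hfatou.trans_lt ENNReal.ofReal_lt_top).ne] with r h1 h2 h3
    exact ⟨h1, h2, h3⟩
  have hne : (ae (volume.restrict (Icc s t))).NeBot := by
    rw [ae_neBot]
    simpa using hst
  -- a time at which infinitely many solutions are bounded in `V`
  obtain ⟨r, hr, hιr, hfin⟩ := hae.exists
  obtain ⟨L, hL, -⟩ := ENNReal.lt_iff_exists_nnreal_btwn.1 hfin
  have hfr := frequently_lt_of_liminf_lt (by isBoundedDefault) hL
  obtain ⟨φ, hφ, hφL⟩ := extraction_of_frequently_atTop hfr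
  have hV : ∀ n, ‖u (φ n) r‖ ≤ (L : ℝ) ^ α⁻¹ := by
    intro n
    have h1 : ‖u (φ n) r‖ ^ α ≤ L := by
      have h2 := (hφL n).le
      rw [← ofReal_norm, ENNReal.ofReal_rpow_of_nonneg (norm_nonneg _) hα0.le,
        ENNReal.ofReal_le_iff_le_toReal (by simp)] at h2
      simpa using h2
    calc ‖u (φ n) r‖ = (‖u (φ n) r‖ ^ α) ^ α⁻¹ := by
          rw [← Real.rpow_mul (norm_nonneg _), mul_inv_cancel₀ hα0.ne', Real.rpow_one]
      _ ≤ _ := by gcongr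
  have hcpt := hcomp.isCompact_closure_image_closedBall ((L : ℝ) ^ α⁻¹)
  obtain ⟨w, -, ψ, hψ, hw⟩ := hcpt.tendsto_subseq (x := fun n => Z (φ n) r) fun n =>
    subset_closure ⟨u (φ n) r, by simpa using hV n, hιr _⟩
  -- convergence at time `r` carries over to time `t` by continuous dependence
  have hcau : CauchySeq fun n => Z (φ (ψ n)) t := by
    have h1 := hw.cauchySeq
    rw [Metric.cauchySeq_iff] at h1 ⊢
    intro ε hε
    set E := Real.exp (C * (t - r)) with hE
    have hE0 : 0 < E := Real.exp_pos _
    obtain ⟨n₀, hn₀⟩ := h1 (ε / (Real.sqrt E)) (by positivity)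
    refine ⟨n₀, fun m hm n hn => ?_⟩
    have h2 := hn₀ m hm n hn
    have h3 := ((hZ (φ (ψ m))).restart hr.1).norm_sub_sq_le hd hB hα
      ((hZ (φ (ψ n))).restart hr.1) hr.2
    rw [dist_eq_norm] at h2 ⊢
    rw [lt_div_iff₀ (by positivity)] at h2
    simp only [Function.comp_apply] at h2
    refine lt_of_pow_lt_pow_left₀ 2 hε.le (h3.trans_lt ?_)
    calc _ = (‖Z (φ (ψ m)) r - Z (φ (ψ n)) r‖ * Real.sqrt E) ^ 2 := by
          rw [mul_pow, Real.sq_sqrt hE0.le]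
      _ < ε ^ 2 := by gcongr
  obtain ⟨y, hy⟩ := cauchySeq_tendsto_of_complete hcau
  exact ⟨φ ∘ ψ, hφ.comp hψ, y, hy⟩

/-- Comparison with the explicit supersolutions `ℓ(t) ^ β`, where `ℓ(t) = a - κ t` is affine and
`β = 1 / (2 - α)`. As the drift is coercive of order `α < 2`, decay of `ℓ` at a small enough linear
rate `κ` is compatible with errors of order `ℓ ^ (α β)`. -/
lemma IsVariationalSolution.norm_le_rpow (hd : DenseRange ι) (hB : IsMonotoneDrift ι α B C c g)
    (hα : 1 < α) (hα2 : α < 2) (hZ : IsVariationalSolution ι α B s z Z) {a κ t : ℝ} (hst : s ≤ t)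
    (hκ : 0 ≤ κ) (hκc : 4 * (1 / (2 - α)) * κ ≤ c / (‖ι‖ + 1) ^ α) (hpos : 0 ≤ a - κ * t)
    (hg : ∀ x ∈ Icc s t,
      g x ≤ c / (‖ι‖ + 1) ^ α / 2 * (a - κ * x) ^ (α * (1 / (2 - α))))
    (h0 : ‖z‖ ≤ (a - κ * s) ^ (1 / (2 - α))) : ‖Z t‖ ≤ (a - κ * t) ^ (1 / (2 - α)) := by
  have hα0 : 0 < α := by linarith
  have hc := hB.c_pos
  have h2α : 0 < 2 - α := by linarith
  set β := 1 / (2 - α) with hβ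
  have hβ0 : 0 < β := by positivity
  have hβ1 : 2 * β - 1 = α * β := by rw [hβ]; field_simp; ring
  set c' := c / (‖ι‖ + 1) ^ α with hc'
  have hc'0 : 0 < c' := by positivity
  have hℓ : ∀ x ≤ t, 0 ≤ a - κ * x := fun x hx => by nlinarith
  by_contra! hcon
  have hcont : ContinuousOn (fun x => ‖Z x‖ - (a - κ * x) ^ β) (Icc s t) := by
    refine (hZ.1.mono Icc_subset_Ici_self).norm.sub (Continuous.continuousOn ?_)
    exact (by fun_prop : Continuous fun x : ℝ => a - κ * x).rpow_const fun x => Or.inr hβ0.le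
  -- the last time at which the solution lies below the supersolution
  have hKc : IsCompact {x ∈ Icc s t | ‖Z x‖ - (a - κ * x) ^ β ≤ 0} :=
    isCompact_Icc.of_isClosed_subset
      (hcont.preimage_isClosed_of_isClosed isClosed_Icc isClosed_Iic) fun x hx => hx.1
  obtain ⟨r, ⟨hr, hrle⟩, hrmax⟩ := hKc.exists_isGreatest
    ⟨s, ⟨le_rfl, hst⟩, by rw [hZ.apply_left hd]; linarith⟩
  have hgt : ∀ x ∈ Ioc r t, (a - κ * x) ^ β ≤ ‖Z x‖ := by
    intro x hx
    by_contra! h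
    exact absurd (hrmax ⟨⟨hr.1.trans hx.1.le, hx.2⟩, by linarith⟩) (not_le.2 hx.1)
  obtain ⟨u, hu⟩ := hZ.exists_energy hd hB hα
  obtain ⟨-, h2, h3⟩ := hu r t hr.1 hr.2
  -- the derivative of the squared supersolution; it dominates that of `‖Z‖²` on `(r, t]`, where the
  -- solution lies above the supersolution
  have hFc : Continuous fun x : ℝ => (2 * β) * (a - κ * x) ^ (2 * β - 1) * (-κ) := by
    refine (continuous_const.mul ?_).mul continuous_const
    exact (by fun_prop : Continuous fun x : ℝ => a - κ * x).rpow_const fun x =>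
      Or.inr (by rw [hβ1]; positivity)
  have h4 := h3 (fun x => (2 * β) * (a - κ * x) ^ (2 * β - 1) * (-κ))
    (hFc.intervalIntegrable _ _) (by
      filter_upwards [ae_restrict_mem measurableSet_Ioc,
        ae_mono (Measure.restrict_mono Ioc_subset_Icc_self le_rfl) h2] with x hx hux
      have h5 := hgt x hx
      have h6 := hg x ⟨hr.1.trans hx.1.le, hx.2⟩
      have hℓx := hℓ x hx.2
      have h7 : (a - κ * x) ^ (α * β) ≤ ‖Z x‖ ^ α := by
        rw [mul_comm α, Real.rpow_mul hℓx]
        gcongr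
      have h8 : ‖Z x‖ ^ α ≤ (‖ι‖ + 1) ^ α * ‖u x‖ ^ α := by
        rw [← Real.mul_rpow (by positivity) (norm_nonneg _), ← hux]
        gcongr
        refine (ι.le_opNorm _).trans ?_
        gcongr
        linarith
      have h9 : c' * ‖Z x‖ ^ α ≤ c * ‖u x‖ ^ α := by
        calc c' * ‖Z x‖ ^ α ≤ c' * ((‖ι‖ + 1) ^ α * ‖u x‖ ^ α) := by gcongr
          _ = c * ‖u x‖ ^ α := by
            rw [hc']
            field_simp
      rw [hβ1]
      have h10 : 0 ≤ (a - κ * x) ^ (α * β) := by positivity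
      have h11 : 4 * β * κ * (a - κ * x) ^ (α * β) ≤ c' * (a - κ * x) ^ (α * β) := by gcongr
      have h12 : c' * (a - κ * x) ^ (α * β) ≤ c' * ‖Z x‖ ^ α := by gcongr
      linarith)
  rw [intervalIntegral.integral_eq_sub_of_hasDerivAt
    (f := fun x : ℝ => (a - κ * x) ^ (2 * β)) (fun x _ => by
      have h5 : HasDerivAt (fun x : ℝ => a - κ * x) (-κ) x := by
        simpa using ((hasDerivAt_id x).const_mul κ).const_sub a
      have h6 : 1 ≤ 2 * β := by nlinarith [mul_pos hα0 hβ0]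
      convert! h5.rpow_const (Or.inr h6) using 1
      ring) (hFc.intervalIntegrable _ _)] at h4
  have e : ∀ x ≤ t, (a - κ * x) ^ (2 * β) = ((a - κ * x) ^ β) ^ 2 := fun x hx => by
    rw [mul_comm 2 β, Real.rpow_mul (hℓ x hx)]
    norm_cast
  rw [e t le_rfl, e r hr.2] at h4
  have h5 : ‖Z r‖ ≤ (a - κ * r) ^ β := by linarith
  have h6 : ‖Z r‖ ^ 2 ≤ ((a - κ * r) ^ β) ^ 2 := by gcongr
  have h7 : ((a - κ * t) ^ β) ^ 2 < ‖Z t‖ ^ 2 := by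
    have := hℓ t le_rfl
    gcongr
  linarith

end Dissipativity

/-! ### Pullback limit sets of compact processes -/

section Pullback

variable {H : Type*} [NormedAddCommGroup H]

/-- The pullback limit set at time `t` of a family `E` under the process `φ`: all limits of
`φ t (s n) (x n)` with `s n → -∞` and `x n ∈ E (s n)`. -/
def pullbackLimitSet (φ : ℝ → ℝ → H → H) (E : ℝ → Set H) (t : ℝ) : Set H :=
  {y | ∃ (s : ℕ → ℝ) (x : ℕ → H), Tendsto s atTop atBot ∧ (∀ n, x n ∈ E (s n)) ∧
    Tendsto (fun n => φ t (s n) (x n)) atTop (𝓝 y)}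

/-- A process, with evolution `φ t s` from time `s` to time `t`, that is Lipschitz continuous in the
initial value, right-continuous at the initial time, and maps bounded sequences to relatively
compact ones. -/
structure IsCompactProcess (φ : ℝ → ℝ → H → H) (C : ℝ) : Prop where
  comp : ∀ s r t x, s ≤ r → r ≤ t → φ t s x = φ t r (φ r s x)
  norm_sub_le : ∀ s t x y, s ≤ t → ‖φ t s x - φ t s y‖ ≤ Real.exp (C * (t - s)) * ‖x - y‖
  tendsto_right : ∀ s x, Tendsto (fun r => φ r s x) (𝓝[>] s) (𝓝 x)
  exists_subseq : ∀ s t, s < t → ∀ (x : ℕ → H) (R : ℝ), (∀ n, ‖x n‖ ≤ R) →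
    ∃ ψ : ℕ → ℕ, StrictMono ψ ∧ ∃ y, Tendsto (fun n => φ t s (x (ψ n))) atTop (𝓝 y)

/-- The family `E` is mapped to bounded sets from the remote past. -/
def IsPullbackBounded (φ : ℝ → ℝ → H → H) (E : ℝ → Set H) : Prop :=
  ∀ t, ∃ R, ∀ᶠ s in atBot, ∀ x ∈ E s, ‖φ t s x‖ ≤ R

lemma pullbackLimitSet_mono (φ : ℝ → ℝ → H → H) {E F : ℝ → Set H}
    (h : ∀ᶠ s in atBot, E s ⊆ F s) (t : ℝ) :
    pullbackLimitSet φ E t ⊆ pullbackLimitSet φ F t := by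
  rintro y ⟨s, x, hs, hx, hy⟩
  obtain ⟨n₀, hn₀⟩ := eventually_atTop.1 (hs.eventually h)
  exact ⟨fun n => s (n + n₀), fun n => x (n + n₀), hs.comp (tendsto_add_atTop_nat n₀),
    fun n => hn₀ _ (Nat.le_add_left _ _) (hx _), hy.comp (tendsto_add_atTop_nat n₀)⟩

lemma IsPullbackBounded.mono {φ : ℝ → ℝ → H → H} {E F : ℝ → Set H}
    (hF : IsPullbackBounded φ F) (h : ∀ᶠ s in atBot, E s ⊆ F s) : IsPullbackBounded φ E := by
  intro t
  obtain ⟨R, hR⟩ := hF t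
  refine ⟨R, ?_⟩
  filter_upwards [hR, h] with s h1 h2 x hx using h1 x (h2 hx)

lemma semiDist_mono {H : Type*} [PseudoEMetricSpace H] {B B' D D' : Set H} (hB : B ⊆ B')
    (hD : D' ⊆ D) : semiDist B D ≤ semiDist B' D' :=
  iSup₂_le fun b hb => (Metric.infEDist_anti hD).trans
    (le_iSup₂ (f := fun b (_ : b ∈ B') => Metric.infEDist b D') b (hB hb))

lemma infEDist_le_infEDist_add_semiDist {H : Type*} [PseudoEMetricSpace H] (x : H) (B D : Set H) :
    Metric.infEDist x D ≤ Metric.infEDist x B + semiDist B D := by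
  rw [← tsub_le_iff_right]
  refine Metric.le_infEDist.2 fun y hy => ?_
  rw [tsub_le_iff_right]
  refine (Metric.infEDist_le_edist_add_infEDist (y := y)).trans ?_
  gcongr
  exact le_iSup₂ (f := fun b (_ : b ∈ B) => Metric.infEDist b D) y hy

variable {φ : ℝ → ℝ → H → H} {C : ℝ} {E : ℝ → Set H}

lemma IsCompactProcess.continuous (hφ : IsCompactProcess φ C) {s t : ℝ} (hst : s ≤ t) :
    Continuous (φ t s) := by
  refine (LipschitzWith.of_dist_le' (K := Real.exp (C * (t - s))) fun x y => ?_).continuous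
  rw [dist_eq_norm, dist_eq_norm]
  exact hφ.norm_sub_le s t x y hst

/-- Right-continuity in the initial time. -/
lemma IsCompactProcess.tendsto_initial (hφ : IsCompactProcess φ C) {s t : ℝ} (hst : s < t) (x : H) :
    Tendsto (fun r => φ t r x) (𝓝[>] s) (𝓝 (φ t s x)) := by
  rw [tendsto_iff_norm_sub_tendsto_zero]
  have h1 : Tendsto (fun r => Real.exp (C * (t - r)) * ‖x - φ r s x‖) (𝓝[>] s)
      (𝓝 (Real.exp (C * (t - s)) * ‖x - x‖)) := by
    refine Tendsto.mul ?_ ((hφ.tendsto_right s x).const_sub x).norm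
    have : Continuous fun r => Real.exp (C * (t - r)) := by fun_prop
    exact (this.tendsto s).mono_left nhdsWithin_le_nhds
  rw [sub_self, norm_zero, mul_zero] at h1
  refine squeeze_zero' (Eventually.of_forall fun r => norm_nonneg _) ?_ h1
  filter_upwards [Ioo_mem_nhdsGT hst] with r hr
  rw [hφ.comp s r t x hr.1.le hr.2.le]
  exact hφ.norm_sub_le r t _ _ hr.2.le

/-- Asymptotic compactness. -/
lemma IsCompactProcess.exists_subseq_tendsto (hφ : IsCompactProcess φ C)
    (hE : IsPullbackBounded φ E) (t : ℝ) {s : ℕ → ℝ} {x : ℕ → H} (hs : Tendsto s atTop atBot)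
    (hx : ∀ n, x n ∈ E (s n)) :
    ∃ ψ : ℕ → ℕ, StrictMono ψ ∧ ∃ y ∈ pullbackLimitSet φ E t,
      Tendsto (fun n => φ t (s (ψ n)) (x (ψ n))) atTop (𝓝 y) := by
  -- the images are bounded at time `t - 1`, and the map from time `t - 1` to `t` is compact
  obtain ⟨R, hR⟩ := hE (t - 1)
  obtain ⟨n₀, hn₀⟩ := eventually_atTop.1
    (hs.eventually (hR.and (eventually_le_atBot (t - 1))))
  obtain ⟨ψ, hψ, y, hy⟩ := hφ.exists_subseq (t - 1) t (by linarith)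
    (fun n => φ (t - 1) (s (n + n₀)) (x (n + n₀))) R
    fun n => (hn₀ _ (Nat.le_add_left _ _)).1 _ (hx _)
  have hψ' : StrictMono fun n => ψ n + n₀ := fun a b hab => by simpa using hψ hab
  have hlim : Tendsto (fun n => φ t (s (ψ n + n₀)) (x (ψ n + n₀))) atTop (𝓝 y) :=
    hy.congr fun n =>
      (hφ.comp _ _ _ _ (hn₀ (ψ n + n₀) (Nat.le_add_left _ _)).2 (by linarith)).symm
  exact ⟨_, hψ', y, ⟨_, _, hs.comp hψ'.tendsto_atTop, fun n => hx _, hlim⟩, hlim⟩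

lemma IsCompactProcess.nonempty_pullbackLimitSet (hφ : IsCompactProcess φ C)
    (hE : IsPullbackBounded φ E) (hne : ∀ s, (E s).Nonempty) (t : ℝ) :
    (pullbackLimitSet φ E t).Nonempty := by
  choose x hx using hne
  obtain ⟨-, -, y, hy, -⟩ := hφ.exists_subseq_tendsto hE t (s := fun n : ℕ => -(n : ℝ))
    (tendsto_neg_atTop_atBot.comp tendsto_natCast_atTop_atTop) fun n => hx _
  exact ⟨y, hy⟩

lemma IsCompactProcess.isCompact_pullbackLimitSet (hφ : IsCompactProcess φ C)
    (hE : IsPullbackBounded φ E) (t : ℝ) : IsCompact (pullbackLimitSet φ E t) := by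
  refine IsSeqCompact.isCompact fun y hy => ?_
  -- points of the limit set are approximated by values of the process, which are asymptotically
  -- compact
  have h1 : ∀ n : ℕ, ∃ s ≤ -(n : ℝ), ∃ x ∈ E s, dist (φ t s x) (y n) < 1 / ((n : ℝ) + 1) := by
    intro n
    obtain ⟨s, x, hs, hx, hlim⟩ := hy n
    obtain ⟨m, h2, h3⟩ := ((hs.eventually (eventually_le_atBot (-(n : ℝ)))).and
      (Metric.tendsto_nhds.1 hlim (1 / ((n : ℝ) + 1)) (by positivity))).exists
    exact ⟨s m, h2, x m, hx m, h3⟩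
  choose s hs x hx hd using h1
  obtain ⟨ψ, hψ, z, hz, hlim⟩ := hφ.exists_subseq_tendsto hE t (tendsto_atBot_mono hs
    (tendsto_neg_atTop_atBot.comp tendsto_natCast_atTop_atTop)) hx
  refine ⟨z, hz, ψ, hψ, ?_⟩
  refine hlim.congr_dist ?_
  refine squeeze_zero (fun _ => dist_nonneg) (fun n => (hd (ψ n)).le) ?_
  exact tendsto_one_div_add_atTop_nhds_zero_nat.comp hψ.tendsto_atTop

lemma IsCompactProcess.image_pullbackLimitSet (hφ : IsCompactProcess φ C)
    (hE : IsPullbackBounded φ E) {s t : ℝ} (hst : s ≤ t) :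
    φ t s '' pullbackLimitSet φ E s = pullbackLimitSet φ E t := by
  apply Subset.antisymm
  · rintro _ ⟨y, ⟨r, x, hr, hx, hy⟩, rfl⟩
    refine ⟨r, x, hr, hx, ?_⟩
    refine (((hφ.continuous hst).tendsto y).comp hy).congr' ?_
    filter_upwards [hr.eventually (eventually_le_atBot s)] with n hn
    exact (hφ.comp _ _ _ _ hn hst).symm
  · rintro y ⟨r, x, hr, hx, hy⟩
    obtain ⟨ψ, hψ, z, hz, hlim⟩ := hφ.exists_subseq_tendsto hE s hr hx
    refine ⟨z, hz, tendsto_nhds_unique (((hφ.continuous hst).tendsto z).comp hlim)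
      ((hy.comp hψ.tendsto_atTop).congr' ?_)⟩
    filter_upwards [(hr.comp hψ.tendsto_atTop).eventually (eventually_le_atBot s)] with n hn
    exact hφ.comp _ _ _ _ hn hst

lemma IsCompactProcess.tendsto_semiDist (hφ : IsCompactProcess φ C)
    (hE : IsPullbackBounded φ E) (t : ℝ) :
    Tendsto (fun s => semiDist (φ t s '' E s) (pullbackLimitSet φ E t)) atBot (𝓝 0) := by
  refine ENNReal.tendsto_nhds_zero.2 fun ε hε => ?_
  by_contra hcon
  simp only [not_eventually, not_le] at hcon
  obtain ⟨s, hs, hsε⟩ := exists_seq_forall_of_frequently hcon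
  have h1 : ∀ n, ∃ x ∈ E (s n), ε < Metric.infEDist (φ t (s n) x) (pullbackLimitSet φ E t) := by
    intro n
    obtain ⟨b, hb⟩ := lt_iSup_iff.1 (hsε n)
    obtain ⟨⟨x, hx, rfl⟩, hb⟩ := lt_iSup_iff.1 hb
    exact ⟨x, hx, hb⟩
  choose x hx hxε using h1
  obtain ⟨ψ, hψ, y, hy, hlim⟩ := hφ.exists_subseq_tendsto hE t hs hx
  have h2 := ((Metric.continuous_infEDist (s := pullbackLimitSet φ E t)).tendsto y).comp hlim
  rw [Metric.infEDist_zero_of_mem hy] at h2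
  obtain ⟨n, hn⟩ := (h2.eventually (gt_mem_nhds hε)).exists
  exact absurd hn (not_lt.2 (hxε _).le)

/-- The distance to a pullback limit set, as a lower limit of distances to images. -/
lemma IsCompactProcess.infEDist_pullbackLimitSet (hφ : IsCompactProcess φ C)
    (hE : IsPullbackBounded φ E) (t : ℝ) (x : H) :
    Metric.infEDist x (pullbackLimitSet φ E t) =
      liminf (fun s => Metric.infEDist x (φ t s '' E s)) atBot := by
  apply le_antisymm
  · refine le_of_forall_gt_imp_ge_of_dense fun a ha => ?_
    obtain ⟨s, hs, hsa⟩ := exists_seq_forall_of_frequently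
      (frequently_lt_of_liminf_lt (by isBoundedDefault) ha)
    have h1 : ∀ n, ∃ z ∈ E (s n), edist x (φ t (s n) z) < a := by
      intro n
      obtain ⟨_, ⟨z, hz, rfl⟩, h⟩ := Metric.infEDist_lt_iff.1 (hsa n)
      exact ⟨z, hz, h⟩
    choose z hz hza using h1
    obtain ⟨ψ, hψ, y, hy, hlim⟩ := hφ.exists_subseq_tendsto hE t hs hz
    refine (Metric.infEDist_le_edist_of_mem hy).trans ?_
    exact le_of_tendsto (tendsto_const_nhds.edist hlim)
      (Eventually.of_forall fun n => (hza (ψ n)).le)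
  · refine Metric.le_infEDist.2 fun y hy => ?_
    obtain ⟨s, z, hs, hz, hlim⟩ := hy
    calc liminf (fun s => Metric.infEDist x (φ t s '' E s)) atBot
        ≤ liminf (fun s => Metric.infEDist x (φ t s '' E s)) (map s atTop) :=
          liminf_le_liminf_of_le hs
      _ = liminf (fun n => Metric.infEDist x (φ t (s n) '' E (s n))) atTop := rfl
      _ ≤ liminf (fun n => edist x (φ t (s n) (z n))) atTop :=
          liminf_le_liminf (Eventually.of_forall fun n =>
            Metric.infEDist_le_edist_of_mem (mem_image_of_mem _ (hz n)))
      _ = edist x y := (tendsto_const_nhds.edist hlim).liminf_eq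

/-- For a constant family, rational initial times suffice. -/
lemma IsCompactProcess.infEDist_pullbackLimitSet_const (hφ : IsCompactProcess φ C) {B : Set H}
    (hB : IsPullbackBounded φ fun _ => B) (t : ℝ) (x : H) :
    Metric.infEDist x (pullbackLimitSet φ (fun _ => B) t) =
      liminf (fun q : ℚ => Metric.infEDist x (φ t q '' B)) atBot := by
  rw [hφ.infEDist_pullbackLimitSet hB]
  have hcast : Tendsto (fun q : ℚ => (q : ℝ)) atBot atBot := tendsto_ratCast_atBot_iff.2 tendsto_id
  apply le_antisymm
  · exact liminf_le_liminf_of_le (u := fun s : ℝ => Metric.infEDist x (φ t s '' B)) hcast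
  · refine le_of_forall_lt fun a ha => ?_
    obtain ⟨a', haa', ha'⟩ := exists_between ha
    refine haa'.trans_le (le_liminf_of_le (by isBoundedDefault) ?_)
    obtain ⟨q₀, hq₀⟩ := eventually_atBot.1 (eventually_lt_of_lt_liminf ha')
    filter_upwards [eventually_lt_atBot (min (q₀ : ℝ) t)] with s hs
    have hs1 : s < q₀ := hs.trans_le (min_le_left _ _)
    have hs2 : s < t := hs.trans_le (min_le_right _ _)
    refine Metric.le_infEDist.2 ?_
    rintro _ ⟨y, hy, rfl⟩
    have hlim := (hφ.tendsto_initial hs2 y)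
    -- rational times decreasing to `s`
    have h1 : ∀ n : ℕ, ∃ q : ℚ, s < q ∧ (q : ℝ) < min (q₀ : ℝ) (s + 1 / ((n : ℝ) + 1)) := fun n =>
      exists_rat_btwn (lt_min hs1 (by
        have : 0 < 1 / ((n : ℝ) + 1) := by positivity
        linarith))
    choose q hq1 hq2 using h1
    have hq : Tendsto (fun n => (q n : ℝ)) atTop (𝓝[>] s) := by
      refine tendsto_nhdsWithin_iff.2 ⟨?_, Eventually.of_forall hq1⟩
      refine tendsto_of_tendsto_of_tendsto_of_le_of_le tendsto_const_nhds ?_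
        (fun n => (hq1 n).le) (fun n => ((hq2 n).trans_le (min_le_right _ _)).le)
      have := tendsto_one_div_add_atTop_nhds_zero_nat (𝕜 := ℝ)
      simpa using this.const_add s
    refine ge_of_tendsto (tendsto_const_nhds.edist (hlim.comp hq))
      (Eventually.of_forall fun n => ?_)
    have h2 : q n ≤ q₀ := by exact_mod_cast ((hq2 n).trans_le (min_le_left _ _)).le
    exact (hq₀ _ h2).le.trans (Metric.infEDist_le_edist_of_mem (mem_image_of_mem _ hy))

/-- The distance to an invariant set that attracts a family containing it. -/
lemma tendsto_infEDist_of_attracting {A : ℝ → Set H} {t : ℝ} (hne : (A t).Nonempty)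
    (hinv : ∀ᶠ s in atBot, φ t s '' A s = A t) (hsub : ∀ᶠ s in atBot, A s ⊆ E s)
    (hatt : Tendsto (fun s => semiDist (φ t s '' E s) (A t)) atBot (𝓝 0)) (x : H) :
    Tendsto (fun s => Metric.infEDist x (φ t s '' E s)) atBot (𝓝 (Metric.infEDist x (A t))) := by
  have h1 : Tendsto (fun s => Metric.infEDist x (A t) - semiDist (φ t s '' E s) (A t)) atBot
      (𝓝 (Metric.infEDist x (A t) - 0)) :=
    ENNReal.Tendsto.sub tendsto_const_nhds hatt (Or.inl (Metric.infEDist_ne_top hne))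
  rw [tsub_zero] at h1
  refine tendsto_of_tendsto_of_tendsto_of_le_of_le' h1 tendsto_const_nhds
    (Eventually.of_forall fun s => tsub_le_iff_right.2 (infEDist_le_infEDist_add_semiDist _ _ _)) ?_
  filter_upwards [hinv, hsub] with s h2 h3
  conv_rhs => rw [← h2]
  exact Metric.infEDist_anti (image_mono h3)

end Pullback

/-! ### Càdlàg paths -/

section Cadlag

lemma IsCadlag.exists_norm_le {E : Type*} [NormedAddCommGroup E] {g : ℝ → E} (hg : IsCadlag g)
    (a b : ℝ) : ∃ K, ∀ t ∈ Icc a b, ‖g t‖ ≤ K := by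
  refine isCompact_Icc.induction_on (p := fun s => ∃ K, ∀ t ∈ s, ‖g t‖ ≤ K) ⟨0, by simp⟩
    (fun s t hst ⟨K, hK⟩ => ⟨K, fun x hx => hK x (hst hx)⟩)
    (fun s t ⟨K, hK⟩ ⟨L, hL⟩ => ⟨max K L, fun x hx => hx.elim
      (fun h => (hK x h).trans (le_max_left _ _)) fun h => (hL x h).trans (le_max_right _ _)⟩)
    fun t _ => ?_
  obtain ⟨h1, l, h2⟩ := hg t
  have e1 := h1.norm.eventually (gt_mem_nhds (show ‖g t‖ < ‖g t‖ + 1 by linarith))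
  have e2 := h2.norm.eventually (gt_mem_nhds (show ‖l‖ < ‖l‖ + 1 by linarith))
  refine ⟨{x | ‖g x‖ ≤ max (‖g t‖ + 1) (‖l‖ + 1)}, mem_nhdsWithin_of_mem_nhds ?_,
    _, fun x hx => hx⟩
  rw [← nhdsLT_sup_nhdsGE]
  refine mem_sup.2 ⟨?_, ?_⟩
  · filter_upwards [e2] with x hx using hx.le.trans (le_max_right _ _)
  · filter_upwards [e1] with x hx using hx.le.trans (le_max_left _ _)

/-- A right-continuous process is jointly measurable. -/
lemma measurable_of_rightContinuous {Ω E : Type*} [MeasurableSpace Ω] [TopologicalSpace E]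
    [TopologicalSpace.PseudoMetrizableSpace E] [MeasurableSpace E] [BorelSpace E] {N : ℝ → Ω → E}
    (hN : ∀ t, Measurable (N t)) (hc : ∀ ω t, ContinuousWithinAt (fun r => N r ω) (Ici t) t) :
    Measurable fun p : Ω × ℝ => N p.2 p.1 := by
  -- `r n (j n t)` is the first point after `t` of the grid of mesh `1 / (n + 1)`
  let r : ℕ → ℤ → ℝ := fun n j => (j + 1) / ((n : ℝ) + 1)
  let j : ℕ → ℝ → ℤ := fun n t => ⌊t * ((n : ℝ) + 1)⌋
  refine measurable_of_tendsto_metrizable (f := fun n (p : Ω × ℝ) => N (r n (j n p.2)) p.1)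
    (fun n => ?_) (tendsto_pi_nhds.2 fun p => ?_)
  · have h1 : Measurable fun q : Ω × ℤ => N (r n q.2) q.1 :=
      measurable_from_prod_countable_left fun j => hN (r n j)
    exact h1.comp (measurable_fst.prodMk
      ((Int.measurable_floor.comp (measurable_id.mul_const _)).comp measurable_snd))
  · have h1 : ∀ n, p.2 ≤ r n (j n p.2) ∧ r n (j n p.2) ≤ p.2 + 1 / ((n : ℝ) + 1) := fun n => by
      have h0 : (0 : ℝ) < n + 1 := by positivity
      have h2 := Int.floor_le (p.2 * ((n : ℝ) + 1))
      have h3 := Int.lt_floor_add_one (p.2 * ((n : ℝ) + 1))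
      constructor
      · rw [le_div_iff₀ h0]
        exact h3.le
      · rw [div_le_iff₀ h0, add_mul, one_div, inv_mul_cancel₀ h0.ne']
        simp only [j]
        linarith
    have h2 : Tendsto (fun n => r n (j n p.2)) atTop (𝓝[≥] p.2) := by
      refine tendsto_nhdsWithin_iff.2 ⟨?_, Eventually.of_forall fun n => (h1 n).1⟩
      refine tendsto_of_tendsto_of_tendsto_of_le_of_le tendsto_const_nhds ?_
        (fun n => (h1 n).1) (fun n => (h1 n).2)
      simpa using tendsto_one_div_add_atTop_nhds_zero_nat (𝕜 := ℝ) |>.const_add p.2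
    exact (hc p.1 p.2).tendsto.comp h2

end Cadlag

/-! ### The drift along a path of the noise -/

section Shift

variable {V : Type*} [NormedAddCommGroup V] [NormedSpace ℝ V]
  {H : Type*} [NormedAddCommGroup H] [InnerProductSpace ℝ H] {ι : V →L[ℝ] H}

lemma exists_young {α : ℝ} (hα : 1 < α) {δ : ℝ} (hδ : 0 < δ) :
    ∃ K, 0 ≤ K ∧ ∀ x y : ℝ, 0 ≤ x → 0 ≤ y → 2 * (x * y) ≤ δ * x ^ (α / (α - 1)) + K * y ^ α := by
  have hpq : (α / (α - 1)).HolderConjugate α := (Real.HolderConjugate.conjExponent hα).symm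
  set q := α / (α - 1) with hq
  set η := (δ / 2) ^ q⁻¹ with hη
  have hη0 : 0 < η := by positivity
  refine ⟨2 * η⁻¹ ^ α, by positivity, fun x y hx hy => ?_⟩
  have h1 := Real.young_inequality_of_nonneg (a := η * x) (b := η⁻¹ * y) (by positivity)
    (by positivity) hpq
  have e1 : η * x * (η⁻¹ * y) = x * y := by field_simp
  have e2 : (η * x) ^ q = δ / 2 * x ^ q := by
    rw [Real.mul_rpow hη0.le hx, hη, ← Real.rpow_mul (by positivity),
      inv_mul_cancel₀ hpq.pos.ne', Real.rpow_one]
  rw [e1, e2, Real.mul_rpow (by positivity) hy] at h1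
  have h2 : δ / 2 * x ^ q / q ≤ δ / 2 * x ^ q := div_le_self (by positivity) hpq.lt.le
  have h3 : η⁻¹ ^ α * y ^ α / α ≤ η⁻¹ ^ α * y ^ α := div_le_self (by positivity) hα.le
  linarith

lemma norm_add_rpow_le {E : Type*} [NormedAddCommGroup E] {α : ℝ} (hα : 0 ≤ α) (v w : E) :
    ‖v + w‖ ^ α ≤ 2 ^ α * (‖v‖ ^ α + ‖w‖ ^ α) := by
  have h1 : ‖v + w‖ ≤ 2 * max ‖v‖ ‖w‖ := (norm_add_le v w).trans (by
    linarith [le_max_left ‖v‖ ‖w‖, le_max_right ‖v‖ ‖w‖])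
  calc ‖v + w‖ ^ α ≤ (2 * max ‖v‖ ‖w‖) ^ α := by gcongr
    _ = 2 ^ α * (max ‖v‖ ‖w‖) ^ α :=
        Real.mul_rpow (by norm_num) (le_max_of_le_left (norm_nonneg v))
    _ ≤ 2 ^ α * (‖v‖ ^ α + ‖w‖ ^ α) := by
        gcongr
        have h2 : 0 ≤ ‖v‖ ^ α := by positivity
        have h3 : 0 ≤ ‖w‖ ^ α := by positivity
        rcases max_choice ‖v‖ ‖w‖ with h | h <;> rw [h] <;> linarith

variable {Ω : Type*} [MeasurableSpace V] {A : ℝ → V → Ω → StrongDual ℝ V} {α : ℝ}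
  {C₁ C₂ c f : ℝ → Ω → ℝ}

/-- Along a fixed path of the noise, the drift of the random equation for `X - N` is monotone,
coercive and of growth `α`. -/
lemma DriftAssumptions.exists_isMonotoneDrift [BorelSpace V] [SecondCountableTopology V]
    (hA : DriftAssumptions ι A α C₁ C₂ c f) (hα : 1 < α) (hC₁ : ∀ t ω, C₁ t ω = 0)
    (hC₂ : ∀ s t ω, C₂ s ω = C₂ t ω) (hc : ∀ s t ω, c s ω = c t ω) {ω : Ω}
    (hf : IsCadlag fun t => f t ω) {n : ℝ → V} (hn : IsCadlag n) (hnm : Measurable n) :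
    ∃ C c' K, 0 ≤ K ∧ IsMonotoneDrift ι α (fun t v => A t (v + n t) ω) C c'
      (fun t => 2 * f t ω + K * ‖n t‖ ^ α) := by
  have hα0 : 0 < α := by linarith
  have hα1 : 0 < α - 1 := by linarith
  have hq0 : 0 < α / (α - 1) := by positivity
  set c₀ := c 0 ω with hc₀
  have hc₀0 : 0 < c₀ := hA.c_pos 0 ω
  set D := max (C₂ 0 ω) 0 with hD
  have hD0 : 0 ≤ D := le_max_right _ _
  have hgrowth : ∀ v t, ‖A t v ω‖ ^ (α / (α - 1)) ≤ D * ‖v‖ ^ α + f t ω := fun v t => by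
    have h1 := hA.growth v t ω
    rw [hC₁, zero_mul, zero_add, hC₂ t 0] at h1
    have : C₂ 0 ω * ‖v‖ ^ α ≤ D * ‖v‖ ^ α := by
      gcongr
      exact le_max_left _ _
    linarith
  -- the growth condition at `v = 0` forces `f` to be nonnegative
  have hf0 : ∀ t, 0 ≤ f t ω := fun t => by
    have h1 := hgrowth 0 t
    rw [norm_zero, Real.zero_rpow hα0.ne', mul_zero, zero_add] at h1
    exact le_trans (by positivity) h1
  have hcoer : ∀ v t, 2 * A t v ω v ≤ -c₀ * ‖v‖ ^ α + f t ω := fun v t => by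
    have h1 := hA.coercivity v t ω
    rw [hC₁, hc t 0] at h1
    linarith
  -- a weight in Young's inequality, by which the pairing of the drift with the noise costs at most
  -- half of the coercivity
  set δ := min 1 (c₀ / (2 * (D + 1))) with hδ
  have hδ0 : 0 < δ := by positivity
  have hδD : δ * D ≤ c₀ / 2 := by
    have h1 : δ ≤ c₀ / (2 * (D + 1)) := min_le_right _ _
    calc δ * D ≤ c₀ / (2 * (D + 1)) * D := by gcongr
      _ ≤ c₀ / 2 := by
        rw [div_mul_eq_mul_div, div_le_div_iff₀ (by positivity) (by norm_num)]
        nlinarith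
  obtain ⟨K, hK, hyoung⟩ := exists_young hα hδ0
  have h2α : (0 : ℝ) < 2 ^ α := by positivity
  refine ⟨D * 2 ^ α, c₀ / 2 / 2 ^ α, K + c₀ / 2 + D * 2 ^ α, by positivity,
    { measurable := ?_, C_nonneg := by positivity, c_pos := by positivity, exists_bound := ?_,
      hemicontinuity := ?_, monotonicity := ?_, coercivity := ?_, growth := ?_ }⟩
  · exact (hA.measurable ω).comp
      (measurable_fst.prodMk (measurable_snd.add (hnm.comp measurable_fst)))
  · intro a b
    obtain ⟨K₁, hK₁⟩ := hf.exists_norm_le a b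
    obtain ⟨K₂, hK₂⟩ := hn.exists_norm_le a b
    refine ⟨2 * |K₁| + (K + c₀ / 2 + D * 2 ^ α) * |K₂| ^ α, by positivity, fun t ht => ?_⟩
    have h1 : f t ω ≤ |K₁| := ((le_abs_self _).trans (hK₁ t ht)).trans (le_abs_self _)
    have h2 : ‖n t‖ ≤ |K₂| := (hK₂ t ht).trans (le_abs_self _)
    gcongr
  · intro t v₁ v₂ v
    have h1 := hA.hemicontinuity v (v₁ + n t) v₂ t ω
    simpa only [add_right_comm] using h1
  · intro t v₁ v₂
    have h1 := hA.monotonicity (v₁ + n t) (v₂ + n t) t ω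
    rw [add_sub_add_right_eq_sub] at h1
    refine h1.trans ?_
    gcongr
    rw [hC₂ t 0]
    refine (le_max_left _ 0).trans (le_mul_of_one_le_right hD0 ?_)
    exact Real.one_le_rpow (by norm_num) hα0.le
  · intro t v
    set w := v + n t with hw
    have e : A t w ω v = A t w ω w - A t w ω (n t) := by rw [← map_sub, hw, add_sub_cancel_right]
    have h1 := hcoer w t
    have h2 : -A t w ω (n t) ≤ ‖A t w ω‖ * ‖n t‖ :=
      (neg_le_abs _).trans ((A t w ω).le_opNorm (n t))
    have h3 := hyoung ‖A t w ω‖ ‖n t‖ (norm_nonneg _) (norm_nonneg _)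
    have h4 : δ * ‖A t w ω‖ ^ (α / (α - 1)) ≤ c₀ / 2 * ‖w‖ ^ α + f t ω := by
      calc δ * ‖A t w ω‖ ^ (α / (α - 1)) ≤ δ * (D * ‖w‖ ^ α + f t ω) := by
            gcongr
            exact hgrowth w t
        _ = δ * D * ‖w‖ ^ α + δ * f t ω := by ring
        _ ≤ c₀ / 2 * ‖w‖ ^ α + 1 * f t ω := by
            have := hf0 t
            gcongr
            exact min_le_left _ _
        _ = _ := by ring
    have h5 : c₀ / 2 / 2 ^ α * ‖v‖ ^ α ≤ c₀ / 2 * (‖w‖ ^ α + ‖n t‖ ^ α) := by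
      have h6 := norm_add_rpow_le hα0.le w (-n t)
      rw [norm_neg, hw, add_neg_cancel_right, ← hw] at h6
      calc c₀ / 2 / 2 ^ α * ‖v‖ ^ α ≤ c₀ / 2 / 2 ^ α * (2 ^ α * (‖w‖ ^ α + ‖n t‖ ^ α)) := by gcongr
        _ = _ := by field_simp
    have h7 : 0 ≤ D * 2 ^ α * ‖n t‖ ^ α := by positivity
    rw [e]
    linarith
  · intro t v
    have h1 := hgrowth (v + n t) t
    have h2 : D * ‖v + n t‖ ^ α ≤ D * (2 ^ α * (‖v‖ ^ α + ‖n t‖ ^ α)) := by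
      gcongr
      exact norm_add_rpow_le hα0.le _ _
    have h3 := hf0 t
    have h4 : 0 ≤ (K + c₀ / 2) * ‖n t‖ ^ α := by positivity
    linarith

end Shift

/-! ### Pullback absorption -/

lemma eventually_norm_map_le {V H : Type*} [NormedAddCommGroup V] [NormedSpace ℝ V]
    [NormedAddCommGroup H] [InnerProductSpace ℝ H] {n : ℝ → V} (ι : V →L[ℝ] H) {β : ℝ}
    (hn : n =o[atBot] fun t : ℝ => |t| ^ β) {ε : ℝ} (hε : 0 < ε) :
    ∀ᶠ t in atBot, ‖ι (n t)‖ ≤ ε * |t| ^ β := by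
  filter_upwards [hn.def (show 0 < ε / (‖ι‖ + 1) by positivity)] with t ht
  rw [Real.norm_of_nonneg (by positivity)] at ht
  refine (ι.le_opNorm _).trans ?_
  calc ‖ι‖ * ‖n t‖ ≤ (‖ι‖ + 1) * (ε / (‖ι‖ + 1) * |t| ^ β) := by
        gcongr
        linarith
    _ = _ := by field_simp

section Absorption

variable {V : Type*} [NormedAddCommGroup V] [NormedSpace ℝ V] [MeasurableSpace V] [BorelSpace V]
  [SecondCountableTopology (StrongDual ℝ V)]
  {H : Type*} [NormedAddCommGroup H] [InnerProductSpace ℝ H] {ι : V →L[ℝ] H}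

/-- The family of centred balls of radius `ε |t| ^ β`. -/
def growthBall (H : Type*) [NormedAddCommGroup H] (β ε t : ℝ) : Set H :=
  Metric.closedBall 0 (ε * |t| ^ β)

variable {α : ℝ} {B : ℝ → V → StrongDual ℝ V} {C c : ℝ} {g : ℝ → ℝ} {φ : ℝ → ℝ → H → H} {n : ℝ → V}

set_option maxHeartbeats 800000 in
/-- Balls of radius `ε |s| ^ β`, with `β = 1 / (2 - α)` and small `ε`, are mapped to bounded sets
from the remote past, and are absorbed there by balls of radius `ε' |t| ^ β` for every `ε'`. -/
theorem exists_absorption (hd : DenseRange ι) (hB : IsMonotoneDrift ι α B C c g) (hα : 1 < α)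
    (hα2 : α < 2)
    (hφ : ∀ s x, IsVariationalSolution ι α B s (x - ι (n s)) fun t => φ t s x - ι (n t))
    (hn : n =o[atBot] fun t : ℝ => |t| ^ (1 / (2 - α)))
    (hg : ∀ η > 0, ∀ᶠ t in atBot, g t ≤ η * |t| ^ (α * (1 / (2 - α)))) :
    ∃ ε > 0, IsPullbackBounded φ (growthBall H (1 / (2 - α)) ε) ∧
      ∀ ε' > 0, ∀ᶠ t in atBot, ∀ᶠ s in atBot, ∀ x ∈ growthBall H (1 / (2 - α)) ε s,
        φ t s x ∈ growthBall H (1 / (2 - α)) ε' t := by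
  have hα0 : 0 < α := by linarith
  have hc := hB.c_pos
  have h2α : 0 < 2 - α := by linarith
  have hcmp := fun {s x} (a κ t : ℝ) =>
    (hφ s x).norm_le_rpow hd hB hα hα2 (a := a) (κ := κ) (t := t)
  set β := 1 / (2 - α) with hβ
  have hβ0 : 0 < β := by positivity
  set c' := c / (‖ι‖ + 1) ^ α with hc'
  have hc'0 : 0 < c' := by positivity
  -- the largest rate of decay admitted by the comparison with supersolutions
  set κ := c' / (4 * β) with hκ
  have hκ0 : 0 < κ := by positivity
  have hκc : 4 * β * κ ≤ c' := by rw [hκ]; field_simp; rfl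
  -- initial values in the ball, shifted by the noise, then lie below a supersolution of rate `κ`
  set ε := (κ / 2) ^ β / 2 with hε
  have hε0 : 0 < ε := by positivity
  have hinit : ∀ᶠ s in atBot, ∀ x ∈ growthBall H β ε s, ‖x - ι (n s)‖ ≤ (κ / 2 * |s|) ^ β := by
    filter_upwards [eventually_norm_map_le ι hn hε0] with s hs x hx
    rw [growthBall, mem_closedBall_zero_iff] at hx
    refine (norm_sub_le _ _).trans ((add_le_add hx hs).trans (le_of_eq ?_))
    rw [Real.mul_rpow (by positivity) (abs_nonneg s), hε]
    ring
  have hgev : ∀ κ' > 0, ∀ᶠ t in atBot, g t ≤ c' / 2 * (κ' * |t|) ^ (α * β) := by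
    intro κ' hκ'
    filter_upwards [hg (c' / 2 * κ' ^ (α * β)) (by positivity)] with t ht
    rwa [Real.mul_rpow hκ'.le (abs_nonneg t), ← mul_assoc]
  refine ⟨ε, hε0, fun t => ?_, fun ε' hε' => ?_⟩
  · obtain ⟨T, hT⟩ := eventually_atBot.1 ((hgev κ hκ0).and (eventually_le_atBot 0))
    obtain ⟨K, hK, hgK⟩ := hB.exists_bound T t
    -- raising the supersolution by `b` makes it dominate the errors on `[T, t]`
    set b := (2 * K / c') ^ (α * β)⁻¹ with hb
    have hb0 : 0 ≤ b := by positivity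
    have hbK : K = c' / 2 * b ^ (α * β) := by
      rw [hb, ← Real.rpow_mul (by positivity), inv_mul_cancel₀ (by positivity), Real.rpow_one]
      field_simp
    set a := κ * |t| + b with ha
    refine ⟨(a - κ * t) ^ β + ‖ι (n t)‖, ?_⟩
    filter_upwards [hinit, eventually_le_atBot (min t 0)] with s hs hst x hx
    have hst' : s ≤ t := hst.trans (min_le_left _ _)
    have hs0 : s ≤ 0 := hst.trans (min_le_right _ _)
    have hκt : κ * t ≤ κ * |t| := by gcongr; exact le_abs_self t
    have h1 := hcmp (s := s) (x := x) a κ t hst' hκ0.le hκc (by linarith) (fun r hr => by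
      have hκr : κ * r ≤ κ * t := by
        have := hr.2
        gcongr
      rcases le_total r T with h | h
      · obtain ⟨h2, h3⟩ := hT r h
        refine h2.trans ?_
        rw [abs_of_nonpos h3]
        have h4 : 0 ≤ κ * -r := by nlinarith
        have h5 : 0 ≤ κ * |t| := by positivity
        gcongr
        linarith
      · refine (hgK r ⟨h, hr.2⟩).trans (hbK.le.trans ?_)
        gcongr
        linarith) ((hs x hx).trans (by
      have h4 : 0 ≤ κ * |t| := by positivity
      rw [abs_of_nonpos hs0]
      have h5 : 0 ≤ κ / 2 * -s := mul_nonneg (by positivity) (by linarith)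
      gcongr
      linarith))
    calc ‖φ t s x‖ = ‖(φ t s x - ι (n t)) + ι (n t)‖ := by rw [sub_add_cancel]
      _ ≤ _ := (norm_add_le _ _).trans (by gcongr)
  -- a supersolution of rate `κ'` stays in half of the target ball; the other half is for the noise
  · obtain ⟨κ', hκ'0, hκ'1, hκ'ε⟩ : ∃ κ' > 0, κ' ≤ κ / 2 ∧ κ' ^ β ≤ ε' / 2 := by
      refine ⟨min (κ / 2) ((ε' / 2) ^ β⁻¹), by positivity, min_le_left _ _, ?_⟩
      calc (min (κ / 2) ((ε' / 2) ^ β⁻¹)) ^ β ≤ ((ε' / 2) ^ β⁻¹) ^ β := by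
            gcongr
            exact min_le_right _ _
        _ = ε' / 2 := by
            rw [← Real.rpow_mul (by positivity), inv_mul_cancel₀ hβ0.ne', Real.rpow_one]
    obtain ⟨T, hT⟩ := eventually_atBot.1 (hgev κ' hκ'0)
    filter_upwards [eventually_le_atBot (min T 0),
      eventually_norm_map_le ι hn (show 0 < ε' / 2 by positivity)] with t ht htn
    have htT : t ≤ T := ht.trans (min_le_left _ _)
    have ht0 : t ≤ 0 := ht.trans (min_le_right _ _)
    filter_upwards [hinit, eventually_le_atBot (2 * t)] with s hs hst x hx
    have hs0 : s ≤ 0 := by linarith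
    -- the time at which the supersolution `(κ / 2 * s - κ * r) ^ β` meets `(-κ' * r) ^ β`
    set τ := κ * s / (2 * (κ - κ')) with hτ
    have hκκ' : 0 < κ - κ' := by linarith
    have hτe : κ / 2 * s - κ * τ = 0 - κ' * τ := by
      rw [hτ]
      field_simp
      ring
    have hsτ : s ≤ τ := by
      rw [hτ, le_div_iff₀ (by positivity)]
      nlinarith
    have hτt : τ ≤ t := by
      rw [hτ, div_le_iff₀ (by positivity)]
      nlinarith
    have h1 := hcmp (s := s) (x := x) (κ / 2 * s) κ τ hsτ hκ0.le hκc
      (by rw [hτe]; nlinarith) (fun r hr => by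
        refine (hT r ((hr.2.trans hτt).trans htT)).trans ?_
        rw [abs_of_nonpos ((hr.2.trans hτt).trans ht0)]
        have h2 : 0 ≤ κ' * -r := by nlinarith [(hr.2.trans hτt).trans ht0]
        gcongr
        nlinarith [hr.2]) ((hs x hx).trans (by
        rw [abs_of_nonpos hs0]
        have h5 : 0 ≤ κ / 2 * -s := mul_nonneg (by positivity) (by linarith)
        gcongr
        linarith))
    rw [hτe] at h1
    have h2 := ((hφ s x).restart hsτ).norm_le_rpow hd hB hα hα2 (a := 0) (κ := κ') hτt hκ'0.le
      (by nlinarith) (by nlinarith) (fun r hr => by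
        refine (hT r (hr.2.trans htT)).trans (le_of_eq ?_)
        rw [abs_of_nonpos (hr.2.trans ht0), mul_neg, zero_sub]) h1
    rw [growthBall, mem_closedBall_zero_iff]
    calc ‖φ t s x‖ = ‖(φ t s x - ι (n t)) + ι (n t)‖ := by rw [sub_add_cancel]
      _ ≤ (0 - κ' * t) ^ β + ε' / 2 * |t| ^ β := (norm_add_le _ _).trans (add_le_add h2 htn)
      _ = κ' ^ β * |t| ^ β + ε' / 2 * |t| ^ β := by
          rw [← Real.mul_rpow hκ'0.le (abs_nonneg t), abs_of_nonpos ht0, mul_neg, zero_sub]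
      _ ≤ ε' / 2 * |t| ^ β + ε' / 2 * |t| ^ β := by gcongr
      _ = ε' * |t| ^ β := by ring

end Absorption

/-! ### Attractors of processes with pullback absorption -/

section Attractor

variable {H : Type*} [NormedAddCommGroup H] {φ : ℝ → ℝ → H → H} {C β ε : ℝ}

lemma eventually_subset_growthBall {D : ℝ → Set H} (hε : 0 < ε)
    (hD : Tendsto (fun t : ℝ => setNorm (D t) / ENNReal.ofReal (|t| ^ β)) atBot (𝓝 0)) :
    ∀ᶠ t in atBot, D t ⊆ growthBall H β ε t := by
  filter_upwards [ENNReal.tendsto_nhds_zero.1 hD (ENNReal.ofReal ε) (by simpa using hε),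
    eventually_lt_atBot 0] with t ht ht0 b hb
  have hpos : 0 < |t| ^ β := Real.rpow_pos_of_pos (abs_pos.2 ht0.ne) β
  rw [ENNReal.div_le_iff (by simpa using hpos) ENNReal.ofReal_ne_top,
    ← ENNReal.ofReal_mul hε.le] at ht
  have h1 : ‖b‖ₑ ≤ ENNReal.ofReal (ε * |t| ^ β) :=
    (le_iSup₂ (f := fun b (_ : b ∈ D t) => ‖b‖ₑ) b hb).trans ht
  rw [← ofReal_norm, ENNReal.ofReal_le_ofReal_iff (by positivity)] at h1
  simpa [growthBall] using h1

lemma tendsto_setNorm_div {D : ℝ → Set H}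
    (hD : ∀ ε > 0, ∀ᶠ t in atBot, D t ⊆ growthBall H β ε t) :
    Tendsto (fun t : ℝ => setNorm (D t) / ENNReal.ofReal (|t| ^ β)) atBot (𝓝 0) := by
  refine ENNReal.tendsto_nhds_zero.2 fun δ hδ => ?_
  obtain ⟨ε, hε, hεδ⟩ : ∃ ε : ℝ, 0 < ε ∧ ENNReal.ofReal ε ≤ δ := by
    obtain ⟨r, hr0, hr⟩ := ENNReal.lt_iff_exists_nnreal_btwn.1 hδ
    exact ⟨r, by exact_mod_cast hr0, by rw [ENNReal.ofReal_coe_nnreal]; exact hr.le⟩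
  filter_upwards [hD ε hε] with t ht
  refine (ENNReal.div_le_of_le_mul ?_).trans hεδ
  rw [← ENNReal.ofReal_mul hε.le]
  refine iSup₂_le fun b hb => ?_
  rw [← ofReal_norm]
  refine ENNReal.ofReal_le_ofReal ?_
  simpa [growthBall] using ht hb

lemma growthBall_mono {ε ε' : ℝ} (h : ε ≤ ε') (t : ℝ) : growthBall H β ε t ⊆ growthBall H β ε' t :=
  Metric.closedBall_subset_closedBall (by gcongr)

lemma nonempty_growthBall (hε : 0 ≤ ε) (t : ℝ) : (growthBall H β ε t).Nonempty :=
  ⟨0, by simp only [growthBall, Metric.mem_closedBall, dist_self]; positivity⟩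

/-- Absorption passes to the pullback limit set. -/
lemma pullbackLimitSet_subset_growthBall {E : ℝ → Set H} {ε' t : ℝ}
    (h : ∀ᶠ s in atBot, ∀ x ∈ E s, φ t s x ∈ growthBall H β ε' t) :
    pullbackLimitSet φ E t ⊆ growthBall H β ε' t := by
  rintro y ⟨s, x, hs, hx, hy⟩
  refine Metric.isClosed_closedBall.mem_of_tendsto hy ?_
  filter_upwards [hs.eventually h] with n hn using hn _ (hx n)

lemma eventually_subset_growthBall_of_isBounded (hβ : 0 < β) (hε : 0 < ε) {B : Set H}
    (hB : Bornology.IsBounded B) : ∀ᶠ t in atBot, B ⊆ growthBall H β ε t := by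
  obtain ⟨R, hR⟩ := hB.subset_closedBall 0
  have h1 : Tendsto (fun t : ℝ => ε * |t| ^ β) atBot atTop :=
    ((tendsto_rpow_atTop hβ).comp tendsto_abs_atBot_atTop).const_mul_atTop hε
  filter_upwards [h1.eventually (eventually_ge_atTop R)] with t ht
  exact hR.trans (Metric.closedBall_subset_closedBall ht)

/-- The distance to the attractor for families of growth `o(|t| ^ β)`, in a form independent of
the absorption rate. -/
lemma IsCompactProcess.infEDist_pullbackLimitSet_growthBall (hφ : IsCompactProcess φ C) (hε : 0 < ε)
    (hE : IsPullbackBounded φ (growthBall H β ε))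
    (habs : ∀ ε' > 0, ∀ᶠ t in atBot, ∀ᶠ s in atBot, ∀ x ∈ growthBall H β ε s,
      φ t s x ∈ growthBall H β ε' t) (t : ℝ) (x : H) :
    Metric.infEDist x (pullbackLimitSet φ (growthBall H β ε) t) =
      liminf (fun m : ℕ => liminf (fun k : ℕ =>
        Metric.infEDist x (φ t (-k) '' growthBall H β (1 / ((m : ℝ) + 1)) (-k))) atTop) atTop := by
  -- the inner lower limit equals the distance as soon as `1 / (m + 1) ≤ ε`
  have h1 : ∀ᶠ m : ℕ in atTop, 1 / ((m : ℝ) + 1) ≤ ε :=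
    (tendsto_one_div_add_atTop_nhds_zero_nat (𝕜 := ℝ)).eventually (ge_mem_nhds hε)
  have h2 : ∀ᶠ m : ℕ in atTop, liminf (fun k : ℕ =>
      Metric.infEDist x (φ t (-k) '' growthBall H β (1 / ((m : ℝ) + 1)) (-k))) atTop =
      Metric.infEDist x (pullbackLimitSet φ (growthBall H β ε) t) := by
    filter_upwards [h1] with m hm
    have h3 : Tendsto (fun s => semiDist (φ t s '' growthBall H β (1 / ((m : ℝ) + 1)) s)
        (pullbackLimitSet φ (growthBall H β ε) t)) atBot (𝓝 0) :=
      tendsto_of_tendsto_of_tendsto_of_le_of_le tendsto_const_nhds (hφ.tendsto_semiDist hE t)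
        (fun s => zero_le) fun s => semiDist_mono (image_mono (growthBall_mono hm s)) le_rfl
    have h4 := tendsto_infEDist_of_attracting
      (hφ.nonempty_pullbackLimitSet hE (nonempty_growthBall hε.le) t)
      (by
        filter_upwards [eventually_le_atBot t] with s hs using hφ.image_pullbackLimitSet hE hs)
      (by
        filter_upwards [habs (1 / ((m : ℝ) + 1)) (by positivity)] with s hs
        exact pullbackLimitSet_subset_growthBall hs) h3 x
    exact (h4.comp (tendsto_neg_atTop_atBot.comp tendsto_natCast_atTop_atTop)).liminf_eq
  rw [liminf_congr h2, liminf_const]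

/-- The closure of the union of the pullback limit sets of all centred balls. -/
def boundedLimitSet (φ : ℝ → ℝ → H → H) (t : ℝ) : Set H :=
  closure (⋃ k : ℕ, pullbackLimitSet φ (fun _ => Metric.closedBall 0 k) t)

lemma IsCompactProcess.boundedLimitSet_subset (hφ : IsCompactProcess φ C) (hβ : 0 < β) (hε : 0 < ε)
    (hE : IsPullbackBounded φ (growthBall H β ε)) (t : ℝ) :
    boundedLimitSet φ t ⊆ pullbackLimitSet φ (growthBall H β ε) t :=
  closure_minimal (iUnion_subset fun _ => pullbackLimitSet_mono φ
    (eventually_subset_growthBall_of_isBounded hβ hε Metric.isBounded_closedBall) t)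
    (hφ.isCompact_pullbackLimitSet hE t).isClosed

lemma IsCompactProcess.isCompact_boundedLimitSet (hφ : IsCompactProcess φ C) (hβ : 0 < β)
    (hε : 0 < ε) (hE : IsPullbackBounded φ (growthBall H β ε)) (t : ℝ) :
    IsCompact (boundedLimitSet φ t) :=
  (hφ.isCompact_pullbackLimitSet hE t).of_isClosed_subset isClosed_closure
    (hφ.boundedLimitSet_subset hβ hε hE t)

lemma isPullbackBounded_closedBall (hβ : 0 < β)
    (hε : 0 < ε) (hE : IsPullbackBounded φ (growthBall H β ε)) (R : ℝ) :
    IsPullbackBounded φ fun _ => Metric.closedBall 0 R :=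
  hE.mono (eventually_subset_growthBall_of_isBounded hβ hε Metric.isBounded_closedBall)

lemma IsCompactProcess.nonempty_boundedLimitSet (hφ : IsCompactProcess φ C) (hβ : 0 < β)
    (hε : 0 < ε) (hE : IsPullbackBounded φ (growthBall H β ε)) (t : ℝ) :
    (boundedLimitSet φ t).Nonempty := by
  obtain ⟨y, hy⟩ := hφ.nonempty_pullbackLimitSet
    (isPullbackBounded_closedBall hβ hε hE ((0 : ℕ) : ℝ)) (fun _ => ⟨0, by simp⟩) t
  exact ⟨y, subset_closure (mem_iUnion.2 ⟨0, hy⟩)⟩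

lemma IsCompactProcess.image_boundedLimitSet (hφ : IsCompactProcess φ C) (hβ : 0 < β)
    (hε : 0 < ε) (hE : IsPullbackBounded φ (growthBall H β ε)) {s t : ℝ} (hst : s ≤ t) :
    φ t s '' boundedLimitSet φ s = boundedLimitSet φ t := by
  have h1 : φ t s '' (⋃ k : ℕ, pullbackLimitSet φ (fun _ => Metric.closedBall 0 k) s) =
      ⋃ k : ℕ, pullbackLimitSet φ (fun _ => Metric.closedBall 0 k) t := by
    rw [image_iUnion]
    exact iUnion_congr fun k =>
      hφ.image_pullbackLimitSet (isPullbackBounded_closedBall hβ hε hE k) hst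
  apply Subset.antisymm
  · refine (image_closure_subset_closure_image (hφ.continuous hst)).trans ?_
    rw [h1]
    exact subset_rfl
  · refine closure_minimal ?_
      ((hφ.isCompact_boundedLimitSet hβ hε hE s).image (hφ.continuous hst)).isClosed
    rw [← h1]
    exact image_mono subset_closure

lemma IsCompactProcess.tendsto_semiDist_boundedLimitSet (hφ : IsCompactProcess φ C) (hβ : 0 < β)
    (hε : 0 < ε) (hE : IsPullbackBounded φ (growthBall H β ε)) {B : Set H}
    (hB : Bornology.IsBounded B) (t : ℝ) :
    Tendsto (fun s => semiDist (φ t s '' B) (boundedLimitSet φ t)) atBot (𝓝 0) := by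
  obtain ⟨R, hR⟩ := hB.subset_closedBall 0
  obtain ⟨k, hk⟩ := exists_nat_ge R
  refine tendsto_of_tendsto_of_tendsto_of_le_of_le tendsto_const_nhds
    (hφ.tendsto_semiDist (isPullbackBounded_closedBall hβ hε hE k) t)
    (fun s => zero_le) fun s => ?_
  refine semiDist_mono (image_mono (hR.trans (Metric.closedBall_subset_closedBall hk))) ?_
  exact (subset_iUnion (fun k : ℕ =>
    pullbackLimitSet φ (fun _ => Metric.closedBall 0 (k : ℝ)) t) k).trans subset_closure

lemma IsCompactProcess.infEDist_boundedLimitSet (hφ : IsCompactProcess φ C) (hβ : 0 < β)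
    (hε : 0 < ε) (hE : IsPullbackBounded φ (growthBall H β ε)) (t : ℝ) (x : H) :
    Metric.infEDist x (boundedLimitSet φ t) = ⨅ k : ℕ, liminf (fun q : ℚ =>
      Metric.infEDist x (φ t q '' Metric.closedBall 0 k)) atBot := by
  rw [boundedLimitSet, Metric.infEDist_closure, Metric.infEDist_iUnion]
  exact iInf_congr fun k =>
    hφ.infEDist_pullbackLimitSet_const (isPullbackBounded_closedBall hβ hε hE k) t x

end Attractor

/-! ### Measurability of distances and of the growth condition -/

lemma measurable_infEDist_image {Ω H : Type*} [MeasurableSpace Ω] [NormedAddCommGroup H]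
    [MeasurableSpace H] [BorelSpace H] [SecondCountableTopology H] {F : Ω → H → H}
    (hFc : ∀ ω, Continuous (F ω)) (hFm : ∀ y, Measurable fun ω => F ω y) (x : H) (B : Set H) :
    Measurable fun ω => Metric.infEDist x (F ω '' B) := by
  obtain ⟨D, hDB, hDc, hD⟩ :=
    (TopologicalSpace.IsSeparable.of_separableSpace B).exists_countable_dense_subset
  have h1 : ∀ ω, Metric.infEDist x (F ω '' B) = ⨅ y ∈ D, edist x (F ω y) := fun ω => by
    have h2 : Metric.infEDist x (F ω '' B) = Metric.infEDist x (F ω '' D) := by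
      apply le_antisymm (Metric.infEDist_anti (image_mono hDB))
      rw [← Metric.infEDist_closure (s := F ω '' D)]
      exact Metric.infEDist_anti ((image_mono hD).trans
        (image_closure_subset_closure_image (hFc ω)))
    rw [h2]
    exact iInf_image
  simp only [h1]
  exact .biInf D hDc fun y _ => measurable_const.edist (hFm y)

/-- By right-continuity, the growth condition can be checked at rational times. -/
lemma measurableSet_isLittleO {Ω V : Type*} [MeasurableSpace Ω] [NormedAddCommGroup V]
    [MeasurableSpace V] [BorelSpace V] {β : ℝ} (hβ : 0 < β) {N : ℝ → Ω → V}
    (hN : ∀ t, Measurable (N t)) (hc : ∀ ω t, ContinuousWithinAt (fun r => N r ω) (Ici t) t) :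
    MeasurableSet {ω | (fun t => N t ω) =o[atBot] fun t : ℝ => |t| ^ β} := by
  have h1 : {ω | (fun t => N t ω) =o[atBot] fun t : ℝ => |t| ^ β} = ⋂ m : ℕ, ⋃ k : ℕ, ⋂ q : ℚ,
      {ω | (q : ℝ) ≤ -k → ‖N q ω‖ ≤ 1 / ((m : ℝ) + 1) * |(q : ℝ)| ^ β} := by
    ext ω
    simp only [mem_ofPred_eq, mem_iInter, mem_iUnion]
    constructor
    · intro h m
      obtain ⟨T, hT⟩ := eventually_atBot.1 (h.def (show 0 < 1 / ((m : ℝ) + 1) by positivity))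
      obtain ⟨k, hk⟩ := exists_nat_ge (-T)
      refine ⟨k, fun q hq => ?_⟩
      have h2 := hT q (by linarith)
      rwa [Real.norm_of_nonneg (by positivity)] at h2
    · intro h
      refine Asymptotics.isLittleO_iff.2 fun δ hδ => ?_
      obtain ⟨m, hm⟩ := exists_nat_one_div_lt hδ
      obtain ⟨k, hk⟩ := h m
      filter_upwards [eventually_lt_atBot (-(k : ℝ))] with t ht
      rw [Real.norm_of_nonneg (by positivity)]
      have h3 : Tendsto (fun r => ‖N r ω‖ - 1 / ((m : ℝ) + 1) * |r| ^ β) (𝓝[>] t)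
          (𝓝 (‖N t ω‖ - 1 / ((m : ℝ) + 1) * |t| ^ β)) := by
        refine Tendsto.sub ?_ ?_
        · exact ((hc ω t).tendsto.mono_left (nhdsWithin_mono _ Ioi_subset_Ici_self)).norm
        · have : Continuous fun r : ℝ => 1 / ((m : ℝ) + 1) * |r| ^ β :=
            (continuous_abs.rpow_const fun _ => Or.inr hβ.le).const_mul _
          exact (this.tendsto t).mono_left nhdsWithin_le_nhds
      have h4 : ‖N t ω‖ - 1 / ((m : ℝ) + 1) * |t| ^ β ≤ 0 := by
        refine le_of_tendsto_of_frequently h3 ((nhdsGT_basis t).frequently_iff.2 fun u hu => ?_)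
        obtain ⟨q, hq1, hq2⟩ := exists_rat_btwn (lt_min ht hu)
        refine ⟨q, ⟨hq1, hq2.trans_le (min_le_right _ _)⟩, ?_⟩
        have := hk q (hq2.trans_le (min_le_left _ _)).le
        linarith
      have h5 : 1 / ((m : ℝ) + 1) * |t| ^ β ≤ δ * |t| ^ β := by gcongr
      linarith
  rw [h1]
  refine .iInter fun m => .iUnion fun k => .iInter fun q => ?_
  by_cases hq : (q : ℝ) ≤ -k
  · simp only [hq, true_imp_iff]
    exact measurableSet_le (hN q).norm measurable_const
  · simp [hq]

/-! ### The flow of solutions -/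

section Shift

variable {V : Type*} [NormedAddCommGroup V] [NormedSpace ℝ V]
  {H : Type*} [NormedAddCommGroup H] [InnerProductSpace ℝ H] {ι : V →L[ℝ] H}
  {α s : ℝ} {B : ℝ → V → StrongDual ℝ V} {z : H} {Z : ℝ → H}

lemma IsVariationalSolution.congr {Z' : ℝ → H} (hZ : IsVariationalSolution ι α B s z Z)
    (h : EqOn Z' Z (Ici s)) : IsVariationalSolution ι α B s z Z' := by
  obtain ⟨hc, u, hu1, hu2, hu3⟩ := hZ
  refine ⟨hc.congr h, u, ?_, hu2, fun t ht => ?_⟩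
  · filter_upwards [hu1, ae_restrict_mem measurableSet_Ici] with r hr hrs
    rw [hr, h hrs]
  · rw [h (mem_Ici.2 ht)]
    exact hu3 t ht

lemma measurePreserving_sub_right_restrict (h : ℝ) {S T : Set ℝ} (hT : MeasurableSet T)
    (hST : (fun r => r - h) ⁻¹' T = S) :
    MeasurePreserving (fun r : ℝ => r - h) (volume.restrict S) (volume.restrict T) :=
  hST ▸ (measurePreserving_sub_right volume h).restrict_preimage hT

lemma MeasureTheory.MemLp.comp_sub_right_sub_const {E : Type*} [NormedAddCommGroup E] {p : ℝ≥0∞}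
    {u : ℝ → E} {a b : ℝ} (h : ℝ) (k : E) (hu : MemLp u p (volume.restrict (Icc a b))) :
    MemLp (fun r => u (r - h) - k) p (volume.restrict (Icc (a + h) (b + h))) :=
  (hu.comp_measurePreserving (measurePreserving_sub_right_restrict h measurableSet_Icc
    (by simp))).sub (memLp_const k)

/-- Translations in time by `h` and in space by `k` act on solutions. -/
lemma IsVariationalSolution.shift (hZ : IsVariationalSolution ι α B s z Z) (h : ℝ) (k : V) :
    IsVariationalSolution ι α (fun r v => B (r - h) (v + k)) (s + h) (z - ι k)
      fun t => Z (t - h) - ι k := by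
  obtain ⟨hc, u, hu1, hu2, hu3⟩ := hZ
  refine ⟨?_, fun r => u (r - h) - k, ?_, fun t => ?_, fun t ht => ?_⟩
  · refine (hc.comp (by fun_prop) fun t ht => ?_).sub continuousOn_const
    simp only [mem_Ici] at ht ⊢
    linarith
  · have h1 := (measurePreserving_sub_right_restrict h (measurableSet_Ici (a := s))
      (S := Ici (s + h)) (by simp)).quasiMeasurePreserving.ae hu1
    filter_upwards [h1] with r hr
    rw [map_sub, hr]
  · have := (hu2 (t - h)).comp_sub_right_sub_const h k
    rwa [sub_add_cancel] at this
  · obtain ⟨h1, h2⟩ := hu3 (t - h) (by linarith)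
    simp only [sub_add_cancel]
    constructor
    · have := h1.comp_sub_right h
      rwa [sub_add_cancel] at this
    · rw [intervalIntegral.integral_comp_sub_right (fun r => B r (u r)), add_sub_cancel_right]
      have h3 : ∀ x : H, toDualV ι (x - ι k) = toDualV ι x - toDualV ι (ι k) := fun x =>
        map_sub (toDualVₗ ι) x (ι k)
      rw [h3, h3, h2]
      abel

end Shift

section Flow

variable {Ω V H : Type*} [NormedAddCommGroup V] [NormedSpace ℝ V]
  [NormedAddCommGroup H] [InnerProductSpace ℝ H] {ι : V →L[ℝ] H}
  {α : ℝ} {A : ℝ → V → Ω → StrongDual ℝ V} {N : ℝ → Ω → V}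
  {C c : Ω → ℝ} {g : Ω → ℝ → ℝ} {S S' : ℝ → ℝ → Ω → H → H}

lemma IsSolutionFlow.apply_self (hS : IsSolutionFlow ι α A N S) (hd : DenseRange ι) (s : ℝ) (ω : Ω)
    (x : H) : S s s ω x = x :=
  sub_left_injective ((hS s ω x).apply_left hd)

variable [MeasurableSpace V]

/-- Existence of the flow; it is normalised to be the identity for reversed times. -/
lemma exists_isSolutionFlow [BorelSpace V]
    (hB : ∀ ω, IsMonotoneDrift ι α (fun t v => A t (v + N t ω) ω) (C ω) (c ω) (g ω))
    (hα : 1 < α) (hα2 : α < 2) (hι : IsGelfandTriple ι) (hcomp : IsCompactOperator ι) :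
    ∃ S : ℝ → ℝ → Ω → H → H, IsSolutionFlow ι α A N S ∧
      ∀ t s ω x, t < s → S t s ω x = x := by
  have := hι.complete_H
  have := hι.complete_V
  have := hι.separable_H
  have := hι.separableSpace
  have := hι.separableSpace_dual
  have := UniformSpace.secondCountable_of_separable H
  have := UniformSpace.secondCountable_of_separable V
  have := UniformSpace.secondCountable_of_separable (StrongDual ℝ V)
  obtain ⟨d, hd⟩ := TopologicalSpace.exists_dense_seq V
  obtain ⟨J, hJ, hJd⟩ := exists_galerkin_scheme hι.injective d
  choose Z hZ _ using fun s ω z =>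
    (hB ω).exists_isVariationalSolution hα hα2 hι hcomp hd hJ hJd s z
  refine ⟨fun t s ω x => if s ≤ t then Z s ω (x - ι (N s ω)) t + ι (N t ω) else x,
    fun s ω x => (hZ s ω (x - ι (N s ω))).congr fun t ht => ?_, fun t s ω x hts => ?_⟩
  · simp only [mem_Ici] at ht
    simp [ht]
  · simp [not_le.2 hts]

variable [BorelSpace V] [SecondCountableTopology (StrongDual ℝ V)]

lemma IsSolutionFlow.eq_of_le (hS : IsSolutionFlow ι α A N S) (hS' : IsSolutionFlow ι α A N S')
    (hd : DenseRange ι)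
    (hB : ∀ ω, IsMonotoneDrift ι α (fun t v => A t (v + N t ω) ω) (C ω) (c ω) (g ω)) (hα : 1 < α)
    {s t : ℝ} (hst : s ≤ t) (ω : Ω) (x : H) : S' t s ω x = S t s ω x :=
  sub_left_injective ((hS' s ω x).unique hd (hB ω) hα (hS s ω x) hst)

lemma IsSolutionFlow.isStochasticFlow (hS : IsSolutionFlow ι α A N S) (hd : DenseRange ι)
    (hB : ∀ ω, IsMonotoneDrift ι α (fun t v => A t (v + N t ω) ω) (C ω) (c ω) (g ω))
    (hα : 1 < α) : IsStochasticFlow S where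
  refl := hS.apply_self hd
  comp s r _ ω x hsr hrt :=
    sub_left_injective (((hS s ω x).restart hsr).unique hd (hB ω) hα (hS r ω (S r s ω x)) hrt)

lemma IsSolutionFlow.isCompactProcess [CompleteSpace H] (hS : IsSolutionFlow ι α A N S)
    (hd : DenseRange ι) (hcomp : IsCompactOperator ι)
    (hB : ∀ ω, IsMonotoneDrift ι α (fun t v => A t (v + N t ω) ω) (C ω) (c ω) (g ω))
    (hα : 1 < α) {ω : Ω} (hN : ∀ t, ContinuousWithinAt (fun r => N r ω) (Ici t) t) :
    IsCompactProcess (fun t s x => S t s ω x) (C ω / 2) where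
  comp s r t x hsr hrt := (hS.isStochasticFlow hd hB hα).comp s r t ω x hsr hrt
  norm_sub_le s t x y hst := by
    have h1 := (hS s ω x).norm_sub_sq_le hd (hB ω) hα (hS s ω y) hst
    simp only [sub_sub_sub_cancel_right] at h1
    have h2 : Real.exp (C ω * (t - s)) = Real.exp (C ω / 2 * (t - s)) ^ 2 := by
      rw [← Real.exp_nat_mul]
      congr 1
      push_cast
      ring
    rw [h2, mul_comm, ← mul_pow] at h1
    exact le_of_sq_le_sq h1 (by positivity)
  tendsto_right s x := by
    have h1 : Tendsto (fun r => S r s ω x - ι (N r ω)) (𝓝[>] s)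
        (𝓝 (S s s ω x - ι (N s ω))) :=
      ((hS s ω x).1 s self_mem_Ici).mono_left (nhdsWithin_mono _ Ioi_subset_Ici_self)
    have h2 : Tendsto (fun r => ι (N r ω)) (𝓝[>] s) (𝓝 (ι (N s ω))) :=
      (ι.continuous.tendsto _).comp ((hN s).mono_left (nhdsWithin_mono _ Ioi_subset_Ici_self))
    simpa [hS.apply_self hd] using h1.add h2
  exists_subseq s t hst x R hR := by
    obtain ⟨ψ, hψ, w, hw⟩ := exists_subseq_tendsto_of_isVariationalSolution hd hcomp (hB ω) hα
      (fun n => hS s ω (x n)) (R := R + ‖ι (N s ω)‖)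
      (fun n => (norm_sub_le _ _).trans (by gcongr; exact hR n)) hst
    exact ⟨ψ, hψ, w + ι (N t ω), by simpa using hw.add_const (ι (N t ω))⟩

/-- Stationarity of the drift and of the increments of the noise is inherited by the flow. -/
lemma IsSolutionFlow.apply_eq_shift [MeasurableSpace Ω] {P : Measure Ω} {θ : ℝ → Ω → Ω}
    (hS : IsSolutionFlow ι α A N S) (hd : DenseRange ι)
    (hB : ∀ ω, IsMonotoneDrift ι α (fun t v => A t (v + N t ω) ω) (C ω) (c ω) (g ω))
    (hα : 1 < α) (hθ : IsMetricDynamicalSystem P θ) (hA : IsStrictlyStationaryDrift θ A)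
    (hN : ∀ t s ω, N t ω - N s ω = N (t - s) (θ s ω) - N 0 (θ s ω))
    {s t : ℝ} (hst : s ≤ t) (h : ℝ) (ω : Ω) (x : H) :
    S t s ω x = S (t - h) (s - h) (θ h ω) x := by
  set k := N h ω - N 0 (θ h ω) with hk
  have hNk : ∀ r, N (r - h) (θ h ω) + k = N r ω := fun r => by
    rw [hk, add_sub_left_comm, ← hN r h ω]
    abel
  have h1 := (hS (s - h) (θ h ω) x).shift h k
  have h2 : (fun (r : ℝ) v => A (r - h) (v + k + N (r - h) (θ h ω)) (θ h ω)) =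
      fun r v => A r (v + N r ω) ω := by
    funext r v
    rw [hA (r - h), ← hθ.add, sub_add_cancel, ← hA r, add_assoc, add_comm k, hNk]
  simp only [h2, sub_add_cancel, sub_sub, ← map_add, hNk] at h1
  exact sub_left_injective ((hS s ω x).unique hd (hB ω) hα h1 hst)

lemma IsSolutionFlow.measurable [MeasurableSpace Ω] [CompleteSpace V] [SecondCountableTopology V]
    [CompleteSpace H] [SecondCountableTopology H] [MeasurableSpace H] [BorelSpace H]
    (hS : IsSolutionFlow ι α A N S) (hS' : ∀ t s ω x, t < s → S t s ω x = x)
    (hB : ∀ ω, IsMonotoneDrift ι α (fun t v => A t (v + N t ω) ω) (C ω) (c ω) (g ω))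
    (hα : 1 < α) (hα2 : α < 2) (hι : IsGelfandTriple ι) (hcomp : IsCompactOperator ι)
    (hA : IsMeasurableDrift A) (hNm : ∀ t, Measurable (N t))
    (hN : ∀ ω t, ContinuousWithinAt (fun r => N r ω) (Ici t) t) (t s : ℝ) (x : H) :
    Measurable fun ω => S t s ω x := by
  rcases lt_or_ge t s with hts | hst
  · simp only [hS' t s _ x hts, measurable_const]
  · have hN' : Measurable fun p : Ω × ℝ × V => N p.2.1 p.1 :=
      (measurable_of_rightContinuous hNm hN).comp (measurable_fst.prodMk measurable_snd.fst)
    have h1 := measurable_of_isVariationalSolution hB hα hα2 hι hcomp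
      (hA.comp (measurable_snd.fst.prodMk ((measurable_snd.snd.add hN').prodMk measurable_fst)))
      hst (measurable_const.sub (ι.continuous.measurable.comp (hNm s))) fun ω => hS s ω x
    have h2 : (fun ω => S t s ω x) = (fun ω => S t s ω x - ι (N t ω)) + fun ω => ι (N t ω) := by
      ext ω
      simp
    rw [h2]
    exact h1.add (ι.continuous.measurable.comp (hNm t))

end Flow

/-! ### Random attractors of flows -/

section RandomAttractor

variable {Ω H : Type*} [NormedAddCommGroup H] {β : ℝ}

/-- The process `φ` maps balls of radius `ε |s| ^ β` to bounded sets from the remote past, and they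
are absorbed there by balls of radius `ε' |t| ^ β` for every `ε'`. -/
structure IsAbsorbing (φ : ℝ → ℝ → H → H) (β ε : ℝ) : Prop where
  pos : 0 < ε
  bounded : IsPullbackBounded φ (growthBall H β ε)
  absorbs : ∀ ε' > 0, ∀ᶠ t in atBot, ∀ᶠ s in atBot, ∀ x ∈ growthBall H β ε s,
    φ t s x ∈ growthBall H β ε' t

/-- On the event `G`, the pullback limit set of the balls of radius `ε |s| ^ β`; empty off `G`. -/
def growthAttractor (S : ℝ → ℝ → Ω → H → H) (G : Set Ω) (β : ℝ) (ε : Ω → ℝ) (t : ℝ) (ω : Ω) :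
    Set H :=
  {y | ω ∈ G ∧ y ∈ pullbackLimitSet (fun t s => S t s ω) (growthBall H β (ε ω)) t}

/-- On the event `G`, the closure of the union of the pullback limit sets of all balls; empty
off `G`. -/
def boundedAttractor (S : ℝ → ℝ → Ω → H → H) (G : Set Ω) (t : ℝ) (ω : Ω) : Set H :=
  {y | ω ∈ G ∧ y ∈ boundedLimitSet (fun t s => S t s ω) t}

variable {S : ℝ → ℝ → Ω → H → H} {G : Set Ω} {ε : Ω → ℝ} {C : Ω → ℝ} {ω : Ω}

lemma growthAttractor_of_mem (hω : ω ∈ G) (t : ℝ) : growthAttractor S G β ε t ω =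
    pullbackLimitSet (fun t s => S t s ω) (growthBall H β (ε ω)) t := by
  simp [growthAttractor, hω]

lemma growthAttractor_of_notMem (hω : ω ∉ G) (t : ℝ) : growthAttractor S G β ε t ω = ∅ := by
  simp [growthAttractor, hω]

lemma boundedAttractor_of_mem (hω : ω ∈ G) (t : ℝ) :
    boundedAttractor S G t ω = boundedLimitSet (fun t s => S t s ω) t := by
  simp [boundedAttractor, hω]

lemma boundedAttractor_of_notMem (hω : ω ∉ G) (t : ℝ) : boundedAttractor S G t ω = ∅ := by
  simp [boundedAttractor, hω]

lemma growthAttractor_mem_subpolynomialFamilies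
    (hε : ∀ ω ∈ G, IsAbsorbing (fun t s => S t s ω) β (ε ω)) :
    growthAttractor S G β ε ∈ subpolynomialFamilies Ω H β := by
  intro ω
  refine tendsto_setNorm_div fun ε' hε' => ?_
  by_cases hω : ω ∈ G
  · filter_upwards [(hε ω hω).absorbs ε' hε'] with t ht
    rw [growthAttractor_of_mem hω]
    exact pullbackLimitSet_subset_growthBall ht
  · simp [growthAttractor_of_notMem hω]

lemma pullbackLimitSet_eq_of_shift {φ φ' : ℝ → ℝ → H → H} {h : ℝ}
    (hφ : ∀ t s x, φ t s x = φ' (t - h) (s - h) x) (B : Set H) (t : ℝ) :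
    pullbackLimitSet φ (fun _ => B) t = pullbackLimitSet φ' (fun _ => B) (t - h) := by
  ext y
  constructor
  · rintro ⟨s, x, hs, hx, hy⟩
    exact ⟨fun n => s n - h, x, tendsto_atBot_add_const_right _ (-h) hs, hx, by simpa [hφ] using hy⟩
  · rintro ⟨s, x, hs, hx, hy⟩
    exact ⟨fun n => s n + h, x, tendsto_atBot_add_const_right _ h hs, hx, by simpa [hφ] using hy⟩

lemma isStrictlyStationarySet_boundedAttractor {θ : ℝ → Ω → Ω}
    (hS : ∀ t s ω x h, S t s ω x = S (t - h) (s - h) (θ h ω) x)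
    (hG : ∀ h ω, θ h ω ∈ G ↔ ω ∈ G) : IsStrictlyStationarySet θ (boundedAttractor S G) := by
  intro t ω
  ext y
  simp only [boundedAttractor, boundedLimitSet, mem_ofPred_eq, hG]
  have h1 : ∀ k : ℕ,
      pullbackLimitSet (fun t s => S t s ω) (fun _ => Metric.closedBall 0 (k : ℝ)) t =
      pullbackLimitSet (fun r s => S r s (θ t ω)) (fun _ => Metric.closedBall 0 (k : ℝ)) 0 :=
    fun k => by
      rw [← sub_self t]
      exact pullbackLimitSet_eq_of_shift (fun r s x => hS r s ω x t) _ t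
  simp only [h1]

variable [MeasurableSpace Ω] {P : Measure Ω}

lemma isRandomAttractor_growthAttractor (hφ : ∀ ω, IsCompactProcess (fun t s => S t s ω) (C ω))
    (hG : ∀ᵐ ω ∂P, ω ∈ G) (hε : ∀ ω ∈ G, IsAbsorbing (fun t s => S t s ω) β (ε ω)) :
    IsRandomAttractor P (subpolynomialFamilies Ω H β) S (growthAttractor S G β ε) where
  nonempty_compact := by
    filter_upwards [hG] with ω hω t
    rw [growthAttractor_of_mem hω]
    exact ⟨(hφ ω).nonempty_pullbackLimitSet (hε ω hω).bounded
      (nonempty_growthBall (hε ω hω).pos.le) t,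
      (hφ ω).isCompact_pullbackLimitSet (hε ω hω).bounded t⟩
  attracting := by
    filter_upwards [hG] with ω hω D hD t
    rw [growthAttractor_of_mem hω]
    refine tendsto_of_tendsto_of_tendsto_of_le_of_le' tendsto_const_nhds
      ((hφ ω).tendsto_semiDist (hε ω hω).bounded t) (.of_forall fun s => zero_le) ?_
    filter_upwards [eventually_subset_growthBall (hε ω hω).pos (hD ω)] with s hs
    exact semiDist_mono (image_mono hs) subset_rfl
  invariant := by
    filter_upwards [hG] with ω hω s t hst
    rw [growthAttractor_of_mem hω, growthAttractor_of_mem hω]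
    exact (hφ ω).image_pullbackLimitSet (hε ω hω).bounded hst

lemma isRandomAttractor_boundedAttractor (hβ : 0 < β)
    (hφ : ∀ ω, IsCompactProcess (fun t s => S t s ω) (C ω))
    (hG : ∀ᵐ ω ∂P, ω ∈ G) (hε : ∀ ω ∈ G, IsAbsorbing (fun t s => S t s ω) β (ε ω)) :
    IsRandomAttractor P (deterministicBoundedFamilies Ω H) S (boundedAttractor S G) where
  nonempty_compact := by
    filter_upwards [hG] with ω hω t
    rw [boundedAttractor_of_mem hω]
    exact ⟨(hφ ω).nonempty_boundedLimitSet hβ (hε ω hω).pos (hε ω hω).bounded t,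
      (hφ ω).isCompact_boundedLimitSet hβ (hε ω hω).pos (hε ω hω).bounded t⟩
  attracting := by
    filter_upwards [hG] with ω hω D hD t
    obtain ⟨B, hB, rfl⟩ := hD
    rw [boundedAttractor_of_mem hω]
    exact (hφ ω).tendsto_semiDist_boundedLimitSet hβ (hε ω hω).pos (hε ω hω).bounded hB t
  invariant := by
    filter_upwards [hG] with ω hω s t hst
    rw [boundedAttractor_of_mem hω, boundedAttractor_of_mem hω]
    exact (hφ ω).image_boundedLimitSet hβ (hε ω hω).pos (hε ω hω).bounded hst

variable [MeasurableSpace H] [BorelSpace H] [SecondCountableTopology H]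

open Classical in
/-- The rate `ε` need not be measurable, as it does not enter the formula for the distance. -/
lemma isRandomClosedSet_growthAttractor (hφ : ∀ ω, IsCompactProcess (fun t s => S t s ω) (C ω))
    (hG : ∀ᵐ ω ∂P, ω ∈ G) (hGm : MeasurableSet G)
    (hε : ∀ ω ∈ G, IsAbsorbing (fun t s => S t s ω) β (ε ω))
    (hSc : ∀ t s ω, Continuous (S t s ω)) (hSm : ∀ t s x, Measurable fun ω => S t s ω x) :
    IsRandomClosedSet P (growthAttractor S G β ε) := by
  refine ⟨?_, fun t x => ?_⟩
  · filter_upwards [hG] with ω hω t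
    rw [growthAttractor_of_mem hω]
    exact ((hφ ω).isCompact_pullbackLimitSet (hε ω hω).bounded t).isClosed
  · have h1 : (fun ω => Metric.infEDist x (growthAttractor S G β ε t ω)) = fun ω =>
        if ω ∈ G then liminf (fun m : ℕ => liminf (fun k : ℕ => Metric.infEDist x
          (S t (-k) ω '' growthBall H β (1 / ((m : ℝ) + 1)) (-k))) atTop) atTop else ⊤ := by
      funext ω
      split_ifs with hω
      · rw [growthAttractor_of_mem hω]
        exact (hφ ω).infEDist_pullbackLimitSet_growthBall (hε ω hω).pos (hε ω hω).bounded
          (hε ω hω).absorbs t x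
      · rw [growthAttractor_of_notMem hω, Metric.infEDist_empty]
    rw [h1]
    exact Measurable.ite hGm (.liminf fun m => .liminf fun k =>
      measurable_infEDist_image (fun ω => hSc t (-k) ω) (hSm t (-k)) x _) measurable_const

open Classical in
lemma isRandomClosedSet_boundedAttractor (hβ : 0 < β)
    (hφ : ∀ ω, IsCompactProcess (fun t s => S t s ω) (C ω))
    (hG : ∀ᵐ ω ∂P, ω ∈ G) (hGm : MeasurableSet G)
    (hε : ∀ ω ∈ G, IsAbsorbing (fun t s => S t s ω) β (ε ω))
    (hSc : ∀ t s ω, Continuous (S t s ω)) (hSm : ∀ t s x, Measurable fun ω => S t s ω x) :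
    IsRandomClosedSet P (boundedAttractor S G) := by
  refine ⟨?_, fun t x => ?_⟩
  · filter_upwards [hG] with ω hω t
    rw [boundedAttractor_of_mem hω]
    exact isClosed_closure
  · have h1 : (fun ω => Metric.infEDist x (boundedAttractor S G t ω)) = fun ω =>
        if ω ∈ G then ⨅ k : ℕ, liminf (fun q : ℚ => Metric.infEDist x
          (S t q ω '' Metric.closedBall 0 k)) atBot else ⊤ := by
      funext ω
      split_ifs with hω
      · rw [boundedAttractor_of_mem hω]
        exact (hφ ω).infEDist_boundedLimitSet hβ (hε ω hω).pos (hε ω hω).bounded t x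
      · rw [boundedAttractor_of_notMem hω, Metric.infEDist_empty]
    rw [h1]
    refine Measurable.ite hGm (.iInf fun k => ?_) measurable_const
    exact Measurable.liminf' (fun q : ℚ => measurable_infEDist_image (fun ω => hSc t q ω)
      (hSm t q) x _) ⟨atBot_basis, to_countable _⟩ fun q => to_countable _

end RandomAttractor

/-! ### Growth of the noise and of the error function -/

section Growth

variable {V : Type*} [NormedAddCommGroup V] {α β : ℝ}

lemma isLittleO_const_rpow_abs_atBot (hβ : 0 < β) (k : V) :
    (fun _ => k) =o[atBot] fun t : ℝ => |t| ^ β :=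
  Asymptotics.isLittleO_const_left.2 <| Or.inr <| tendsto_norm_atTop_atTop.comp <|
    (tendsto_rpow_atTop hβ).comp tendsto_abs_atBot_atTop

lemma isBigO_rpow_abs_add_const (hβ : 0 < β) (h : ℝ) :
    (fun t : ℝ => |t + h| ^ β) =O[atBot] fun t : ℝ => |t| ^ β := by
  refine Asymptotics.IsBigO.of_bound (2 ^ β) ?_
  filter_upwards [eventually_le_atBot (-|h|)] with t ht
  have h1 : |t + h| ≤ 2 * |t| := by
    have h2 := abs_add_le t h
    have h3 : |h| ≤ |t| := by
      rw [abs_of_nonpos (ht.trans (neg_nonpos.2 (abs_nonneg h)))]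
      linarith
    linarith
  rw [Real.norm_of_nonneg (by positivity), Real.norm_of_nonneg (by positivity),
    ← Real.mul_rpow (by norm_num) (abs_nonneg t)]
  gcongr

/-- The growth condition on the noise is invariant under the shift. -/
lemma isLittleO_shift_iff {Ω : Type*} [MeasurableSpace Ω] {P : Measure Ω} {θ : ℝ → Ω → Ω}
    {N : ℝ → Ω → V} (hθ : IsMetricDynamicalSystem P θ)
    (hN : ∀ t s ω, N t ω - N s ω = N (t - s) (θ s ω) - N 0 (θ s ω)) (hβ : 0 < β) (h : ℝ) (ω : Ω) :
    ((fun t => N t (θ h ω)) =o[atBot] fun t : ℝ => |t| ^ β) ↔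
      (fun t => N t ω) =o[atBot] fun t : ℝ => |t| ^ β := by
  have key : ∀ h ω, ((fun t => N t ω) =o[atBot] fun t : ℝ => |t| ^ β) →
      (fun t => N t (θ h ω)) =o[atBot] fun t : ℝ => |t| ^ β := by
    intro h ω hω
    have h1 : (fun t => N (t + h) ω) =o[atBot] fun t : ℝ => |t| ^ β :=
      (hω.comp_tendsto (tendsto_atBot_add_const_right _ h tendsto_id)).trans_isBigO
        (isBigO_rpow_abs_add_const hβ h)
    refine (h1.add (isLittleO_const_rpow_abs_atBot hβ (N 0 (θ h ω) - N h ω))).congr_left fun t => ?_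
    have h2 := hN (t + h) h ω
    rw [add_sub_cancel_right] at h2
    rw [← sub_add_cancel (N t (θ h ω)) (N 0 (θ h ω)), ← h2]
    abel
  refine ⟨fun hω => ?_, key h ω⟩
  have := key (-h) _ hω
  rwa [← hθ.add, neg_add_cancel, hθ.zero] at this

lemma eventually_le_of_isLittleO (hα : 0 < α) {f : ℝ → ℝ} {n : ℝ → V} {K : ℝ}
    (hK : 0 ≤ K) (hf : f =o[atBot] fun t : ℝ => |t| ^ (α * β))
    (hn : n =o[atBot] fun t : ℝ => |t| ^ β) {η : ℝ} (hη : 0 < η) :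
    ∀ᶠ t in atBot, 2 * f t + K * ‖n t‖ ^ α ≤ η * |t| ^ (α * β) := by
  set δ := (η / (2 * (K + 1))) ^ α⁻¹ with hδ
  have hδ0 : 0 < δ := by positivity
  have hδα : δ ^ α = η / (2 * (K + 1)) := Real.rpow_inv_rpow (by positivity) hα.ne'
  filter_upwards [hf.def (show 0 < η / 4 by positivity), hn.def hδ0] with t h1 h2
  rw [Real.norm_of_nonneg (show 0 ≤ |t| ^ (α * β) by positivity)] at h1
  rw [Real.norm_of_nonneg (by positivity)] at h2
  have h3 := (le_abs_self _).trans h1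
  have h4 : ‖n t‖ ^ α ≤ η / (2 * (K + 1)) * |t| ^ (α * β) := by
    calc ‖n t‖ ^ α ≤ (δ * |t| ^ β) ^ α := by gcongr
      _ = _ := by
        rw [Real.mul_rpow hδ0.le (by positivity), hδα, ← Real.rpow_mul (abs_nonneg t), mul_comm β]
  have h5 : K * ‖n t‖ ^ α ≤ η / 2 * |t| ^ (α * β) := by
    calc K * ‖n t‖ ^ α ≤ (K + 1) * (η / (2 * (K + 1)) * |t| ^ (α * β)) := by
          gcongr
          linarith
      _ = _ := by field_simp
  linarith

end Growth

/-! ### Existence of the attractors -/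

theorem mainTheorem1
    {Ω : Type*} [MeasurableSpace Ω] (P : Measure Ω) [IsProbabilityMeasure P]
    (θ : ℝ → Ω → Ω) (hθ : IsMetricDynamicalSystem P θ)
    {V : Type*} [NormedAddCommGroup V] [NormedSpace ℝ V] [MeasurableSpace V] [BorelSpace V]
    {H : Type*} [NormedAddCommGroup H] [InnerProductSpace ℝ H]
    (ι : V →L[ℝ] H) (hι : IsGelfandTriple ι)
    (α : ℝ) (hα : α ∈ Ioo (1 : ℝ) 2)
    (A : ℝ → V → Ω → StrongDual ℝ V) (C₁ C₂ c f : ℝ → Ω → ℝ)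
    (hA : DriftAssumptions ι A α C₁ C₂ c f)
    -- the embedding of `V` into `H` is compact
    (hcompact : IsCompactOperator ι)
    (hC₁ : ∀ t ω, C₁ t ω = 0)
    (hC₂ : ∀ s t ω, C₂ s ω = C₂ t ω)
    (hc : ∀ s t ω, c s ω = c t ω)
    (hf_cadlag : ∀ ω, IsCadlag (fun t => f t ω))
    (hf_growth : ∀ ω, (fun t => f t ω) =o[atBot] (fun t : ℝ => |t| ^ (α / (2 - α))))
    (N : ℝ → Ω → V) (hN : NoiseAssumptions P θ α N) :
    ∃ S : ℝ → ℝ → Ω → H → H,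
      -- `S` is the unique flow of solutions
      IsSolutionFlow ι α A N S ∧
      (∀ S' : ℝ → ℝ → Ω → H → H, IsSolutionFlow ι α A N S' →
        ∀ s t ω x, s ≤ t → S' t s ω x = S t s ω x) ∧
      IsStochasticFlow S ∧
      -- random attractor for the families of subpolynomial growth
      (∃ 𝒜 : ℝ → Ω → Set H,
        IsRandomAttractor P (subpolynomialFamilies Ω H (1 / (2 - α))) S 𝒜 ∧
        𝒜 ∈ subpolynomialFamilies Ω H (1 / (2 - α)) ∧
        (IsMeasurableDrift A → (∀ t, Measurable (f t)) → IsRandomClosedSet P 𝒜)) ∧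
      -- strictly stationary random attractor for deterministic bounded sets
      (IsStrictlyStationaryDrift θ A →
        ∃ 𝒜 : ℝ → Ω → Set H,
          IsRandomAttractor P (deterministicBoundedFamilies Ω H) S 𝒜 ∧
          IsStrictlyStationarySet θ 𝒜 ∧
          (IsMeasurableDrift A → IsRandomClosedSet P 𝒜)) := by
  obtain ⟨hα1, hα2⟩ := hα
  have := hι.complete_H
  have := hι.complete_V
  have := hι.separable_H
  have := hι.separableSpace
  have := hι.separableSpace_dual
  have := UniformSpace.secondCountable_of_separable H
  have := UniformSpace.secondCountable_of_separable V
  have := UniformSpace.secondCountable_of_separable (StrongDual ℝ V)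
  borelize H
  have hd := hι.denseRange
  have hα0 : 0 < α := by linarith
  have h2α : 0 < 2 - α := by linarith
  have hβ : 0 < 1 / (2 - α) := by positivity
  have hNc : ∀ ω t, ContinuousWithinAt (fun r => N r ω) (Ici t) t := fun ω t => (hN.cadlag ω t).1
  have hNm : ∀ ω, Measurable fun t => N t ω := fun ω =>
    (measurable_of_rightContinuous hN.measurable hNc).comp measurable_prodMk_left
  -- these constants are chosen for each `ω`; no measurability in `ω` is needed
  choose C c' K hK hB using fun ω => hA.exists_isMonotoneDrift hα1 hC₁ hC₂ hc (hf_cadlag ω)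
    (hN.cadlag ω) (hNm ω)
  obtain ⟨S, hS, hS'⟩ := exists_isSolutionFlow hB hα1 hα2 hι hcompact
  have hφ : ∀ ω, IsCompactProcess (fun t s => S t s ω) (C ω / 2) := fun ω =>
    hS.isCompactProcess hd hcompact hB hα1 (hNc ω)
  have hSc : ∀ t s ω, Continuous (S t s ω) := fun t s ω => by
    rcases lt_or_ge t s with hts | hst
    · exact continuous_id.congr fun x => (hS' t s ω x hts).symm
    · exact (hφ ω).continuous hst
  have hSm : IsMeasurableDrift A → ∀ t s x, Measurable fun ω => S t s ω x := fun hAm t s x =>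
    hS.measurable hS' hB hα1 hα2 hι hcompact hAm hN.measurable hNc t s x
  -- the event on which the noise has the required growth; it is invariant under `θ`
  set G : Set Ω := {ω | (fun t => N t ω) =o[atBot] fun t : ℝ => |t| ^ (1 / (2 - α))} with hG
  have hGm : MeasurableSet G := measurableSet_isLittleO hβ hN.measurable hNc
  have habs : ∀ ω ∈ G, ∃ ε, IsAbsorbing (fun t s => S t s ω) (1 / (2 - α)) ε := fun ω hω => by
    obtain ⟨ε, hε, h1, h2⟩ := exists_absorption hd (hB ω) hα1 hα2 (fun s x => hS s ω x) hω
      fun η hη => eventually_le_of_isLittleO hα0 (hK ω)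
        (by simpa only [mul_one_div] using hf_growth ω) hω hη
    exact ⟨ε, hε, h1, h2⟩
  choose! ε hε using habs
  refine ⟨S, hS, fun S' hS' s t ω x hst => hS.eq_of_le hS' hd hB hα1 hst ω x,
    hS.isStochasticFlow hd hB hα1, ⟨growthAttractor S G (1 / (2 - α)) ε,
      isRandomAttractor_growthAttractor hφ hN.growth hε,
      growthAttractor_mem_subpolynomialFamilies hε, fun hAm _ =>
      isRandomClosedSet_growthAttractor hφ hN.growth hGm hε hSc (hSm hAm)⟩,
    fun hAs => ⟨boundedAttractor S G, isRandomAttractor_boundedAttractor hβ hφ hN.growth hε, ?_,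
      fun hAm => isRandomClosedSet_boundedAttractor hβ hφ hN.growth hGm hε hSc (hSm hAm)⟩⟩
  refine isStrictlyStationarySet_boundedAttractor (fun t s ω x h => ?_) fun h ω =>
    isLittleO_shift_iff hθ hN.stationary_increments hβ h ω
  rcases lt_or_ge t s with hts | hst
  · rw [hS' t s ω x hts, hS' _ _ _ x (sub_lt_sub_right hts h)]
  · exact hS.apply_eq_shift hd hB hα1 hθ hAs hN.stationary_increments hst h ω x
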